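/- Let $(X,\mu)$ be a probability Lebesgue space. An automorphism $T$ of $(X,\mu)$ (an invertible measure-preserving transformation) is called a rank-one transformation with height sequence $(h_j)$ if there are measurable sets $E_j\subset X$ such that, for every $j$, the floors $E_j, TE_j,\dots,T^{h_j}E_j$ are pairwise disjoint and the partitions $\xi_j=\{E_j,TE_j,\dots,T^{h_j}E_j,E_j'\}$, where $E_j'=X\setminus\bigcup_{i=0}^{h_j}T^iE_j$, converge to the partition into points, that is, for every measurable $A$ there are unions $A_j$ of cells of $\xi_j$ with $\mu(A\,\triangle\,A_j)\to0$. The automorphism $T$ is mixing if $\mu(A\cap T^mB)\to\mu(A)\mu(B)$ as $m\to\infty$ for all measurable $A,B$. A joining of automorphisms $\tilde T$ and $T$ is a $(\tilde T\times T)$-invariant measure $\nu$ on $X\times X$ with $\nu(A\times X)=\nu(X\times A)=\mu(A)$ for all measurable $A$; it is ergodic if $(\tilde T\times T,X\times X,\nu)$ is ergodic. The automorphisms $\tilde T$ and $T$ are disjoint if $\mu\otimes\mu$ is their only joining. **Theorem 1.** Let $\tilde T$ and $T$ be rank-one transformations of $(X,\mu)$ with height sequences $(\tilde h_j)$ and $(h_j)$,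 respectively, and suppose that $\tilde h_j/h_j\to\alpha$ for some $\alpha\in(0,1)$. If at least one of $T$, $\tilde T$ is mixing, then every ergodic joining $\nu$ of $\tilde T$ and $T$ equals $\mu\otimes\mu$, and $\tilde T$ and $T$ are disjoint. -/

import Mathlib

open MeasureTheory Filter Topology Set
open scoped symmDiff

/-- The `i`-th floor `T^i E` of the tower over `E`. -/
def towerFloor {X : Type*} (T : X → X) (E : Set X) (i : ℕ) : Set X :=
  T^[i] '' E

/-- The part `E' = X \ (E ∪ T E ∪ ⋯ ∪ T^h E)` of the space not covered by the tower. -/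
def towerResidual {X : Type*} (T : X → X) (E : Set X) (h : ℕ) : Set X :=
  (⋃ i ∈ Set.Iic h, towerFloor T E i)ᶜ

/-- The partition `{E, T E, …, T^h E, E'}` determined by the tower, as a set of cells. -/
def towerPartition {X : Type*} (T : X → X) (E : Set X) (h : ℕ) : Set (Set X) :=
  towerFloor T E '' Set.Iic h ∪ {towerResidual T E h}

/-- The partitions `ξ j` converge to the partition into points: every measurable set is
approximated in measure by unions of cells of `ξ j` as `j → ∞`. -/
def ConvergesToPoints {X : Type*} [MeasurableSpace X] (μ : Measure X)
    (ξ : ℕ → Set (Set X)) : Prop :=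
  ∀ A : Set X, MeasurableSet A →
    ∃ S : ℕ → Set (Set X), (∀ j, S j ⊆ ξ j) ∧
      Tendsto (fun j => μ (A ∆ ⋃₀ S j)) atTop (𝓝 0)

/-- `T` is an automorphism (invertible measure-preserving map) of rank one, and `h` is the height
sequence of a sequence of Rokhlin towers `E j, T (E j), …, T^(h j) (E j)` (with pairwise disjoint
floors) whose partitions converge to the partition into points. -/
structure IsRankOne {X : Type*} [MeasurableSpace X] (μ : Measure X) (T : X ≃ᵐ X)
    (h : ℕ → ℕ) : Prop where
  measurePreserving : MeasurePreserving T μ μ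
  exists_towers : ∃ E : ℕ → Set X,
    (∀ j, MeasurableSet (E j)) ∧
    (∀ j, (Set.Iic (h j)).PairwiseDisjoint (towerFloor T (E j))) ∧
    ConvergesToPoints μ (fun j => towerPartition T (E j) (h j))

/-- (2-fold) mixing: `μ (A ∩ T^m B) → μ A * μ B` for all measurable `A`, `B`. -/
def IsMixing {X : Type*} [MeasurableSpace X] (μ : Measure X) (T : X ≃ᵐ X) : Prop :=
  ∀ A B : Set X, MeasurableSet A → MeasurableSet B →
    Tendsto (fun m : ℕ => μ (A ∩ T^[m] '' B)) atTop (𝓝 (μ A * μ B))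

/-- `ν` is a joining of `S` and `T`: an `(S × T)`-invariant measure on `X × X` both of whose
marginals are `μ`. -/
structure IsJoining {X : Type*} [MeasurableSpace X] (μ : Measure X) (S T : X ≃ᵐ X)
    (ν : Measure (X × X)) : Prop where
  invariant : MeasurePreserving (Prod.map S T) ν ν
  fst_marginal : ∀ A : Set X, MeasurableSet A → ν (A ×ˢ Set.univ) = μ A
  snd_marginal : ∀ A : Set X, MeasurableSet A → ν (Set.univ ×ˢ A) = μ A

/-- `S` and `T` are disjoint: `μ × μ` is their unique joining. -/
def AreDisjoint {X : Type*} [MeasurableSpace X] (μ : Measure X) (S T : X ≃ᵐ X) : Prop :=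
  ∀ ν : Measure (X × X), IsJoining μ S T ν ↔ ν = μ.prod μ

/-! Let `F j` (with `k j` floors) and `E j` (with `n j` floors) be the towers of `S` and `T`, and
let `k j / n j → β ≠ 1`. Swapping the coordinates inverts the ratio, so `T` may be taken mixing, at
the price of treating both `β < 1` and `β > 1`. It suffices to bound every joining on every
rectangle `A × B` by `μ(A) μ(B)`: the bounds for `A × B` and `A × Bᶜ` together force equality
(`IsJoining.eq_prod_of_le`). So suppose that the supremum `σ` of `m(A × B)` over joinings `m`
exceeds `μ(A) μ(B)`. Finitely additive joinings are admitted, so that limits along an ultrafilter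
exist on all measurable sets at once.

Blocks. Cut the `S`-tower into `L` pieces of `ℓ = k j / L` floors. A run of `ℓ` consecutive floor
rectangles along a diagonal carries a block charge. Limits of block charges are again joinings, so
each gives `A × B` at most `σ + o(1)` (`eventually_blockCharge_le`). Conversely, up to an edge
effect of order `1 / L`, every joining is an average of block charges (`eventually_le_sum_block`).

Concentration. By mixing, two columns of the `T`-tower that start far apart are nearly uncorrelated,
so a second-moment estimate shows that blocks with spread-out weights average to at most about `μ(A)
μ(B)`. A joining with value close to `σ` therefore puts nearly all its mass on a bounded number of
offsets between the two towers, the bound being independent of `j` (`exists_concentration`).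

Contradiction for `β < 1`. The `S`-tower is too short for a bounded window of offsets over each
piece to fill the `T`-tower. So over some piece there are two offsets, arbitrarily far apart, whose
blocks are both nearly maximal. Gluing them over the common piece yields in the limit a law of `(x,
y, y')` with `(x, y)` and `(x, y')` nearly maximal and, by mixing, `y` and `y'` independent.
Concentration confines the offset of `y'` from `y` to boundedly many values with large probability,
which independence forbids.

Contradiction for `β > 1`. A definite proportion of `x` stays in the `S`-tower for `n j` more steps.
If the offset is one of boundedly many both before and after these steps, then `y` returns to its
own floor at one of boundedly many times, each at least `n j`. Mixing makes the set of such `y`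
small (`IsTowerSeq.eventually_return_le`).

The value `β = 1` has to be excluded: the diagonal is a joining of `T` with itself. -/

/-! ### Floors of a tower. -/

section Floors

variable {X : Type*}

theorem mem_towerFloor [MeasurableSpace X] {T : X ≃ᵐ X} {E : Set X} {i : ℕ} {x : X} :
    x ∈ towerFloor T E i ↔ T.symm^[i] x ∈ E := by
  have hl : Function.LeftInverse (T.symm^[i]) (T^[i]) :=
    Function.LeftInverse.iterate T.symm_apply_apply i
  have hr : Function.RightInverse (T.symm^[i]) (T^[i]) :=
    Function.RightInverse.iterate T.apply_symm_apply i
  constructor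
  · rintro ⟨y, hy, rfl⟩
    rwa [hl y]
  · exact fun h => ⟨_, h, hr x⟩

theorem towerFloor_eq_preimage [MeasurableSpace X] (T : X ≃ᵐ X) (E : Set X) (i : ℕ) :
    towerFloor T E i = T.symm^[i] ⁻¹' E := ext fun _ => mem_towerFloor

theorem towerFloor_zero (T : X → X) (E : Set X) : towerFloor T E 0 = E := by simp [towerFloor]

theorem towerFloor_add (T : X → X) (E : Set X) (i k : ℕ) :
    towerFloor T (towerFloor T E i) k = towerFloor T E (i + k) := by
  simp only [towerFloor, ← image_comp, ← Function.iterate_add, add_comm]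

theorem iterate_mem_towerFloor {T : X → X} {E : Set X} {i : ℕ} (k : ℕ) {x : X}
    (h : x ∈ towerFloor T E i) : T^[k] x ∈ towerFloor T E (i + k) := by
  rw [← towerFloor_add]
  exact mem_image_of_mem _ h

theorem iterate_mem_towerFloor_iff [MeasurableSpace X] {T : X ≃ᵐ X} {E : Set X} {i k : ℕ} {x : X} :
    T^[k] x ∈ towerFloor T E (i + k) ↔ x ∈ towerFloor T E i := by
  rw [← towerFloor_add]
  exact (T.injective.iterate k).mem_set_image

theorem preimage_towerFloor [MeasurableSpace X] (T : X ≃ᵐ X) (E : Set X) (i k : ℕ) :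
    T^[k] ⁻¹' towerFloor T E (i + k) = towerFloor T E i :=
  ext fun _ => iterate_mem_towerFloor_iff

theorem measurableSet_towerFloor [MeasurableSpace X] (T : X ≃ᵐ X) {E : Set X}
    (hE : MeasurableSet E) (i : ℕ) : MeasurableSet (towerFloor T E i) := by
  rw [towerFloor_eq_preimage]
  exact T.symm.measurable.iterate i hE

theorem measureReal_towerFloor [MeasurableSpace X] {μ : Measure X} {T : X ≃ᵐ X}
    (hT : MeasurePreserving T μ μ) {E : Set X} (hE : MeasurableSet E) (i : ℕ) :
    μ.real (towerFloor T E i) = μ.real E := by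
  rw [towerFloor_eq_preimage]
  exact (hT.symm T |>.iterate i).measureReal_preimage hE.nullMeasurableSet

end Floors

/-! ### Nearly invariant sets and unions of consecutive floors. -/

section NearInvariant

variable {X : Type*} [MeasurableSpace X] {μ : Measure X} [IsProbabilityMeasure μ] {T : X ≃ᵐ X}

/-- `C` and `T⁻¹ C` have equal measure, so each exceeds the other by at most `γ`; replacing one by
the other in `μ (T⁻¹ (C ∩ B)) = μ (C ∩ B)` costs no more. -/
theorem measureReal_inter_preimage_le (hT : MeasurePreserving T μ μ) {C : Set X}
    (hC : MeasurableSet C) {γ : ℝ} (hγ : μ.real (C \ T ⁻¹' C) ≤ γ) {B : Set X}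
    (hB : MeasurableSet B) : |μ.real (C ∩ T ⁻¹' B) - μ.real (C ∩ B)| ≤ γ := by
  have hTC : MeasurableSet (T ⁻¹' C) := T.measurable hC
  have hTB : MeasurableSet (T ⁻¹' B) := T.measurable hB
  have e1 : μ.real (T ⁻¹' (C ∩ B)) = μ.real (C ∩ B) :=
    hT.measureReal_preimage (hC.inter hB).nullMeasurableSet
  have e2 : μ.real (T ⁻¹' C) = μ.real C := hT.measureReal_preimage hC.nullMeasurableSet
  have e3 := measureReal_inter_add_sdiff (μ := μ) (s := C) hTC
  have e4 := measureReal_inter_add_sdiff (μ := μ) (s := T ⁻¹' C) hC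
  rw [inter_comm] at e4
  have e5 : μ.real (C ∩ T ⁻¹' B) ≤ μ.real (T ⁻¹' (C ∩ B)) + μ.real (C \ T ⁻¹' C) :=
    (measureReal_mono (by intro x; simp only [mem_inter_iff, mem_preimage, mem_union, Set.mem_sdiff]; tauto)).trans
      (measureReal_union_le _ _)
  have e6 : μ.real (T ⁻¹' (C ∩ B)) ≤ μ.real (C ∩ T ⁻¹' B) + μ.real (T ⁻¹' C \ C) :=
    (measureReal_mono (by intro x; simp only [mem_inter_iff, mem_preimage, mem_union, Set.mem_sdiff]; tauto)).trans
      (measureReal_union_le _ _)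
  rw [abs_le]; constructor <;> linarith

theorem measureReal_inter_iterate_preimage_le (hT : MeasurePreserving T μ μ) {C : Set X}
    (hC : MeasurableSet C) {γ : ℝ} (hγ : μ.real (C \ T ⁻¹' C) ≤ γ) {B : Set X}
    (hB : MeasurableSet B) (n : ℕ) :
    |μ.real (C ∩ T^[n] ⁻¹' B) - μ.real (C ∩ B)| ≤ n * γ := by
  induction n with
  | zero => simp
  | succ n ih =>
    have := measureReal_inter_preimage_le hT hC hγ ((T.measurable.iterate n) hB)
    rw [← preimage_comp, ← Function.iterate_succ] at this
    push_cast
    calc _ ≤ _ := abs_sub_le _ (μ.real (C ∩ T^[n] ⁻¹' B)) _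
      _ ≤ _ := by linarith

/-- Only points of the top level can leave the union in one step. Hence a column of floors over a
base of small measure is nearly invariant, however tall it is. -/
theorem measureReal_orbitUnion_diff_preimage_le {G : Set X} (hT : MeasurePreserving T μ μ)
    (hG : MeasurableSet G) (ℓ : ℕ) :
    μ.real ((⋃ t ∈ Iio ℓ, towerFloor T G t) \ T ⁻¹' (⋃ t ∈ Iio ℓ, towerFloor T G t))
      ≤ μ.real G := by
  rcases Nat.eq_zero_or_pos ℓ with rfl | hℓ
  · simp
  refine (measureReal_mono ?_).trans (measureReal_towerFloor hT hG (ℓ - 1)).le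
  rintro x ⟨hx, hx'⟩
  simp only [mem_iUnion, mem_preimage, exists_prop, mem_Iio, not_exists, not_and] at hx hx'
  obtain ⟨t, ht, hxt⟩ := hx
  have h1 : ¬ t + 1 < ℓ := fun h => hx' (t + 1) h (iterate_mem_towerFloor 1 hxt)
  rwa [show ℓ - 1 = t by omega]

theorem measurableSet_orbitUnion (T : X ≃ᵐ X) {G : Set X} (hG : MeasurableSet G) (ℓ : ℕ) :
    MeasurableSet (⋃ t ∈ Iio ℓ, towerFloor T G t) :=
  MeasurableSet.biUnion (to_countable _) fun i _ => measurableSet_towerFloor T hG i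

theorem measureReal_orbitUnion_inter {G : Set X} (hT : MeasurePreserving T μ μ)
    (hG : MeasurableSet G) {ℓ : ℕ} (hd : (Iio ℓ).PairwiseDisjoint (towerFloor T G)) {B : Set X}
    (hB : MeasurableSet B) :
    μ.real ((⋃ t ∈ Iio ℓ, towerFloor T G t) ∩ B)
      = ∑ t ∈ Finset.range ℓ, μ.real (G ∩ T^[t] ⁻¹' B) := by
  have h1 : (⋃ t ∈ Iio ℓ, towerFloor T G t) ∩ B
      = ⋃ t ∈ Finset.range ℓ, (towerFloor T G t ∩ B) := by
    ext x; simp; tauto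
  rw [h1, measureReal_biUnion_finset]
  · refine Finset.sum_congr rfl fun t _ => ?_
    rw [← (hT.iterate t).measureReal_preimage
      ((measurableSet_towerFloor T hG t).inter hB).nullMeasurableSet, preimage_inter]
    have := preimage_towerFloor T G 0 t
    rw [zero_add, towerFloor_zero] at this
    rw [this]
  · intro i hi k hk hik
    exact (hd (by simpa using hi) (by simpa using hk) hik).mono inter_subset_left inter_subset_left
  · exact fun i _ => (measurableSet_towerFloor T hG i).inter hB

theorem measureReal_orbitUnion {G : Set X} (hT : MeasurePreserving T μ μ)
    (hG : MeasurableSet G) {ℓ : ℕ} (hd : (Iio ℓ).PairwiseDisjoint (towerFloor T G)) :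
    μ.real (⋃ t ∈ Iio ℓ, towerFloor T G t) = ℓ * μ.real G := by
  have := measureReal_orbitUnion_inter hT hG hd MeasurableSet.univ
  simpa using this

theorem abs_measureReal_inter_sub_le (A B C : Set X) : |μ.real (C ∩ A) - μ.real (C ∩ B)| ≤ μ.real (A ∆ B) := by
  have e5 : μ.real (C ∩ A) ≤ μ.real (C ∩ B) + μ.real (A ∆ B) :=
    (measureReal_mono (by intro x; simp only [mem_inter_iff, mem_symmDiff, mem_union]; tauto)).trans
      (measureReal_union_le _ _)
  have e6 : μ.real (C ∩ B) ≤ μ.real (C ∩ A) + μ.real (A ∆ B) :=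
    (measureReal_mono (by intro x; simp only [mem_inter_iff, mem_symmDiff, mem_union]; tauto)).trans
      (measureReal_union_le _ _)
  rw [abs_le]; constructor <;> linarith

end NearInvariant

/-! ### Tower sequences. -/

/-- Every one of the first `n` floors over `E` is contained in `A` or disjoint from it. -/
def IsAdapted {X : Type*} (T : X → X) (E : Set X) (n : ℕ) (A : Set X) : Prop :=
  ∀ i < n, towerFloor T E i ⊆ A ∨ Disjoint (towerFloor T E i) A

/-- A sequence of Rokhlin towers with `n j` floors over `E j`, of heights tending to infinity,
asymptotically filling the space and approximating all measurable sets. -/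
structure IsTowerSeq {X : Type*} [MeasurableSpace X] (μ : Measure X) (T : X ≃ᵐ X)
    (E : ℕ → Set X) (n : ℕ → ℕ) : Prop where
  mp : MeasurePreserving T μ μ
  meas : ∀ j, MeasurableSet (E j)
  disj : ∀ j, (Iio (n j)).PairwiseDisjoint (towerFloor T (E j))
  height : Tendsto n atTop atTop
  cover : Tendsto (fun j => n j * μ.real (E j)) atTop (𝓝 1)
  approx : ∀ A, MeasurableSet A → ∃ A' : ℕ → Set X, (∀ j, MeasurableSet (A' j)) ∧
    (∀ j, IsAdapted T (E j) (n j) (A' j)) ∧ Tendsto (fun j => μ.real (A ∆ A' j)) atTop (𝓝 0)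

namespace IsTowerSeq

variable {X : Type*} [MeasurableSpace X] {μ : Measure X} {T : X ≃ᵐ X}
  {E : ℕ → Set X} {n : ℕ → ℕ}

theorem comp (h : IsTowerSeq μ T E n) {σ : ℕ → ℕ} (hσ : Tendsto σ atTop atTop) :
    IsTowerSeq μ T (E ∘ σ) (n ∘ σ) where
  mp := h.mp
  meas j := h.meas (σ j)
  disj j := h.disj (σ j)
  height := h.height.comp hσ
  cover := h.cover.comp hσ
  approx A hA := by
    obtain ⟨A', h1, h2, h3⟩ := h.approx A hA
    exact ⟨A' ∘ σ, fun j => h1 _, fun j => h2 _, h3.comp hσ⟩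

theorem base_tendsto (h : IsTowerSeq μ T E n) :
    Tendsto (fun j => μ.real (E j)) atTop (𝓝 0) := by
  have h1 : Tendsto (fun j => (n j * μ.real (E j)) * ((n j : ℝ))⁻¹) atTop (𝓝 (1 * 0)) :=
    h.cover.mul (tendsto_inv_atTop_zero.comp (tendsto_natCast_atTop_atTop.comp h.height))
  rw [mul_zero] at h1
  refine h1.congr' ?_
  filter_upwards [h.height.eventually_gt_atTop 0] with j hj
  field_simp

theorem floor_meas (h : IsTowerSeq μ T E n) (j i : ℕ) : MeasurableSet (towerFloor T (E j) i) :=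
  measurableSet_towerFloor T (h.meas j) i

theorem floor_measure (h : IsTowerSeq μ T E n) (j i : ℕ) :
    μ.real (towerFloor T (E j) i) = μ.real (E j) :=
  measureReal_towerFloor h.mp (h.meas j) i

theorem disj_floor (h : IsTowerSeq μ T E n) {j a ℓ : ℕ} (ha : a + ℓ ≤ n j) :
    (Iio ℓ).PairwiseDisjoint (towerFloor T (towerFloor T (E j) a)) := by
  intro i hi k hk hik
  rw [mem_Iio] at hi hk
  simp only [Function.onFun, towerFloor_add]
  exact h.disj j (show a + i < n j by omega) (show a + k < n j by omega) (by omega)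

theorem floor_unique (h : IsTowerSeq μ T E n) {j i i' : ℕ} (hi : i < n j)
    (hi' : i' < n j) {x : X} (hx : x ∈ towerFloor T (E j) i) (hx' : x ∈ towerFloor T (E j) i') :
    i = i' := by
  by_contra hne
  exact disjoint_left.1 (h.disj j hi hi' hne) hx hx'

theorem residual_le [IsProbabilityMeasure μ] (h : IsTowerSeq μ T E n) (j : ℕ) :
    μ.real (⋃ t ∈ Iio (n j), towerFloor T (E j) t)ᶜ = 1 - n j * μ.real (E j) := by
  rw [measureReal_compl (measurableSet_orbitUnion T (h.meas j) _),
    measureReal_orbitUnion h.mp (h.meas j) (h.disj j)]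
  simp

theorem mul_le_one [IsProbabilityMeasure μ] (h : IsTowerSeq μ T E n) (j : ℕ) :
    n j * μ.real (E j) ≤ 1 := by
  rw [← measureReal_orbitUnion h.mp (h.meas j) (h.disj j)]
  exact measureReal_le_one

/-- Intersections with an adapted set are computed floor by floor. -/
theorem abs_inter_adapted_sub_le [IsProbabilityMeasure μ] (h : IsTowerSeq μ T E n) (j : ℕ)
    {A D : Set X} (hA : IsAdapted T (E j) (n j) A)
    (hD : MeasurableSet D) [DecidablePred fun i => towerFloor T (E j) i ⊆ A] :
    |μ.real (D ∩ A) - ∑ i ∈ Finset.range (n j) with towerFloor T (E j) i ⊆ A,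
      μ.real (D ∩ towerFloor T (E j) i)| ≤ 1 - n j * μ.real (E j) := by
  set I := (Finset.range (n j)).filter fun i => towerFloor T (E j) i ⊆ A
  have hm := fun i => measurableSet_towerFloor T (h.meas j) i
  have h1 : ∑ i ∈ I, μ.real (D ∩ towerFloor T (E j) i)
      = μ.real (⋃ i ∈ I, D ∩ towerFloor T (E j) i) := by
    rw [measureReal_biUnion_finset]
    · intro i hi k hk hik
      refine (h.disj j ?_ ?_ hik).mono inter_subset_right inter_subset_right
      · simp [I] at hi; exact hi.1
      · simp [I] at hk; exact hk.1
    · exact fun i _ => hD.inter (hm i)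
  rw [h1, ← h.residual_le j]
  have h2 : μ.real (⋃ i ∈ I, D ∩ towerFloor T (E j) i) ≤ μ.real (D ∩ A) := by
    refine measureReal_mono (iUnion₂_subset fun i hi => inter_subset_inter_right _ ?_)
    exact (Finset.mem_filter.1 hi).2
  have h3 : μ.real (D ∩ A) ≤ μ.real (⋃ i ∈ I, D ∩ towerFloor T (E j) i)
      + μ.real (⋃ t ∈ Iio (n j), towerFloor T (E j) t)ᶜ := by
    refine (measureReal_mono ?_).trans (measureReal_union_le _ _)
    rintro x ⟨hxD, hxA⟩
    by_cases hx : x ∈ ⋃ t ∈ Iio (n j), towerFloor T (E j) t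
    · left
      simp only [mem_iUnion, exists_prop, mem_Iio] at hx ⊢
      obtain ⟨i, hi, hxi⟩ := hx
      refine ⟨i, Finset.mem_filter.2 ⟨Finset.mem_range.2 hi, ?_⟩, hxD, hxi⟩
      exact (hA i hi).resolve_right fun hd => disjoint_left.1 hd hxi hxA
    · exact Or.inr hx
  rw [abs_le]; constructor <;> linarith [measureReal_nonneg (μ := μ)
    (s := (⋃ t ∈ Iio (n j), towerFloor T (E j) t)ᶜ)]

/-- Nearly invariant sets are nearly independent of any given measurable set. -/
theorem exists_nearInvariant_inter_le [IsProbabilityMeasure μ] (h : IsTowerSeq μ T E n)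
    {A : Set X} (hA : MeasurableSet A) {ε : ℝ} (hε : 0 < ε) :
    ∃ γ > 0, ∀ C, MeasurableSet C → μ.real (C \ T ⁻¹' C) ≤ γ →
      |μ.real (C ∩ A) - μ.real C * μ.real A| ≤ ε := by
  classical
  obtain ⟨A', hA'm, hA'a, hA'⟩ := h.approx A hA
  have hc : Tendsto (fun j => 1 - n j * μ.real (E j)) atTop (𝓝 0) := by
    simpa using (tendsto_const_nhds (x := (1 : ℝ))).sub h.cover
  obtain ⟨j, hj1, hj2⟩ := ((hA'.eventually_lt_const (show 0 < ε / 16 by positivity)).and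
    (hc.eventually_lt_const (show 0 < ε / 16 by positivity))).exists
  set r := 1 - n j * μ.real (E j) with hr
  set N : ℝ := (n j : ℝ) with hN
  have hN0 : 0 ≤ N := Nat.cast_nonneg _
  -- Moving up to `N` floors costs at most `N * γ` per floor, and at most `N` floors are summed;
  -- this `γ` keeps `N * (N * γ)` below `ε / 16`.
  refine ⟨ε / (16 * (N ^ 2 + 1)), by positivity, fun C hC hγ => ?_⟩
  set γ := ε / (16 * (N ^ 2 + 1)) with hγdef
  have hγ0 : 0 < γ := by positivity
  have hNγ : N * (N * γ) ≤ ε / 16 := by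
    have : γ * (16 * (N ^ 2 + 1)) = ε := by rw [hγdef]; field_simp
    nlinarith
  set I := (Finset.range (n j)).filter fun i => towerFloor T (E j) i ⊆ A' j
  have floorC : ∀ i ∈ Finset.range (n j),
      |μ.real (C ∩ towerFloor T (E j) i) - μ.real (C ∩ E j)| ≤ N * γ := by
    intro i hi
    have := measureReal_inter_iterate_preimage_le h.mp hC hγ
      (measurableSet_towerFloor T (h.meas j) i) i
    have h0 := preimage_towerFloor T (E j) 0 i
    rw [zero_add, towerFloor_zero] at h0
    rw [h0, abs_sub_comm] at this
    refine this.trans (mul_le_mul_of_nonneg_right ?_ hγ0.le)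
    exact Nat.cast_le.2 (Finset.mem_range.1 hi).le
  have sumC : ∀ J ⊆ Finset.range (n j),
      |∑ i ∈ J, μ.real (C ∩ towerFloor T (E j) i) - J.card * μ.real (C ∩ E j)| ≤ ε / 16 := by
    intro J hJ
    calc _ = |∑ i ∈ J, (μ.real (C ∩ towerFloor T (E j) i) - μ.real (C ∩ E j))| := by
          simp [Finset.sum_sub_distrib]
      _ ≤ ∑ i ∈ J, |μ.real (C ∩ towerFloor T (E j) i) - μ.real (C ∩ E j)| :=
          Finset.abs_sum_le_sum_abs _ _
      _ ≤ ∑ i ∈ J, N * γ := Finset.sum_le_sum fun i hi => floorC i (hJ hi)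
      _ = J.card * (N * γ) := by simp
      _ ≤ N * (N * γ) := by
          refine mul_le_mul_of_nonneg_right ?_ (by positivity)
          have := Finset.card_le_card hJ
          rw [Finset.card_range] at this
          exact Nat.cast_le.2 this
      _ ≤ _ := hNγ
  have a1 := h.abs_inter_adapted_sub_le j (hA'a j) hC
  have a2 := h.abs_inter_adapted_sub_le j (hA'a j) MeasurableSet.univ
  have a3 := h.abs_inter_adapted_sub_le j (A := univ) (fun i _ => Or.inl (subset_univ _)) hC
  have b1 := sumC I (Finset.filter_subset _ _)
  have b3 := sumC _ (Finset.filter_subset (fun i => towerFloor T (E j) i ⊆ univ) _)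
  simp only [subset_univ, Finset.filter_true, Finset.card_range, inter_univ] at a3 b3
  simp only [univ_inter, measureReal_towerFloor h.mp (h.meas j), Finset.sum_const,
    nsmul_eq_mul] at a2
  have c1 := abs_measureReal_inter_sub_le (μ := μ) A (A' j) C
  have c2 := abs_measureReal_inter_sub_le (μ := μ) A (A' j) univ
  simp only [univ_inter] at c2
  have hI : (I.card : ℝ) ≤ N := by
    have := Finset.card_le_card (Finset.filter_subset (fun i => towerFloor T (E j) i ⊆ A' j)
      (Finset.range (n j)))
    rw [Finset.card_range] at this
    exact Nat.cast_le.2 this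
  have d1 : 0 ≤ μ.real (C ∩ E j) := measureReal_nonneg
  have d2 : μ.real (C ∩ E j) ≤ μ.real (E j) := measureReal_mono inter_subset_right
  have d3 : N * μ.real (E j) ≤ 1 := h.mul_le_one j
  have d4 : 0 ≤ μ.real C := measureReal_nonneg
  have d5 : μ.real C ≤ 1 := measureReal_le_one
  have d6 : 0 ≤ μ.real (A' j) := measureReal_nonneg
  have d7 : μ.real (A' j) ≤ 1 := measureReal_le_one
  have d8 : 0 ≤ (I.card : ℝ) := Nat.cast_nonneg _
  -- With these names `μ C ≈ N x`, `μ (A' j) ≈ s e`, `μ (C ∩ A' j) ≈ s x` and `N e ≈ 1`, so `s x ≈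
  -- (N x)(s e)`, which is the required independence.
  set s : ℝ := (I.card : ℝ)
  set x := μ.real (C ∩ E j)
  set e := μ.real (E j)
  have f0 : s * x ≤ 1 := by nlinarith
  have f1 : |s * x - N * x * (s * e)| ≤ ε / 16 := by
    rw [show s * x - N * x * (s * e) = s * x * r by rw [hr]; ring, abs_of_nonneg]
    · nlinarith [mul_nonneg d8 d1]
    · exact mul_nonneg (mul_nonneg d8 d1) (by linarith)
  have f2 : |μ.real C * μ.real (A' j) - N * x * (s * e)| ≤ 3 * (ε / 16) := by
    have g1 : |(μ.real C - N * x) * μ.real (A' j)| ≤ 2 * (ε / 16) := by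
      rw [abs_mul, abs_of_nonneg d6]
      have : |μ.real C - N * x| ≤ 2 * (ε / 16) := by
        have := abs_sub_le (μ.real C) (∑ i ∈ Finset.range (n j), μ.real (C ∩ towerFloor T (E j) i)) (N * x)
        linarith
      nlinarith [abs_nonneg (μ.real C - N * x)]
    have g2 : |N * x * (μ.real (A' j) - s * e)| ≤ ε / 16 := by
      rw [abs_mul, abs_of_nonneg (mul_nonneg hN0 d1)]
      have : N * x ≤ 1 := by nlinarith
      nlinarith [abs_nonneg (μ.real (A' j) - s * e), mul_nonneg hN0 d1]
    have := abs_add_le ((μ.real C - N * x) * μ.real (A' j)) (N * x * (μ.real (A' j) - s * e))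
    rw [show (μ.real C - N * x) * μ.real (A' j) + N * x * (μ.real (A' j) - s * e)
      = μ.real C * μ.real (A' j) - N * x * (s * e) by ring] at this
    linarith
  have f3 : |μ.real C * μ.real A - μ.real C * μ.real (A' j)| ≤ ε / 16 := by
    rw [← mul_sub, abs_mul, abs_of_nonneg d4]
    nlinarith [abs_nonneg (μ.real A - μ.real (A' j))]
  rw [abs_le] at *
  constructor <;> linarith

end IsTowerSeq

/-! ### Consequences of mixing for nearly invariant sets. -/

section Mixing

variable {X : Type*} [MeasurableSpace X] {μ : Measure X} [IsProbabilityMeasure μ] {T : X ≃ᵐ X}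

/-- The double sum is the second moment of `g = ∑ (1_{F i} - p)`; the bound integrates `|g| ≤ δ / 2
+ g² / (2 δ)`, a form of Cauchy–Schwarz without square roots. -/
theorem abs_sum_measureReal_inter_sub_le {ι : Type*} (s : Finset ι) {F : ι → Set X}
    (hF : ∀ i, MeasurableSet (F i)) {C : Set X} (hC : MeasurableSet C) (p : ℝ) {δ : ℝ}
    (hδ : 0 < δ) :
    |∑ i ∈ s, (μ.real (C ∩ F i) - p * μ.real C)| ≤ δ / 2 + (∑ i ∈ s, ∑ k ∈ s,
      (μ.real (F i ∩ F k) - p * μ.real (F i) - p * μ.real (F k) + p ^ 2)) / (2 * δ) := by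
  set f : ι → X → ℝ := fun i => (F i).indicator 1
  have hint : ∀ B : Set X, MeasurableSet B → Integrable (B.indicator (1 : X → ℝ)) μ :=
    fun B hB => (integrable_const (1 : ℝ)).indicator hB
  have hval : ∀ B : Set X, MeasurableSet B → ∫ x, B.indicator (1 : X → ℝ) x ∂μ = μ.real B :=
    fun B hB => integral_indicator_one hB
  have hmul : ∀ (A B : Set X) (x : X), A.indicator (1 : X → ℝ) x * B.indicator (1 : X → ℝ) x
      = (A ∩ B).indicator (1 : X → ℝ) x := fun A B x => by
    by_cases hA : x ∈ A <;> by_cases hB : x ∈ B <;> simp [hA, hB]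
  have h1 : ∀ i k x, (f i x - p) * (f k x - p) = (F i ∩ F k).indicator (1 : X → ℝ) x
      - p * f i x - p * f k x + p ^ 2 := fun i k x => by
    rw [← hmul]; simp only [f]; ring
  have hint1 : ∀ i k, Integrable (fun x => (f i x - p) * (f k x - p)) μ := fun i k => by
    simp only [h1]
    exact (((hint _ ((hF i).inter (hF k))).sub ((hint _ (hF i)).const_mul p)).sub
      ((hint _ (hF k)).const_mul p)).add (integrable_const _)
  have h2 : ∀ i k, ∫ x, (f i x - p) * (f k x - p) ∂μ
      = μ.real (F i ∩ F k) - p * μ.real (F i) - p * μ.real (F k) + p ^ 2 := fun i k => by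
    simp only [h1]
    rw [integral_add, integral_sub, integral_sub, integral_const_mul, integral_const_mul,
      hval _ ((hF i).inter (hF k)), hval _ (hF i), hval _ (hF k)]
    · simp
    · exact hint _ ((hF i).inter (hF k))
    · exact (hint _ (hF i)).const_mul p
    · exact (hint _ ((hF i).inter (hF k))).sub ((hint _ (hF i)).const_mul p)
    · exact (hint _ (hF k)).const_mul p
    · exact ((hint _ ((hF i).inter (hF k))).sub ((hint _ (hF i)).const_mul p)).sub
        ((hint _ (hF k)).const_mul p)
    · exact integrable_const _
  set g : X → ℝ := fun x => ∑ i ∈ s, (f i x - p)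
  have h3 : ∀ x, g x ^ 2 = ∑ i ∈ s, ∑ k ∈ s, (f i x - p) * (f k x - p) := fun x => by
    rw [sq, Finset.sum_mul_sum]
  have hintg2 : Integrable (fun x => g x ^ 2) μ := by
    simp only [h3]
    exact integrable_finsetSum _ fun i _ => integrable_finsetSum _ fun k _ => hint1 i k
  have h4 : ∫ x, g x ^ 2 ∂μ = ∑ i ∈ s, ∑ k ∈ s,
      (μ.real (F i ∩ F k) - p * μ.real (F i) - p * μ.real (F k) + p ^ 2) := by
    simp only [h3]
    rw [integral_finsetSum _ fun i _ => integrable_finsetSum _ fun k _ => hint1 i k]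
    refine Finset.sum_congr rfl fun i _ => ?_
    rw [integral_finsetSum _ fun k _ => hint1 i k]
    exact Finset.sum_congr rfl fun k _ => h2 i k
  have h5 : ∀ x, C.indicator (1 : X → ℝ) x * g x
      = ∑ i ∈ s, ((C ∩ F i).indicator (1 : X → ℝ) x - p * C.indicator (1 : X → ℝ) x) := fun x => by
    rw [Finset.mul_sum]
    refine Finset.sum_congr rfl fun i _ => ?_
    rw [← hmul]; simp only [f]; ring
  have hint5 : ∀ i, Integrable (fun x => (C ∩ F i).indicator (1 : X → ℝ) x
      - p * C.indicator (1 : X → ℝ) x) μ := fun i =>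
    (hint _ (hC.inter (hF i))).sub ((hint _ hC).const_mul p)
  have h6 : ∫ x, C.indicator (1 : X → ℝ) x * g x ∂μ
      = ∑ i ∈ s, (μ.real (C ∩ F i) - p * μ.real C) := by
    simp only [h5]
    rw [integral_finsetSum _ fun i _ => hint5 i]
    refine Finset.sum_congr rfl fun i _ => ?_
    rw [integral_sub (hint _ (hC.inter (hF i))) ((hint _ hC).const_mul p), integral_const_mul,
      hval _ (hC.inter (hF i)), hval _ hC]
  rw [← h6, ← h4]
  have h7 : ∫ x, (δ / 2 + g x ^ 2 / (2 * δ)) ∂μ = δ / 2 + (∫ x, g x ^ 2 ∂μ) / (2 * δ) := by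
    rw [integral_add (integrable_const _) (hintg2.div_const _)]
    congr 1
    · simp
    · exact integral_div _ _
  rw [← h7]
  refine (abs_integral_le_integral_abs).trans (integral_mono_of_nonneg
    (Eventually.of_forall fun x => abs_nonneg _) ((integrable_const _).add (hintg2.div_const _))
    (Eventually.of_forall fun x => ?_))
  have h8 : |C.indicator (1 : X → ℝ) x * g x| ≤ |g x| := by
    by_cases hx : x ∈ C <;> simp [hx]
  refine h8.trans ?_
  have h9 : δ / 2 + g x ^ 2 / (2 * δ) - |g x| = (δ - |g x|) ^ 2 / (2 * δ) := by
    rw [← sq_abs (g x)]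
    field_simp
    ring
  have : 0 ≤ (δ - |g x|) ^ 2 / (2 * δ) := by positivity
  show |g x| ≤ δ / 2 + g x ^ 2 / (2 * δ)
  linarith

theorem IsMixing.tendsto_measureReal (hT : MeasurePreserving T μ μ) (hmix : IsMixing μ T)
    {A B : Set X} (hA : MeasurableSet A) (hB : MeasurableSet B) :
    Tendsto (fun r : ℕ => μ.real (A ∩ T^[r] ⁻¹' B)) atTop (𝓝 (μ.real A * μ.real B)) := by
  have h1 := (ENNReal.tendsto_toReal (ENNReal.mul_ne_top (measure_ne_top μ B)
    (measure_ne_top μ A))).comp (hmix B A hB hA)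
  rw [ENNReal.toReal_mul, mul_comm] at h1
  refine h1.congr fun r => ?_
  have h2 : MeasurableSet (T^[r] '' A) := measurableSet_towerFloor T hA r
  have h3 := (hT.iterate r).measureReal_preimage (hB.inter h2).nullMeasurableSet
  rw [preimage_inter, preimage_image_eq _ (T.injective.iterate r), inter_comm] at h3
  exact h3.symm

theorem card_filter_dist_lt_le (N n u : ℕ) :
    ((Finset.range N).filter fun m => Nat.dist n m < u).card ≤ 2 * u := by
  have h : ((Finset.range N).filter fun m => Nat.dist n m < u) ⊆ Finset.Ico (n - u) (n + u) := by
    intro m hm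
    have h1 := (Finset.mem_filter.1 hm).2
    rw [Nat.dist] at h1
    rw [Finset.mem_Ico]
    omega
  refine (Finset.card_le_card h).trans ?_
  simp only [Nat.card_Ico]; omega

/-- Under mixing, `B₁ ∩ T^{-r} B₂` becomes nearly independent of nearly invariant sets. -/
theorem IsMixing.exists_nearInvariant_inter_le (hT : MeasurePreserving T μ μ)
    (hmix : IsMixing μ T) {B₁ B₂ : Set X} (h₁ : MeasurableSet B₁) (h₂ : MeasurableSet B₂)
    {ε : ℝ} (hε : 0 < ε) :
    ∃ γ > 0, ∃ b : ℕ, ∀ C, MeasurableSet C → μ.real (C \ T ⁻¹' C) ≤ γ → ∀ r ≥ b,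
      |μ.real (C ∩ (B₁ ∩ T^[r] ⁻¹' B₂)) - μ.real C * (μ.real B₁ * μ.real B₂)| ≤ ε := by
  set p := μ.real B₁ * μ.real B₂ with hp
  set D : ℕ → Set X := fun r => B₁ ∩ T^[r] ⁻¹' B₂ with hD
  have hDm : ∀ r, MeasurableSet (D r) := fun r => h₁.inter (T.measurable.iterate r h₂)
  have hpre : ∀ n (A : Set X), MeasurableSet A → MeasurableSet (T^[n] ⁻¹' A) := fun n A hA =>
    T.measurable.iterate n hA
  set c : ℕ → ℝ := fun u => μ.real (B₁ ∩ T^[u] ⁻¹' B₁) * μ.real (B₂ ∩ T^[u] ⁻¹' B₂) with hc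
  have hDlim : Tendsto (fun r => μ.real (D r)) atTop (𝓝 p) := hmix.tendsto_measureReal hT h₁ h₂
  have hclim : Tendsto c atTop (𝓝 (p ^ 2)) := by
    have := (hmix.tendsto_measureReal hT h₁ h₁).mul (hmix.tendsto_measureReal hT h₂ h₂)
    convert! this using 2
    rw [hp]; ring
  -- Two-fold mixing suffices: `D r ∩ T⁻ᵘ D r` regroups as `(B₁ ∩ T⁻ᵘ B₁) ∩ T⁻ʳ (B₂ ∩ T⁻ᵘ B₂)`, and
  -- `u` is fixed while `r → ∞`.
  have hself : ∀ u, Tendsto (fun r => μ.real (D r ∩ T^[u] ⁻¹' D r)) atTop (𝓝 (c u)) := by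
    intro u
    refine (hmix.tendsto_measureReal hT (h₁.inter (hpre u _ h₁)) (h₂.inter (hpre u _ h₂))).congr
      fun r => ?_
    congr 1
    simp only [hD, preimage_inter, ← preimage_comp, ← Function.iterate_add]
    rw [add_comm u r]
    ext x; simp only [mem_inter_iff]; tauto
  have hle : ∀ n u, Tendsto (fun r => μ.real (T^[n] ⁻¹' D r ∩ T^[n + u] ⁻¹' D r)) atTop
      (𝓝 (c u)) := by
    intro n u
    refine (hself u).congr fun r => ?_
    rw [← (hT.iterate n).measureReal_preimage
      ((hDm r).inter (hpre u _ (hDm r))).nullMeasurableSet, preimage_inter, ← preimage_comp,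
      ← Function.iterate_add, add_comm]
  have hpair : ∀ n m, Tendsto (fun r => μ.real (T^[n] ⁻¹' D r ∩ T^[m] ⁻¹' D r)) atTop
      (𝓝 (c (Nat.dist n m))) := by
    intro n m
    rcases le_total n m with h | h
    · obtain ⟨u, rfl⟩ := Nat.exists_eq_add_of_le h
      rw [Nat.dist_eq_sub_of_le h, Nat.add_sub_cancel_left]
      exact hle n u
    · obtain ⟨u, rfl⟩ := Nat.exists_eq_add_of_le h
      rw [Nat.dist_eq_sub_of_le_right h, Nat.add_sub_cancel_left]
      simpa only [inter_comm] using hle m u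
  have hDpre : ∀ n r, μ.real (T^[n] ⁻¹' D r) = μ.real (D r) := fun n r =>
    (hT.iterate n).measureReal_preimage (hDm r).nullMeasurableSet
  obtain ⟨u₀, hu₀⟩ := eventually_atTop.1
    (hclim.eventually_lt_const (show p ^ 2 < p ^ 2 + ε ^ 2 / 8 by
      have := pow_pos hε 2; linarith))
  -- At most `2 u₀` indices `m` lie within `u₀` of a given `n`; `N > 16 u₀ / ε²` makes their total
  -- contribution `2 u₀ N` smaller than `N² ε² / 8`.
  obtain ⟨N, hN⟩ := exists_nat_gt (max 1 (16 * u₀ / ε ^ 2))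
  have hN1 : (1 : ℝ) < N := (le_max_left _ _).trans_lt hN
  have hN2 : 16 * u₀ < N * ε ^ 2 := by
    have := (le_max_right _ _).trans_lt hN
    rwa [div_lt_iff₀ (by positivity)] at this
  have hc1 : ∀ u, c u - p ^ 2 ≤ 1 := fun u => by
    have : c u ≤ 1 := mul_le_one₀ measureReal_le_one measureReal_nonneg measureReal_le_one
    have := sq_nonneg p
    linarith
  have hsum : ∑ n ∈ Finset.range N, ∑ m ∈ Finset.range N, (c (Nat.dist n m) - p ^ 2)
      < N ^ 2 * (ε ^ 2 / 4) := by
    have hrow : ∀ n, ∑ m ∈ Finset.range N, (c (Nat.dist n m) - p ^ 2)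
        ≤ 2 * u₀ + N * (ε ^ 2 / 8) := by
      intro n
      rw [← Finset.sum_filter_add_sum_filter_not _ (fun m => Nat.dist n m < u₀)]
      refine add_le_add ?_ ?_
      · refine (Finset.sum_le_card_nsmul _ _ 1 fun m _ => hc1 _).trans ?_
        rw [nsmul_eq_mul, mul_one]
        exact_mod_cast card_filter_dist_lt_le N n u₀
      · refine (Finset.sum_le_card_nsmul _ _ (ε ^ 2 / 8) fun m hm => ?_).trans ?_
        · have := hu₀ _ (not_lt.1 (Finset.mem_filter.1 hm).2)
          linarith
        · rw [nsmul_eq_mul]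
          refine mul_le_mul_of_nonneg_right ?_ (by positivity)
          have := Finset.card_filter_le (Finset.range N) (fun m => ¬ Nat.dist n m < u₀)
          rw [Finset.card_range] at this
          exact_mod_cast this
    calc _ ≤ ∑ n ∈ Finset.range N, (2 * u₀ + N * (ε ^ 2 / 8) : ℝ) :=
          Finset.sum_le_sum fun n _ => hrow n
      _ = N * (2 * u₀) + N ^ 2 * (ε ^ 2 / 8) := by simp; ring
      _ < N ^ 2 * (ε ^ 2 / 4) := by nlinarith
  have hV : Tendsto (fun r => ∑ n ∈ Finset.range N, ∑ m ∈ Finset.range N,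
      (μ.real (T^[n] ⁻¹' D r ∩ T^[m] ⁻¹' D r) - p * μ.real (T^[n] ⁻¹' D r)
        - p * μ.real (T^[m] ⁻¹' D r) + p ^ 2)) atTop
      (𝓝 (∑ n ∈ Finset.range N, ∑ m ∈ Finset.range N, (c (Nat.dist n m) - p ^ 2))) := by
    refine tendsto_finsetSum _ fun n _ => tendsto_finsetSum _ fun m _ => ?_
    simp only [hDpre]
    convert! (((hpair n m).sub (hDlim.const_mul p)).sub (hDlim.const_mul p)).add_const (p ^ 2)
      using 2
    ring
  obtain ⟨b, hb⟩ := eventually_atTop.1 (hV.eventually_lt_const hsum)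
  -- Near-invariance replaces `D r` by the average of its first `N` preimages at a cost of at most
  -- `N * γ = ε / 2`; the second moment controls that average.
  refine ⟨ε / (2 * N), by positivity, b, fun C hC hγ r hr => ?_⟩
  have k1 := abs_sum_measureReal_inter_sub_le (μ := μ) (Finset.range N)
    (fun n => hpre n _ (hDm r)) hC p (δ := N * ε / 2) (by positivity)
  have k2 := hb r hr
  have k3 : |∑ n ∈ Finset.range N, (μ.real (C ∩ T^[n] ⁻¹' D r) - p * μ.real C)|
      ≤ N * ε / 2 := by
    refine k1.trans ?_
    have : (∑ n ∈ Finset.range N, ∑ m ∈ Finset.range N,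
      (μ.real (T^[n] ⁻¹' D r ∩ T^[m] ⁻¹' D r) - p * μ.real (T^[n] ⁻¹' D r)
        - p * μ.real (T^[m] ⁻¹' D r) + p ^ 2)) / (2 * (N * ε / 2)) ≤ N * ε / 4 := by
      rw [div_le_iff₀ (by positivity)]
      refine k2.le.trans (le_of_eq ?_)
      ring
    linarith
  have k4 : |∑ n ∈ Finset.range N, (μ.real (C ∩ D r) - μ.real (C ∩ T^[n] ⁻¹' D r))|
      ≤ N * ε / 2 := by
    refine (Finset.abs_sum_le_sum_abs _ _).trans ?_
    refine (Finset.sum_le_card_nsmul _ _ (ε / 2) fun n hn => ?_).trans ?_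
    · rw [abs_sub_comm]
      refine (measureReal_inter_iterate_preimage_le hT hC hγ (hDm r) n).trans ?_
      have : (n : ℝ) ≤ N := Nat.cast_le.2 (Finset.mem_range.1 hn).le
      calc (n : ℝ) * (ε / (2 * N)) ≤ N * (ε / (2 * N)) :=
            mul_le_mul_of_nonneg_right this (by positivity)
        _ = ε / 2 := by field_simp
    · simp; linarith
  have k5 : (N : ℝ) * (μ.real (C ∩ D r) - μ.real C * p)
      = ∑ n ∈ Finset.range N, (μ.real (C ∩ D r) - μ.real (C ∩ T^[n] ⁻¹' D r))
        + ∑ n ∈ Finset.range N, (μ.real (C ∩ T^[n] ⁻¹' D r) - p * μ.real C) := by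
    rw [← Finset.sum_add_distrib]
    simp; ring
  have k6 : (N : ℝ) * |μ.real (C ∩ D r) - μ.real C * p| ≤ N * ε := by
    rw [← abs_of_nonneg (show (0 : ℝ) ≤ N by positivity), ← abs_mul, k5,
      abs_of_nonneg (show (0 : ℝ) ≤ N by positivity)]
    refine (abs_add_le _ _).trans ?_
    linarith
  exact le_of_mul_le_mul_left k6 (by linarith)

end Mixing

/-! ### From the rank-one property to tower sequences. -/

theorem disjoint_of_mem_towerPartition {X : Type*} {T : X → X} {E : Set X} {h : ℕ}
    (hd : (Iic h).PairwiseDisjoint (towerFloor T E)) {Q R : Set X}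
    (hQ : Q ∈ towerPartition T E h) (hR : R ∈ towerPartition T E h) (hQR : Q ≠ R) :
    Disjoint Q R := by
  have key : ∀ i ∈ Iic h, Disjoint (towerFloor T E i) (towerResidual T E h) := fun i hi =>
    disjoint_compl_right_iff_subset.2 (subset_biUnion_of_mem (u := towerFloor T E) hi)
  rcases hQ with ⟨i, hi, rfl⟩ | rfl <;> rcases hR with ⟨k, hk, rfl⟩ | rfl
  · exact hd hi hk fun h => hQR (h ▸ rfl)
  · exact key i hi
  · exact (key k hk).symm
  · exact absurd rfl hQR

section RankOne

variable {X : Type*} [MeasurableSpace X] {μ : Measure X}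

/-- Points are null, so each has an open neighbourhood of small measure; finitely many cover a
compact set whose complement is small. -/
theorem exists_finset_cover_measureReal_lt [StandardBorelSpace X] [IsProbabilityMeasure μ]
    [NullSingletonClass μ] {ε : ℝ} (hε : 0 < ε) :
    ∃ s : Finset (Set X), (∀ A ∈ s, MeasurableSet A ∧ μ.real A < ε) ∧ ⋃ A ∈ s, A = univ := by
  classical
  let _ := upgradeStandardBorel X
  have hε' : ENNReal.ofReal ε ≠ 0 := by simpa using hε
  have hreal : ∀ A : Set X, μ A < ENNReal.ofReal ε → μ.real A < ε := fun A hA =>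
    (ENNReal.lt_ofReal_iff_toReal_lt (measure_ne_top μ A)).1 hA
  obtain ⟨K, -, hK, hKε⟩ := MeasurableSet.univ.exists_isCompact_sdiff_lt (μ := μ)
    (measure_ne_top _ _) hε'
  have hU : ∀ x : X, ∃ U : Set X, x ∈ U ∧ IsOpen U ∧ μ U < ENNReal.ofReal ε := fun x => by
    obtain ⟨U, hxU, hU, hUε⟩ := ({x} : Set X).exists_isOpen_lt_of_lt (μ := μ) (ENNReal.ofReal ε)
      (by rw [measure_singleton]; exact pos_iff_ne_zero.2 hε')
    exact ⟨U, hxU rfl, hU, hUε⟩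
  choose U hxU hUo hUε using hU
  obtain ⟨t, -, ht⟩ := hK.elim_nhds_subcover U fun x _ => (hUo x).mem_nhds (hxU x)
  refine ⟨insert (univ \ K) (t.image U), ?_, ?_⟩
  · intro A hA
    rcases Finset.mem_insert.1 hA with rfl | hA
    · exact ⟨MeasurableSet.univ.diff hK.measurableSet, hreal _ hKε⟩
    · obtain ⟨x, -, rfl⟩ := Finset.mem_image.1 hA
      exact ⟨(hUo x).measurableSet, hreal _ (hUε x)⟩
  · refine eq_univ_of_forall fun x => ?_
    by_cases hx : x ∈ K
    · obtain ⟨y, hy, hxy⟩ := mem_iUnion₂.1 (ht hx)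
      exact mem_iUnion₂.2 ⟨U y, Finset.mem_insert_of_mem (Finset.mem_image_of_mem _ hy), hxy⟩
    · exact mem_iUnion₂.2 ⟨_, Finset.mem_insert_self _ _, mem_univ x, hx⟩

/-- Without atoms the space is a finite union of small sets, each approximated by unions of cells. A
cell used for some `A` is about as small as `A`; a cell never used lies inside the approximation
errors. -/
theorem ConvergesToPoints.eventually_measureReal_le [StandardBorelSpace X]
    [IsProbabilityMeasure μ] [NullSingletonClass μ] {ξ : ℕ → Set (Set X)} (hξ : ConvergesToPoints μ ξ)
    (hd : ∀ j, ∀ Q ∈ ξ j, ∀ R ∈ ξ j, Q ≠ R → Disjoint Q R) {ε : ℝ} (hε : 0 < ε) :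
    ∀ᶠ j in atTop, ∀ Q ∈ ξ j, μ.real Q ≤ ε := by
  obtain ⟨s, hs, hcov⟩ := exists_finset_cover_measureReal_lt (μ := μ) (half_pos hε)
  have hch : ∀ A : s, ∃ S : ℕ → Set (Set X), (∀ j, S j ⊆ ξ j) ∧
      Tendsto (fun j => μ (A ∆ ⋃₀ S j)) atTop (𝓝 0) := fun A => hξ A (hs A A.2).1
  choose S hS hSlim using hch
  set δ := ε / (2 * (s.card + 1)) with hδ
  have hδ0 : 0 < δ := by positivity
  have hδε : δ ≤ ε / 2 := by
    rw [hδ]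
    apply div_le_div_of_nonneg_left hε.le (by norm_num)
    have : (0 : ℝ) ≤ s.card := Nat.cast_nonneg _
    linarith
  have hcard : s.card * δ ≤ ε := by
    have : δ * (2 * (s.card + 1)) = ε := by rw [hδ]; field_simp
    have : (0 : ℝ) ≤ s.card := Nat.cast_nonneg _
    nlinarith
  have hev : ∀ᶠ j in atTop, ∀ A : s, μ.real ((A : Set X) ∆ ⋃₀ S A j) < δ := by
    rw [eventually_all]
    intro A
    have := (ENNReal.tendsto_toReal ENNReal.zero_ne_top).comp (hSlim A)
    exact this.eventually_lt_const hδ0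
  filter_upwards [hev] with j hj Q hQ
  by_cases hmem : ∃ A : s, Q ∈ S A j
  · obtain ⟨A, hA⟩ := hmem
    have h1 : μ.real Q ≤ μ.real (A : Set X) + μ.real ((A : Set X) ∆ ⋃₀ S A j) := by
      refine (measureReal_mono fun x hx => ?_).trans (measureReal_union_le _ _)
      by_cases hxA : x ∈ (A : Set X)
      · exact Or.inl hxA
      · exact Or.inr (Or.inr ⟨mem_sUnion_of_mem hx hA, hxA⟩)
    have := hj A
    have := (hs A A.2).2
    linarith
  · push Not at hmem
    -- Each point of `Q` lies in some `A` of the cover, but `Q` is disjoint from every cell of the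
    -- approximant of `A`.
    have h1 : Q ⊆ ⋃ A ∈ s.attach, ((A : Set X) ∆ ⋃₀ S A j) := by
      intro x hx
      have hxu : x ∈ ⋃ A ∈ s, A := hcov ▸ mem_univ x
      obtain ⟨A, hA, hxA⟩ := mem_iUnion₂.1 hxu
      refine mem_iUnion₂.2 ⟨⟨A, hA⟩, Finset.mem_attach _ _, Or.inl ⟨hxA, ?_⟩⟩
      rintro ⟨R, hR, hxR⟩
      have hne : Q ≠ R := fun h => hmem ⟨A, hA⟩ (h ▸ hR)
      exact disjoint_left.1 (hd j Q hQ R (hS _ j hR) hne) hx hxR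
    calc μ.real Q ≤ μ.real (⋃ A ∈ s.attach, ((A : Set X) ∆ ⋃₀ S A j)) := measureReal_mono h1 (measure_ne_top _ _)
      _ ≤ ∑ A ∈ s.attach, μ.real ((A : Set X) ∆ ⋃₀ S A j) := measureReal_biUnion_finset_le _ _
      _ ≤ s.attach.card • δ := Finset.sum_le_card_nsmul _ _ _ fun A _ => (hj A).le
      _ ≤ ε := by simpa using hcard

/-- Eventual smallness of all cells, applied to the residual cell, gives asymptotic filling; applied
also to the base, it gives heights tending to infinity. The `+ 1` arises because the floors are
indexed from `0` to `h j` inclusive. -/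
theorem IsRankOne.exists_isTowerSeq [StandardBorelSpace X] [IsProbabilityMeasure μ] [NullSingletonClass μ]
    {T : X ≃ᵐ X} {h : ℕ → ℕ} (hT : IsRankOne μ T h) :
    ∃ E : ℕ → Set X, IsTowerSeq μ T E fun j => h j + 1 := by
  obtain ⟨hmp, E, hE, hd, hconv⟩ := hT
  have hIio : ∀ j, Iio (h j + 1) = Iic (h j) := fun j => by ext; simp
  have hcellm : ∀ j, ∀ Q ∈ towerPartition T (E j) (h j), MeasurableSet Q := by
    rintro j Q (⟨i, -, rfl⟩ | rfl)
    · exact measurableSet_towerFloor T (hE j) i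
    · exact (MeasurableSet.biUnion (to_countable _) fun i _ =>
        measurableSet_towerFloor T (hE j) i).compl
  have hfin : ∀ j, (towerPartition T (E j) (h j)).Finite := fun j =>
    ((finite_Iic _).image _).union (finite_singleton _)
  have hdis := fun j => fun Q hQ R hR hne =>
    disjoint_of_mem_towerPartition (hd j) (Q := Q) hQ (R := R) hR hne
  have hsmall := fun (ε : ℝ) (hε : 0 < ε) => hconv.eventually_measureReal_le hdis hε
  have hres : ∀ j, μ.real (towerResidual T (E j) (h j)) = 1 - (h j + 1 : ℕ) * μ.real (E j) := by
    intro j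
    rw [towerResidual, ← hIio, measureReal_compl (measurableSet_orbitUnion T (hE j) _),
      measureReal_orbitUnion hmp (hE j) (by rw [hIio]; exact hd j)]
    simp
  have hrlim : Tendsto (fun j => μ.real (towerResidual T (E j) (h j))) atTop (𝓝 0) := by
    rw [Metric.tendsto_atTop']
    intro ε hε
    obtain ⟨N, hN⟩ := eventually_atTop.1 (hsmall (ε / 2) (half_pos hε))
    refine ⟨N, fun j hj => ?_⟩
    rw [Real.dist_eq, sub_zero, abs_of_nonneg measureReal_nonneg]
    have := hN j hj.le _ (Or.inr rfl)
    linarith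
  refine ⟨E, hmp, hE, fun j => by rw [hIio]; exact hd j, ?_, ?_, ?_⟩
  · rw [tendsto_atTop]
    intro N
    -- Fewer than `N` floors together with the residual would be fewer than `N + 1` cells of mass at
    -- most `1 / (N + 1)`, which cannot add up to `1`.
    filter_upwards [hsmall (1 / (N + 1)) (by positivity)] with j hj
    have h1 := hj _ (Or.inr rfl)
    have h2 := hj _ (Or.inl ⟨0, by simp, rfl⟩)
    rw [towerFloor_zero] at h2
    rw [hres] at h1
    by_contra! hlt
    have h3 : ((h j + 1 : ℕ) : ℝ) * μ.real (E j) ≤ (h j + 1 : ℕ) * (1 / (N + 1)) :=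
      mul_le_mul_of_nonneg_left h2 (Nat.cast_nonneg _)
    have h4 : ((h j + 1 : ℕ) : ℝ) + 1 ≤ N := by exact_mod_cast hlt
    have h5 : (((h j + 1 : ℕ) : ℝ) + 1) * (1 / (N + 1)) ≤ N * (1 / (N + 1)) :=
      mul_le_mul_of_nonneg_right h4 (by positivity)
    have h6 : (N : ℝ) * (1 / (N + 1)) < 1 := by
      rw [mul_one_div, div_lt_one (by positivity)]; linarith
    linarith
  · have := (tendsto_const_nhds (x := (1 : ℝ))).sub hrlim
    simp only [hres, sub_zero, sub_sub_cancel] at this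
    exact this
  · intro A hA
    obtain ⟨S, hS, hlim⟩ := hconv A hA
    refine ⟨fun j => ⋃₀ S j, fun j => ?_, fun j i hi => ?_, ?_⟩
    · exact MeasurableSet.sUnion ((hfin j).subset (hS j)).countable fun Q hQ =>
        hcellm j Q (hS j hQ)
    · have hcell : towerFloor T (E j) i ∈ towerPartition T (E j) (h j) :=
        Or.inl ⟨i, Nat.lt_succ_iff.1 hi, rfl⟩
      by_cases hm : towerFloor T (E j) i ∈ S j
      · exact Or.inl (subset_sUnion_of_mem hm)
      · refine Or.inr (disjoint_sUnion_right.2 fun R hR => hdis j _ hcell _ (hS j hR) ?_)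
        rintro rfl
        exact hm hR
    · exact (ENNReal.tendsto_toReal ENNReal.zero_ne_top).comp hlim

end RankOne

/-! ### Finitely additive probabilities. -/

/-- A finitely additive probability on the measurable sets. -/
structure IsCharge {Ω : Type*} [MeasurableSpace Ω] (m : Set Ω → ℝ) : Prop where
  nonneg : ∀ A, MeasurableSet A → 0 ≤ m A
  univ : m univ = 1
  union : ∀ A B, MeasurableSet A → MeasurableSet B → Disjoint A B → m (A ∪ B) = m A + m B

namespace IsCharge

variable {Ω : Type*} [MeasurableSpace Ω] {m : Set Ω → ℝ}

theorem measure (ν : Measure Ω) [IsProbabilityMeasure ν] : IsCharge fun A => ν.real A where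
  nonneg _ _ := measureReal_nonneg
  univ := by simp
  union _ _ _ hB hAB := measureReal_union hAB hB

theorem empty (hm : IsCharge m) : m ∅ = 0 := by
  have := hm.union ∅ ∅ MeasurableSet.empty MeasurableSet.empty (by simp)
  simpa using this

theorem inter_add_diff (hm : IsCharge m) {A B : Set Ω} (hA : MeasurableSet A)
    (hB : MeasurableSet B) : m (A ∩ B) + m (A \ B) = m A := by
  rw [← hm.union _ _ (hA.inter hB) (hA.diff hB) (disjoint_sdiff_inter.symm), inter_union_sdiff]

theorem mono (hm : IsCharge m) {A B : Set Ω} (hA : MeasurableSet A) (hB : MeasurableSet B)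
    (h : A ⊆ B) : m A ≤ m B := by
  have h1 := hm.inter_add_diff hB hA
  rw [inter_eq_self_of_subset_right h] at h1
  linarith [hm.nonneg _ (hB.diff hA)]

theorem le_one (hm : IsCharge m) {A : Set Ω} (hA : MeasurableSet A) : m A ≤ 1 :=
  hm.univ ▸ hm.mono hA MeasurableSet.univ (subset_univ _)

theorem compl (hm : IsCharge m) {A : Set Ω} (hA : MeasurableSet A) : m Aᶜ = 1 - m A := by
  have := hm.inter_add_diff MeasurableSet.univ hA
  rw [univ_inter, ← compl_eq_univ_sdiff, hm.univ] at this
  linarith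

theorem union_le (hm : IsCharge m) {A B : Set Ω} (hA : MeasurableSet A) (hB : MeasurableSet B) :
    m (A ∪ B) ≤ m A + m B := by
  rw [← union_sdiff_self, hm.union _ _ hA (hB.diff hA) disjoint_sdiff_right]
  linarith [hm.mono (hB.diff hA) hB sdiff_subset]

theorem biUnion_le (hm : IsCharge m) {ι : Type*} (s : Finset ι) {A : ι → Set Ω}
    (hA : ∀ i, MeasurableSet (A i)) : m (⋃ i ∈ s, A i) ≤ ∑ i ∈ s, m (A i) := by
  classical
  induction s using Finset.induction_on with
  | empty => simp [hm.empty]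
  | insert i s hi ih =>
    rw [Finset.set_biUnion_insert, Finset.sum_insert hi]
    exact (hm.union_le (hA i) (s.measurableSet_biUnion fun k _ => hA k)).trans (by linarith)

theorem sum_biUnion (hm : IsCharge m) {ι : Type*} (s : Finset ι) {A : ι → Set Ω}
    (hA : ∀ i, MeasurableSet (A i)) (hd : (s : Set ι).PairwiseDisjoint A) :
    m (⋃ i ∈ s, A i) = ∑ i ∈ s, m (A i) := by
  classical
  induction s using Finset.induction_on with
  | empty => simp [hm.empty]
  | insert i s hi ih =>
    rw [Finset.set_biUnion_insert, Finset.sum_insert hi, hm.union _ _ (hA i)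
      (s.measurableSet_biUnion fun k _ => hA k), ih (hd.subset (by simp))]
    refine disjoint_iUnion₂_right.2 fun k hk => hd (by simp) (by simp [hk]) ?_
    rintro rfl
    exact hi hk

theorem sum_le (hm : IsCharge m) {ι : Type*} (s : Finset ι) {A : ι → Set Ω}
    (hA : ∀ i, MeasurableSet (A i)) (hd : (s : Set ι).PairwiseDisjoint A) {B : Set Ω}
    (hB : MeasurableSet B) (hAB : ∀ i ∈ s, A i ⊆ B) : ∑ i ∈ s, m (A i) ≤ m B := by
  rw [← hm.sum_biUnion s hA hd]
  exact hm.mono (s.measurableSet_biUnion fun k _ => hA k) hB (iUnion₂_subset hAB)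

theorem inter_ge (hm : IsCharge m) {A B : Set Ω} (hA : MeasurableSet A) (hB : MeasurableSet B) :
    m A + m B - 1 ≤ m (A ∩ B) := by
  have h1 := hm.inter_add_diff hA hB
  have h2 := hm.mono (hA.diff hB) hB.compl (fun x hx => hx.2)
  rw [hm.compl hB] at h2
  linarith

theorem map (hm : IsCharge m) {Ω' : Type*} [MeasurableSpace Ω'] {f : Ω → Ω'}
    (hf : Measurable f) : IsCharge fun A => m (f ⁻¹' A) where
  nonneg A hA := hm.nonneg _ (hf hA)
  univ := hm.univ
  union A B hA hB hAB := hm.union _ _ (hf hA) (hf hB) (hAB.preimage f)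

theorem abs_sub_le (hm : IsCharge m) {A B : Set Ω} (hA : MeasurableSet A) (hB : MeasurableSet B) :
    |m A - m B| ≤ m (A ∆ B) := by
  have h1 := hm.inter_add_diff hA hB
  have h2 := hm.inter_add_diff hB hA
  have h3 := hm.union _ _ (hA.diff hB) (hB.diff hA) disjoint_sdiff_sdiff
  rw [inter_comm] at h2
  have h4 := hm.nonneg _ (hA.diff hB)
  have h5 := hm.nonneg _ (hB.diff hA)
  change _ ≤ m (A \ B ∪ B \ A)
  rw [h3, abs_le]
  constructor <;> linarith

theorem abs_prod_sub_le {Y Z : Type*} [MeasurableSpace Y] [MeasurableSpace Z]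
    {m : Set (Y × Z) → ℝ} (hm : IsCharge m) {A A' : Set Y} {B B' : Set Z} (hA : MeasurableSet A)
    (hA' : MeasurableSet A') (hB : MeasurableSet B) (hB' : MeasurableSet B') :
    |m (A ×ˢ B) - m (A' ×ˢ B')|
      ≤ m ((A ∆ A') ×ˢ Set.univ) + m (Set.univ ×ˢ (B ∆ B')) := by
  have h1 : MeasurableSet ((A ∆ A') ×ˢ (Set.univ : Set Z)) := (hA.symmDiff hA').prod .univ
  have h2 : MeasurableSet ((Set.univ : Set Y) ×ˢ (B ∆ B')) := .prod .univ (hB.symmDiff hB')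
  refine (hm.abs_sub_le (hA.prod hB) (hA'.prod hB')).trans ((hm.mono
    ((hA.prod hB).symmDiff (hA'.prod hB')) (h1.union h2) ?_).trans (hm.union_le h1 h2))
  rintro ⟨x, y⟩
  simp only [mem_symmDiff, mem_prod, mem_union, mem_univ, true_and, and_true]
  tauto

/-- Pointwise limits of charges along a nonprincipal ultrafilter. -/
theorem exists_limit {m : ℕ → Set Ω → ℝ} (hm : ∀ j, IsCharge (m j)) :
    ∃ l : Set Ω → ℝ, IsCharge l ∧
      ∀ A, MeasurableSet A → Tendsto (fun j => m j A) (hyperfilter ℕ : Filter ℕ) (𝓝 (l A)) := by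
  -- All values lie in `[0, 1]`, so the ultrafilter limit exists for each measurable set. Finite
  -- additivity passes to the limit; countable additivity need not.
  have hex : ∀ A : Set Ω, ∃ x, MeasurableSet A →
      Tendsto (fun j => m j A) (hyperfilter ℕ : Filter ℕ) (𝓝 x) := fun A => by
    by_cases hA : MeasurableSet A
    · obtain ⟨x, -, hx⟩ := (isCompact_Icc (a := (0 : ℝ)) (b := 1)).ultrafilter_le_nhds
        ((hyperfilter ℕ).map fun j => m j A) (by
          rw [le_principal_iff]
          exact Ultrafilter.mem_map.2 (Filter.univ_mem' fun j =>
            ⟨(hm j).nonneg A hA, (hm j).le_one hA⟩))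
      exact ⟨x, fun _ => hx⟩
    · exact ⟨0, fun h => absurd h hA⟩
  choose l hl using hex
  refine ⟨l, ⟨fun A hA => ?_, ?_, fun A B hA hB hAB => ?_⟩, hl⟩
  · exact ge_of_tendsto' (hl A hA) fun j => (hm j).nonneg A hA
  · refine tendsto_nhds_unique (hl _ .univ) ?_
    simp only [(hm _).univ]
    exact tendsto_const_nhds
  · refine tendsto_nhds_unique (hl _ (hA.union hB)) ?_
    simp only [(hm _).union A B hA hB hAB]
    exact (hl A hA).add (hl B hB)

end IsCharge

/-! ### Orbit averages of normalised floors. -/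

/-- The average of the push-forwards of `ρ` under the first `ℓ` iterates of `Q`. -/
noncomputable def orbitAverage {Ω : Type*} [MeasurableSpace Ω] (Q : Ω → Ω) (ρ : Measure Ω)
    (ℓ : ℕ) (R : Set Ω) : ℝ := (∑ t ∈ Finset.range ℓ, ρ.real (Q^[t] ⁻¹' R)) / ℓ

section OrbitAverage

variable {Ω Ω' : Type*} [MeasurableSpace Ω] [MeasurableSpace Ω']

theorem isCharge_orbitAverage {Q : Ω → Ω} (hQ : Measurable Q) (ρ : Measure Ω)
    [IsProbabilityMeasure ρ] {ℓ : ℕ} (hℓ : 0 < ℓ) : IsCharge (orbitAverage Q ρ ℓ) where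
  nonneg A _ := div_nonneg (Finset.sum_nonneg fun _ _ => measureReal_nonneg) (Nat.cast_nonneg _)
  univ := by
    have : (ℓ : ℝ) ≠ 0 := by positivity
    simp [orbitAverage, this]
  union A B hA hB hAB := by
    simp only [orbitAverage, preimage_union]
    rw [← add_div, ← Finset.sum_add_distrib]
    congr 1
    exact Finset.sum_congr rfl fun t _ =>
      measureReal_union (hAB.preimage _) (hQ.iterate t hB)

/-- The difference telescopes to its two end terms; this makes limits with `ℓ → ∞` invariant. -/
theorem abs_orbitAverage_preimage_sub_le {Q : Ω → Ω} (ρ : Measure Ω)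
    [IsProbabilityMeasure ρ] (ℓ : ℕ) (R : Set Ω) :
    |orbitAverage Q ρ ℓ (Q ⁻¹' R) - orbitAverage Q ρ ℓ R| ≤ 1 / ℓ := by
  have h : ∀ t, Q^[t] ⁻¹' (Q ⁻¹' R) = Q^[t + 1] ⁻¹' R := fun t => by
    rw [← preimage_comp, Function.iterate_succ']
  simp only [orbitAverage, h]
  rw [← sub_div, ← Finset.sum_sub_distrib,
    Finset.sum_range_sub (fun t => ρ.real (Q^[t] ⁻¹' R)), abs_div, Nat.abs_cast]
  refine div_le_div_of_nonneg_right ?_ (Nat.cast_nonneg _)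
  rw [abs_le]
  have h1 := fun t => measureReal_le_one (μ := ρ) (s := Q^[t] ⁻¹' R)
  have h2 := fun t => measureReal_nonneg (μ := ρ) (s := Q^[t] ⁻¹' R)
  constructor <;> linarith [h1 0, h2 0, h1 ℓ, h2 ℓ]

theorem orbitAverage_preimage {Q : Ω → Ω} {Q' : Ω' → Ω'} {f : Ω → Ω'} (hf : Measurable f)
    (hQ' : Measurable Q') (h : Function.Semiconj f Q Q') (ρ : Measure Ω) (ℓ : ℕ) {R : Set Ω'}
    (hR : MeasurableSet R) :
    orbitAverage Q ρ ℓ (f ⁻¹' R) = orbitAverage Q' (ρ.map f) ℓ R := by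
  simp only [orbitAverage]
  congr 1
  refine Finset.sum_congr rfl fun t _ => ?_
  rw [map_measureReal_apply hf (hQ'.iterate t hR), ← preimage_comp, ← preimage_comp,
    (h.iterate_right t).comp_eq]

end OrbitAverage

section Cond

open ProbabilityTheory

variable {X : Type*} [MeasurableSpace X] {μ : Measure X} [IsProbabilityMeasure μ] {T : X ≃ᵐ X}

theorem measureReal_cond {G : Set X} (hG : MeasurableSet G) (A : Set X) :
    (μ[|G]).real A = (μ.real G)⁻¹ * μ.real (G ∩ A) := by
  simp only [measureReal_def, cond_apply hG, ENNReal.toReal_mul, ENNReal.toReal_inv]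

/-- The orbit average started from a normalised floor is `μ` conditioned on the column above it, to
which the estimates for nearly invariant sets apply. -/
theorem orbitAverage_cond (hT : MeasurePreserving T μ μ) {G : Set X} (hG : MeasurableSet G)
    {ℓ : ℕ} (hd : (Iio ℓ).PairwiseDisjoint (towerFloor T G)) {A : Set X} (hA : MeasurableSet A) :
    orbitAverage T (μ[|G]) ℓ A
      = μ.real ((⋃ t ∈ Iio ℓ, towerFloor T G t) ∩ A) / (ℓ * μ.real G) := by
  rw [measureReal_orbitUnion_inter hT hG hd hA, orbitAverage]
  simp only [measureReal_cond hG]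
  rw [← Finset.mul_sum]
  rw [div_eq_mul_inv, div_eq_mul_inv, mul_inv]
  ring

end Cond

section Blocks

open ProbabilityTheory

variable {X : Type*} [MeasurableSpace X] {μ : Measure X} [IsProbabilityMeasure μ]

theorem orbitAverage_prod {Y Z : Type*} [MeasurableSpace Y] [MeasurableSpace Z] (S : Y → Y)
    (T : Z → Z) (ρ : Measure Y) (ρ' : Measure Z) [SFinite ρ] [SFinite ρ'] (ℓ : ℕ) (A : Set Y)
    (B : Set Z) : orbitAverage (Prod.map S T) (ρ.prod ρ') ℓ (A ×ˢ B)
      = (∑ t ∈ Finset.range ℓ, ρ.real (S^[t] ⁻¹' A) * ρ'.real (T^[t] ⁻¹' B)) / ℓ := by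
  simp only [orbitAverage, Prod.map_iterate, preimage_prod_map_prod, measureReal_prod_prod]

theorem prod_univ_orbitAverage {Y Z : Type*} [MeasurableSpace Y] [MeasurableSpace Z] (S : Y → Y)
    (T : Z → Z) (ρ : Measure Y) (ρ' : Measure Z) [SFinite ρ] [IsProbabilityMeasure ρ'] (ℓ : ℕ)
    (A : Set Y) : orbitAverage (Prod.map S T) (ρ.prod ρ') ℓ (A ×ˢ univ) = orbitAverage S ρ ℓ A := by
  rw [orbitAverage_prod]
  simp [orbitAverage]

theorem univ_prod_orbitAverage {Y Z : Type*} [MeasurableSpace Y] [MeasurableSpace Z] (S : Y → Y)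
    (T : Z → Z) (ρ : Measure Y) (ρ' : Measure Z) [IsProbabilityMeasure ρ] [SFinite ρ'] (ℓ : ℕ)
    (B : Set Z) : orbitAverage (Prod.map S T) (ρ.prod ρ') ℓ (univ ×ˢ B) = orbitAverage T ρ' ℓ B := by
  rw [orbitAverage_prod]
  simp [orbitAverage]

theorem isProbabilityMeasure_cond_of_pos {G : Set X} (hG : 0 < μ.real G) :
    IsProbabilityMeasure (μ[|G]) :=
  cond_isProbabilityMeasure fun h => hG.ne' (by rw [measureReal_def, h]; rfl)

theorem pos_of_le_mul {c x : ℝ} {ℓ : ℕ} (hc : 0 < c) (h : c ≤ ℓ * x) : 0 < x ∧ 0 < ℓ := by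
  have h1 : 0 < (ℓ : ℝ) * x := hc.trans_le h
  have h2 : 0 < ℓ := by
    rcases Nat.eq_zero_or_pos ℓ with rfl | h
    · simp at h1
    · exact h
  exact ⟨(pos_iff_pos_of_mul_pos h1).1 (Nat.cast_pos.2 h2), h2⟩

namespace IsTowerSeq

variable {T : X ≃ᵐ X} {E : ℕ → Set X} {n : ℕ → ℕ}

theorem orbitAverage_le (h : IsTowerSeq μ T E n) {j a ℓ : ℕ} (ha : a + ℓ ≤ n j) {c : ℝ}
    (hc : 0 < c) (hcℓ : c ≤ ℓ * μ.real (E j)) {A : Set X} (hA : MeasurableSet A) :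
    orbitAverage T (μ[|towerFloor T (E j) a]) ℓ A ≤ μ.real A / c := by
  rw [orbitAverage_cond h.mp (h.floor_meas j a) (h.disj_floor ha) hA, h.floor_measure]
  exact div_le_div₀ measureReal_nonneg (measureReal_mono inter_subset_right) hc hcℓ

/-- A column of floors loses at most one floor per step, hence is nearly invariant and nearly
independent of `A`. Dividing by its mass is harmless because that mass is at least `c`, and the
estimate is uniform in the column. -/
theorem eventually_orbitAverage_sub_le (h : IsTowerSeq μ T E n) {A : Set X}
    (hA : MeasurableSet A) {c ε : ℝ} (hc : 0 < c) (hε : 0 < ε) :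
    ∀ᶠ j in atTop, ∀ a ℓ : ℕ, a + ℓ ≤ n j → c ≤ ℓ * μ.real (E j) →
      |orbitAverage T (μ[|towerFloor T (E j) a]) ℓ A - μ.real A| ≤ ε := by
  obtain ⟨γ, hγ, hC⟩ := h.exists_nearInvariant_inter_le hA (mul_pos hc hε)
  filter_upwards [h.base_tendsto.eventually_lt_const hγ] with j hj a ℓ ha hcℓ
  have h1 := hC _ (measurableSet_orbitUnion T (h.floor_meas j a) ℓ)
    ((measureReal_orbitUnion_diff_preimage_le h.mp (h.floor_meas j a) ℓ).trans
      ((h.floor_measure j a).trans_le hj.le))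
  rw [measureReal_orbitUnion h.mp (h.floor_meas j a) (h.disj_floor ha), h.floor_measure] at h1
  rw [orbitAverage_cond h.mp (h.floor_meas j a) (h.disj_floor ha) hA, h.floor_measure]
  have h2 : 0 < ℓ * μ.real (E j) := hc.trans_le hcℓ
  rw [div_sub' h2.ne', abs_div, abs_of_pos h2, div_le_iff₀ h2]
  refine h1.trans ?_
  rw [mul_comm]
  exact mul_le_mul_of_nonneg_left hcℓ hε.le

theorem _root_.IsAdapted.measureReal_cond_preimage {μ : Measure X} [IsProbabilityMeasure μ]
    {T : X ≃ᵐ X} {E : Set X} (hT : MeasurePreserving T μ μ) (hE : MeasurableSet E)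
    (hpos : 0 < μ.real E) {n : ℕ} {A : Set X} (hA : IsAdapted T E n A) {a t : ℕ} (h : a + t < n)
    [Decidable (towerFloor T E (a + t) ⊆ A)] :
    (μ[|towerFloor T E a]).real (T^[t] ⁻¹' A) = if towerFloor T E (a + t) ⊆ A then 1 else 0 := by
  rw [measureReal_cond (measurableSet_towerFloor T hE a), measureReal_towerFloor hT hE]
  split_ifs with hs
  · rw [inter_eq_self_of_subset_left, measureReal_towerFloor hT hE, inv_mul_cancel₀ hpos.ne']
    intro x hx
    exact hs (iterate_mem_towerFloor t hx)
  · have hd := (hA _ h).resolve_left hs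
    rw [show towerFloor T E a ∩ T^[t] ⁻¹' A = ∅ from ?_]
    · simp
    · refine eq_empty_of_forall_notMem fun x hx => ?_
      exact disjoint_left.1 hd (iterate_mem_towerFloor t hx.1) hx.2

/-- Under mixing, distant pieces of the same tower are asymptotically uncorrelated. -/
theorem eventually_orbitAverage_prod_sub_le (h : IsTowerSeq μ T E n) (hmix : IsMixing μ T)
    {B₁ B₂ : Set X} (h₁ : MeasurableSet B₁) (h₂ : MeasurableSet B₂) {c ε : ℝ} (hc : 0 < c)
    (hε : 0 < ε) :
    ∃ b : ℕ, ∀ᶠ j in atTop, ∀ e e' ℓ : ℕ, e + b ≤ e' → e' + ℓ ≤ n j → c ≤ ℓ * μ.real (E j) →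
      |orbitAverage (Prod.map T T)
        ((μ[|towerFloor T (E j) e]).prod (μ[|towerFloor T (E j) e'])) ℓ (B₁ ×ˢ B₂)
        - μ.real B₁ * μ.real B₂| ≤ ε := by
  classical
  obtain ⟨γ, hγ, b, hC⟩ := hmix.exists_nearInvariant_inter_le h.mp h₁ h₂
    (show 0 < c * ε / 3 by positivity)
  obtain ⟨B₁', hm₁, ha₁, hl₁⟩ := h.approx B₁ h₁
  obtain ⟨B₂', hm₂, ha₂, hl₂⟩ := h.approx B₂ h₂
  refine ⟨b, ?_⟩
  filter_upwards [h.base_tendsto.eventually_lt_const hγ,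
    hl₁.eventually_lt_const (show 0 < c * ε / 6 by positivity),
    hl₂.eventually_lt_const (show 0 < c * ε / 6 by positivity)] with j hj hj1 hj2
    e e' ℓ hee he' hcℓ
  obtain ⟨r, rfl⟩ := Nat.exists_eq_add_of_le (show e ≤ e' by omega)
  have hr : b ≤ r := by omega
  have he : e + ℓ ≤ n j := by omega
  obtain ⟨hE0, hℓ0⟩ := pos_of_le_mul hc hcℓ
  have := isProbabilityMeasure_cond_of_pos ((h.floor_measure j e).symm ▸ hE0)
  have := isProbabilityMeasure_cond_of_pos ((h.floor_measure j (e + r)).symm ▸ hE0)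
  have hch := isCharge_orbitAverage (T.measurable.prodMap T.measurable)
    ((μ[|towerFloor T (E j) e]).prod (μ[|towerFloor T (E j) (e + r)])) hℓ0
  have k1 := hch.abs_prod_sub_le h₁ (hm₁ j) h₂ (hm₂ j)
  rw [prod_univ_orbitAverage, univ_prod_orbitAverage] at k1
  have k2 := h.orbitAverage_le he hc hcℓ (h₁.symmDiff (hm₁ j))
  have k3 := h.orbitAverage_le he' hc hcℓ (h₂.symmDiff (hm₂ j))
  set C := ⋃ t ∈ Iio ℓ, towerFloor T (towerFloor T (E j) e) t with hCdef
  have hCm : MeasurableSet C := measurableSet_orbitUnion T (h.floor_meas j e) ℓ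
  have hCr : μ.real C = ℓ * μ.real (E j) := by
    rw [measureReal_orbitUnion h.mp (h.floor_meas j e) (h.disj_floor he), h.floor_measure]
  have k4 := hC C hCm ((measureReal_orbitUnion_diff_preimage_le h.mp (h.floor_meas j e) ℓ).trans
      ((h.floor_measure j e).trans_le hj.le)) r hr
  have hpre : ∀ A, MeasurableSet A → MeasurableSet (T^[r] ⁻¹' A) := fun A hA =>
    T.measurable.iterate r hA
  have k5 : |μ.real (C ∩ (B₁ ∩ T^[r] ⁻¹' B₂)) - μ.real (C ∩ (B₁' j ∩ T^[r] ⁻¹' B₂' j))|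
      ≤ c * ε / 3 := by
    refine (abs_measureReal_inter_sub_le _ _ _).trans ?_
    have : μ.real ((B₁ ∩ T^[r] ⁻¹' B₂) ∆ (B₁' j ∩ T^[r] ⁻¹' B₂' j))
        ≤ μ.real (B₁ ∆ B₁' j) + μ.real (T^[r] ⁻¹' (B₂ ∆ B₂' j)) := by
      refine (measureReal_mono ?_).trans (measureReal_union_le _ _)
      intro x
      simp only [mem_symmDiff, mem_inter_iff, mem_union, mem_preimage]
      tauto
    rw [(h.mp.iterate r).measureReal_preimage (h₂.symmDiff (hm₂ j)).nullMeasurableSet] at this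
    linarith
  -- On a floor an adapted set has conditional probability `0` or `1`. The product of two such
  -- values is therefore the probability of an intersection, and the product measure may be replaced
  -- by the single column `C` and the set `B₁' ∩ T⁻ʳ B₂'`.
  have k6 : orbitAverage (Prod.map T T)
      ((μ[|towerFloor T (E j) e]).prod (μ[|towerFloor T (E j) (e + r)])) ℓ (B₁' j ×ˢ B₂' j)
      = μ.real (C ∩ (B₁' j ∩ T^[r] ⁻¹' B₂' j)) / (ℓ * μ.real (E j)) := by
    have := orbitAverage_cond h.mp (h.floor_meas j e) (h.disj_floor he)
      ((hm₁ j).inter (hpre _ (hm₂ j)))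
    rw [h.floor_measure] at this
    rw [← this, orbitAverage_prod, orbitAverage]
    congr 1
    refine Finset.sum_congr rfl fun t ht => ?_
    rw [Finset.mem_range] at ht
    rw [(ha₁ j).measureReal_cond_preimage h.mp (h.meas j) hE0 (by omega),
      (ha₂ j).measureReal_cond_preimage h.mp (h.meas j) hE0 (by omega)]
    have e1 : T^[t] ⁻¹' (B₁' j ∩ T^[r] ⁻¹' B₂' j) = T^[t] ⁻¹' B₁' j ∩ T^[r + t] ⁻¹' B₂' j := by
      rw [preimage_inter, ← preimage_comp, ← Function.iterate_add]
    rw [e1, measureReal_cond (h.floor_meas j e), h.floor_measure]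
    by_cases hs₁ : towerFloor T (E j) (e + t) ⊆ B₁' j
    · by_cases hs₂ : towerFloor T (E j) (e + r + t) ⊆ B₂' j
      · rw [if_pos hs₁, if_pos hs₂, inter_eq_self_of_subset_left, h.floor_measure,
          inv_mul_cancel₀ hE0.ne', mul_one]
        intro x hx
        refine ⟨hs₁ (iterate_mem_towerFloor t hx), hs₂ ?_⟩
        rw [add_assoc]
        exact iterate_mem_towerFloor _ hx
      · rw [if_neg hs₂, mul_zero, eq_comm, show towerFloor T (E j) e
          ∩ (T^[t] ⁻¹' B₁' j ∩ T^[r + t] ⁻¹' B₂' j) = ∅ from ?_]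
        · simp
        · refine eq_empty_of_forall_notMem fun x hx => ?_
          refine disjoint_left.1 ((ha₂ j _ (by omega)).resolve_left hs₂) ?_ hx.2.2
          rw [add_assoc]
          exact iterate_mem_towerFloor _ hx.1
    · rw [if_neg hs₁, zero_mul, eq_comm, show towerFloor T (E j) e
          ∩ (T^[t] ⁻¹' B₁' j ∩ T^[r + t] ⁻¹' B₂' j) = ∅ from ?_]
      · simp
      · refine eq_empty_of_forall_notMem fun x hx => ?_
        exact disjoint_left.1 ((ha₁ j _ (by omega)).resolve_left hs₁)
          (iterate_mem_towerFloor _ hx.1) hx.2.1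
  have hpos : 0 < ℓ * μ.real (E j) := hc.trans_le hcℓ
  have k7 : |μ.real (C ∩ (B₁' j ∩ T^[r] ⁻¹' B₂' j)) / (ℓ * μ.real (E j))
      - μ.real B₁ * μ.real B₂| ≤ 2 * ε / 3 := by
    rw [div_sub' hpos.ne', abs_div, abs_of_pos hpos, div_le_iff₀ hpos, ← hCr]
    have : c * ε ≤ μ.real C * ε := mul_le_mul_of_nonneg_right (hCr ▸ hcℓ) hε.le
    rw [abs_le] at k4 k5 ⊢
    constructor <;> linarith
  rw [← k6] at k7
  have k8 : μ.real (B₁ ∆ B₁' j) / c ≤ ε / 6 := by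
    rw [div_le_iff₀ hc]; linarith
  have k9 : μ.real (B₂ ∆ B₂' j) / c ≤ ε / 6 := by
    rw [div_le_iff₀ hc]; linarith
  rw [abs_le] at k1 k7 ⊢
  constructor <;> linarith

end IsTowerSeq

end Blocks

/-! ### Couplings and limits of block charges. -/

/-- A finitely additive joining of `S` and `T`. -/
structure IsCoupling {X : Type*} [MeasurableSpace X] (μ : Measure X) (S T : X ≃ᵐ X)
    (m : Set (X × X) → ℝ) : Prop extends IsCharge m where
  inv : ∀ R, MeasurableSet R → m (Prod.map S T ⁻¹' R) = m R
  fst : ∀ A, MeasurableSet A → m (A ×ˢ Set.univ) = μ.real A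
  snd : ∀ A, MeasurableSet A → m (Set.univ ×ˢ A) = μ.real A

section Coupling

open ProbabilityTheory

variable {X : Type*} [MeasurableSpace X] {μ : Measure X} {S T : X ≃ᵐ X}
  {F E : ℕ → Set X} {k n : ℕ → ℕ}

/-- The charge spread along the orbit of the product of two floors. -/
noncomputable def blockCharge {X : Type*} [MeasurableSpace X] (μ : Measure X) (S T : X ≃ᵐ X)
    (P Q : Set X) (ℓ : ℕ) : Set (X × X) → ℝ :=
  orbitAverage (Prod.map S T) ((μ[|P]).prod (μ[|Q])) ℓ

theorem IsTowerSeq.tendsto_inv_length (hT : IsTowerSeq μ T E n) {c : ℝ} (hc : 0 < c)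
    {ℓ : ℕ → ℕ} (hℓ : ∀ j, c ≤ ℓ j * μ.real (E j)) :
    Tendsto (fun j => 1 / (ℓ j : ℝ)) atTop (𝓝 0) := by
  have h1 : Tendsto (fun j => μ.real (E j) / c) atTop (𝓝 0) := by
    simpa using hT.base_tendsto.div_const c
  refine squeeze_zero (fun j => by positivity) (fun j => ?_) h1
  have h2 := (pos_of_le_mul hc (hℓ j)).2
  rw [div_le_div_iff₀ (by positivity) hc]
  linarith [hℓ j]

/-- The supremum of the values of finitely additive joinings on `A × B`. -/
noncomputable def couplingSup {X : Type*} [MeasurableSpace X] (μ : Measure X) (S T : X ≃ᵐ X)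
    (A B : Set X) : ℝ :=
  sSup {x | ∃ m, IsCoupling μ S T m ∧ m (A ×ˢ B) = x}

theorem IsCoupling.le_couplingSup {A B : Set X} (hA : MeasurableSet A) (hB : MeasurableSet B)
    {m : Set (X × X) → ℝ} (hm : IsCoupling μ S T m) : m (A ×ˢ B) ≤ couplingSup μ S T A B := by
  refine le_csSup ⟨1, ?_⟩ ⟨m, hm, rfl⟩
  rintro x ⟨m, hm, rfl⟩
  exact hm.le_one (hA.prod hB)

theorem IsCoupling.half {m m' : Set (X × X) → ℝ} (hm : IsCoupling μ S T m)
    (hm' : IsCoupling μ S T m') : IsCoupling μ S T fun R => (m R + m' R) / 2 where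
  nonneg A hA := by linarith [hm.nonneg A hA, hm'.nonneg A hA]
  univ := by rw [hm.univ, hm'.univ]; norm_num
  union A B hA hB hAB := by rw [hm.union A B hA hB hAB, hm'.union A B hA hB hAB]; ring
  inv R hR := by rw [hm.inv R hR, hm'.inv R hR]
  fst A hA := by rw [hm.fst A hA, hm'.fst A hA]; ring
  snd A hA := by rw [hm.snd A hA, hm'.snd A hA]; ring

variable [IsProbabilityMeasure μ]

/-- The lower bound `c` on the column masses forces `ℓ j → ∞`, which gives invariance, and
equidistributes both columns, which gives the marginals. -/
theorem isCoupling_of_tendsto (hS : IsTowerSeq μ S F k) (hT : IsTowerSeq μ T E n) {c : ℝ}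
    (hc : 0 < c) {a e ℓ : ℕ → ℕ} (hcS : ∀ j, c ≤ ℓ j * μ.real (F j))
    (hcT : ∀ j, c ≤ ℓ j * μ.real (E j)) (ha : ∀ j, a j + ℓ j ≤ k j) (he : ∀ j, e j + ℓ j ≤ n j)
    {l : Set (X × X) → ℝ} (hl : IsCharge l)
    (hlim : ∀ R, MeasurableSet R → Tendsto (fun j => blockCharge μ S T (towerFloor S (F j) (a j))
      (towerFloor T (E j) (e j)) (ℓ j) R) (hyperfilter ℕ : Filter ℕ) (𝓝 (l R))) :
    IsCoupling μ S T l := by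
  have hle : (hyperfilter ℕ : Filter ℕ) ≤ atTop := Nat.hyperfilter_le_atTop
  have hpS := fun j => isProbabilityMeasure_cond_of_pos
    ((hS.floor_measure j (a j)).symm ▸ (pos_of_le_mul hc (hcS j)).1)
  have hpT := fun j => isProbabilityMeasure_cond_of_pos
    ((hT.floor_measure j (e j)).symm ▸ (pos_of_le_mul hc (hcT j)).1)
  have hequi : ∀ {T' : X ≃ᵐ X} {E' : ℕ → Set X} {n' e' : ℕ → ℕ} (_ : IsTowerSeq μ T' E' n')
      (_ : ∀ j, c ≤ ℓ j * μ.real (E' j)) (_ : ∀ j, e' j + ℓ j ≤ n' j) (A : Set X)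
      (_ : MeasurableSet A), Tendsto (fun j => orbitAverage T' (μ[|towerFloor T' (E' j) (e' j)])
        (ℓ j) A) (hyperfilter ℕ : Filter ℕ) (𝓝 (μ.real A)) := by
    intro T' E' n' e' h' hc' he' A hA
    refine Tendsto.mono_left (Metric.tendsto_atTop'.2 fun ε hε => ?_) hle
    obtain ⟨N, hN⟩ := eventually_atTop.1 (h'.eventually_orbitAverage_sub_le hA hc (half_pos hε))
    refine ⟨N, fun j hj => ?_⟩
    rw [Real.dist_eq]
    have := hN j hj.le (e' j) (ℓ j) (he' j) (hc' j)
    linarith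
  refine ⟨hl, fun R hR => ?_, fun A hA => ?_, fun A hA => ?_⟩
  · have h1 := (hlim _ ((S.measurable.prodMap T.measurable) hR)).sub (hlim R hR)
    have h2 : Tendsto (fun j => blockCharge μ S T (towerFloor S (F j) (a j))
        (towerFloor T (E j) (e j)) (ℓ j) (Prod.map S T ⁻¹' R)
        - blockCharge μ S T (towerFloor S (F j) (a j)) (towerFloor T (E j) (e j)) (ℓ j) R)
        (hyperfilter ℕ : Filter ℕ) (𝓝 0) := by
      refine squeeze_zero_norm (fun j => ?_) ((hT.tendsto_inv_length hc hcT).mono_left hle)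
      exact abs_orbitAverage_preimage_sub_le _ _ _
    linarith [tendsto_nhds_unique h1 h2]
  · refine tendsto_nhds_unique (hlim _ (hA.prod .univ)) ?_
    simp only [blockCharge, prod_univ_orbitAverage]
    exact hequi hS hcS ha A hA
  · refine tendsto_nhds_unique (hlim _ (MeasurableSet.univ.prod hA)) ?_
    simp only [blockCharge, univ_prod_orbitAverage]
    exact hequi hT hcT he A hA

/-- Limits of three-fold block charges. -/
theorem exists_triple_limit (hS : IsTowerSeq μ S F k) (hT : IsTowerSeq μ T E n) {c : ℝ}
    (hc : 0 < c) {a e e' ℓ : ℕ → ℕ} (hcS : ∀ j, c ≤ ℓ j * μ.real (F j))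
    (hcT : ∀ j, c ≤ ℓ j * μ.real (E j)) (ha : ∀ j, a j + ℓ j ≤ k j) (he : ∀ j, e j + ℓ j ≤ n j)
    (he' : ∀ j, e' j + ℓ j ≤ n j) :
    ∃ l : Set (X × X × X) → ℝ, IsCharge l ∧
      IsCoupling μ S T (fun R => l (Prod.map id Prod.fst ⁻¹' R)) ∧
      IsCoupling μ S T (fun R => l (Prod.map id Prod.snd ⁻¹' R)) ∧
      (∀ R, MeasurableSet R → Tendsto (fun j => blockCharge μ S T (towerFloor S (F j) (a j))
        (towerFloor T (E j) (e j)) (ℓ j) R) (hyperfilter ℕ : Filter ℕ)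
        (𝓝 (l (Prod.map id Prod.fst ⁻¹' R)))) ∧
      (∀ R, MeasurableSet R → Tendsto (fun j => blockCharge μ S T (towerFloor S (F j) (a j))
        (towerFloor T (E j) (e' j)) (ℓ j) R) (hyperfilter ℕ : Filter ℕ)
        (𝓝 (l (Prod.map id Prod.snd ⁻¹' R)))) ∧
      (∀ R, MeasurableSet R → Tendsto (fun j => blockCharge μ T T (towerFloor T (E j) (e j))
        (towerFloor T (E j) (e' j)) (ℓ j) R) (hyperfilter ℕ : Filter ℕ)
        (𝓝 (l (Prod.snd ⁻¹' R)))) := by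
  have hpS := fun j => isProbabilityMeasure_cond_of_pos
    ((hS.floor_measure j (a j)).symm ▸ (pos_of_le_mul hc (hcS j)).1)
  have hpT := fun j i => isProbabilityMeasure_cond_of_pos
    ((hT.floor_measure j i).symm ▸ (pos_of_le_mul hc (hcT j)).1)
  have hmTT : Measurable (Prod.map T T) := T.measurable.prodMap T.measurable
  have hmST : Measurable (Prod.map S T) := S.measurable.prodMap T.measurable
  have hm : Measurable (Prod.map S (Prod.map T T)) := S.measurable.prodMap hmTT
  -- One limit is taken on the triple product, so that the three pairwise limits are marginals of a
  -- single charge.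
  obtain ⟨l, hl, hlim⟩ := IsCharge.exists_limit fun j => isCharge_orbitAverage hm
    ((μ[|towerFloor S (F j) (a j)]).prod
      ((μ[|towerFloor T (E j) (e j)]).prod (μ[|towerFloor T (E j) (e' j)])))
    (pos_of_le_mul hc (hcS j)).2
  have hf12 : Measurable (Prod.map id Prod.fst : X × X × X → X × X) :=
    measurable_id.prodMap measurable_fst
  have hf13 : Measurable (Prod.map id Prod.snd : X × X × X → X × X) :=
    measurable_id.prodMap measurable_snd
  have h12 : ∀ R, MeasurableSet R → Tendsto (fun j => blockCharge μ S T
      (towerFloor S (F j) (a j)) (towerFloor T (E j) (e j)) (ℓ j) R)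
      (hyperfilter ℕ : Filter ℕ) (𝓝 (l (Prod.map id Prod.fst ⁻¹' R))) := by
    intro R hR
    refine (hlim _ (hf12 hR)).congr fun j => ?_
    rw [orbitAverage_preimage hf12 hmST (fun x => rfl) _ _ hR, blockCharge,
      ← Measure.map_prod_map _ _ measurable_id measurable_fst, Measure.map_id,
      Measure.map_fst_prod, measure_univ, one_smul]
  have h13 : ∀ R, MeasurableSet R → Tendsto (fun j => blockCharge μ S T
      (towerFloor S (F j) (a j)) (towerFloor T (E j) (e' j)) (ℓ j) R)
      (hyperfilter ℕ : Filter ℕ) (𝓝 (l (Prod.map id Prod.snd ⁻¹' R))) := by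
    intro R hR
    refine (hlim _ (hf13 hR)).congr fun j => ?_
    rw [orbitAverage_preimage hf13 hmST (fun x => rfl) _ _ hR, blockCharge,
      ← Measure.map_prod_map _ _ measurable_id measurable_snd, Measure.map_id,
      Measure.map_snd_prod, measure_univ, one_smul]
  refine ⟨l, hl, isCoupling_of_tendsto hS hT hc hcS hcT ha he (hl.map hf12) h12,
    isCoupling_of_tendsto hS hT hc hcS hcT ha he' (hl.map hf13) h13, h12, h13, fun R hR => ?_⟩
  refine (hlim _ (measurable_snd hR)).congr fun j => ?_
  rw [orbitAverage_preimage measurable_snd hmTT (fun x => rfl) _ _ hR, blockCharge,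
      Measure.map_snd_prod, measure_univ, one_smul]

/-- Blocks violating the bound at infinitely many stages would have as a limit a coupling exceeding
the supremum. -/
theorem eventually_blockCharge_le (hS : IsTowerSeq μ S F k) (hT : IsTowerSeq μ T E n)
    {A B : Set X} (hA : MeasurableSet A) (hB : MeasurableSet B) {c ε : ℝ} (hc : 0 < c)
    (hε : 0 < ε) :
    ∀ᶠ j in atTop, ∀ a e ℓ : ℕ, a + ℓ ≤ k j → e + ℓ ≤ n j → c ≤ ℓ * μ.real (F j) →
      c ≤ ℓ * μ.real (E j) → blockCharge μ S T (towerFloor S (F j) a) (towerFloor T (E j) e) ℓ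
        (A ×ˢ B) ≤ couplingSup μ S T A B + ε := by
  by_contra hcon
  rw [not_eventually] at hcon
  push Not at hcon
  obtain ⟨σ, hσ, hbad⟩ := extraction_of_frequently_atTop hcon
  choose a e ℓ h1 h2 h3 h4 h5 using hbad
  obtain ⟨l, -, hl, -, hlim, -, -⟩ := exists_triple_limit (hS.comp hσ.tendsto_atTop)
    (hT.comp hσ.tendsto_atTop) hc h3 h4 h1 h2 h2
  have h6 := ge_of_tendsto' (hlim _ (hA.prod hB)) fun j => (h5 j).le
  have h7 := hl.le_couplingSup hA hB
  linarith

end Coupling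

/-! ### Decomposition of a coupling into blocks. -/

/-- The union of the rectangles of floors `i < k`, `m < n` whose offset `m - i` lies in `N`. -/
def diagonalUnion {X : Type*} (S T : X → X) (P Q : Set X) (k n : ℕ) (N : Finset ℤ) :
    Set (X × X) :=
  {z | ∃ i < k, ∃ m < n, (m : ℤ) - i ∈ N ∧ z.1 ∈ towerFloor S P i ∧ z.2 ∈ towerFloor T Q m}

section Covering

open ProbabilityTheory

variable {X : Type*} [MeasurableSpace X] {μ : Measure X} {S T : X ≃ᵐ X}

theorem measurableSet_diagonalUnion {P Q : Set X} (hP : MeasurableSet P) (hQ : MeasurableSet Q)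
    (k n : ℕ) (N : Finset ℤ) : MeasurableSet (diagonalUnion S T P Q k n N) := by
  have : diagonalUnion S T P Q k n N = ⋃ i ∈ Iio k, ⋃ m ∈ {m : ℕ | m < n ∧ (m : ℤ) - i ∈ N},
      towerFloor S P i ×ˢ towerFloor T Q m := by
    ext z
    simp only [diagonalUnion, mem_ofPred_eq, mem_iUnion, mem_Iio, mem_prod, exists_prop]
    refine exists_congr fun i => and_congr_right fun _ => exists_congr fun m => ?_
    tauto
  rw [this]
  exact .biUnion (to_countable _) fun i _ => .biUnion (to_countable _) fun m _ =>
    (measurableSet_towerFloor S hP i).prod (measurableSet_towerFloor T hQ m)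

theorem IsCoupling.iterate {m : Set (X × X) → ℝ} (hm : IsCoupling μ S T m) (t : ℕ)
    {R : Set (X × X)} (hR : MeasurableSet R) : m ((Prod.map S T)^[t] ⁻¹' R) = m R := by
  induction t with
  | zero => rfl
  | succ t ih =>
    rw [Function.iterate_succ, preimage_comp, hm.inv, ih]
    exact (S.measurable.prodMap T.measurable).iterate t hR

/-- Invariance makes the mass of floor rectangles constant along diagonals, so a block is described
by its initial rectangle and its length. -/
theorem IsCoupling.floor_add {m : Set (X × X) → ℝ} (hm : IsCoupling μ S T m) {P Q : Set X}
    (hP : MeasurableSet P) (hQ : MeasurableSet Q) (i e t : ℕ) :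
    m (towerFloor S P (i + t) ×ˢ towerFloor T Q (e + t))
      = m (towerFloor S P i ×ˢ towerFloor T Q e) := by
  rw [← hm.iterate t ((measurableSet_towerFloor S hP (i + t)).prod
    (measurableSet_towerFloor T hQ (e + t))), Prod.map_iterate, preimage_prod_map_prod,
    preimage_towerFloor, preimage_towerFloor]

variable [IsProbabilityMeasure μ] {F E : ℕ → Set X} {k n : ℕ → ℕ}

theorem blockCharge_adapted (hS : IsTowerSeq μ S F k) (hT : IsTowerSeq μ T E n) {j a e ℓ : ℕ}
    (hF : 0 < μ.real (F j)) (hE : 0 < μ.real (E j)) (ha : a + ℓ ≤ k j) (he : e + ℓ ≤ n j)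
    {A B : Set X} (hA : IsAdapted S (F j) (k j) A) (hB : IsAdapted T (E j) (n j) B)
    [∀ i, Decidable (towerFloor S (F j) i ⊆ A)] [∀ i, Decidable (towerFloor T (E j) i ⊆ B)] :
    blockCharge μ S T (towerFloor S (F j) a) (towerFloor T (E j) e) ℓ (A ×ˢ B)
      = (∑ t ∈ Finset.range ℓ, (if towerFloor S (F j) (a + t) ⊆ A then (1 : ℝ) else 0)
        * (if towerFloor T (E j) (e + t) ⊆ B then 1 else 0)) / ℓ := by
  rw [blockCharge, orbitAverage_prod]
  congr 1
  refine Finset.sum_congr rfl fun t ht => ?_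
  rw [Finset.mem_range] at ht
  rw [hA.measureReal_cond_preimage hS.mp (hS.meas j) hF (by omega),
    hB.measureReal_cond_preimage hT.mp (hT.meas j) hE (by omega)]

theorem mul_add_lt_of_lt {q L t ℓ k : ℕ} (hL : L * ℓ ≤ k) (hq : q < L) (ht : t < ℓ) :
    q * ℓ + t < k := by
  have := Nat.mul_le_mul_right ℓ (Nat.succ_le_of_lt hq)
  rw [Nat.succ_mul] at this
  omega

/-- The mass of blocks contained in a measurable set. -/
theorem IsCoupling.sum_block_le (hS : IsTowerSeq μ S F k) (hT : IsTowerSeq μ T E n)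
    {m : Set (X × X) → ℝ} (hm : IsCoupling μ S T m) {j L ℓ : ℕ} (hL : L * ℓ ≤ k j)
    {s : Finset (ℕ × ℕ)} (hs : ∀ z ∈ s, z.1 < L ∧ z.2 + ℓ ≤ n j) {U : Set (X × X)}
    (hU : MeasurableSet U) (hsU : ∀ z ∈ s, ∀ t < ℓ,
      towerFloor S (F j) (z.1 * ℓ + t) ×ˢ towerFloor T (E j) (z.2 + t) ⊆ U) :
    ∑ z ∈ s, ℓ * m (towerFloor S (F j) (z.1 * ℓ) ×ˢ towerFloor T (E j) z.2) ≤ m U := by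
  have h1 : ∑ z ∈ s, ℓ * m (towerFloor S (F j) (z.1 * ℓ) ×ˢ towerFloor T (E j) z.2)
      = ∑ y ∈ s ×ˢ Finset.range ℓ,
        m (towerFloor S (F j) (y.1.1 * ℓ + y.2) ×ˢ towerFloor T (E j) (y.1.2 + y.2)) := by
    rw [Finset.sum_product]
    refine Finset.sum_congr rfl fun z _ => ?_
    simp only [hm.floor_add (hS.meas j) (hT.meas j)]
    simp
  rw [h1]
  refine hm.sum_le _ (fun y => (hS.floor_meas j _).prod (hT.floor_meas j _)) ?_ hU fun y hy => ?_
  · rintro ⟨⟨q, e⟩, t⟩ hy ⟨⟨q', e'⟩, t'⟩ hy' hne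
    simp only [Finset.coe_product, mem_prod, Finset.mem_coe, Finset.mem_range] at hy hy'
    have b1 := hs _ hy.1
    have b2 := hs _ hy'.1
    simp only at b1 b2
    refine disjoint_left.2 fun x hx hx' => hne ?_
    -- The rectangles are disjoint: the first floor index `q ℓ + t` determines `q` and `t` by
    -- division with remainder, and then the second determines `e`.
    have c1 := hS.floor_unique (mul_add_lt_of_lt hL b1.1 hy.2) (mul_add_lt_of_lt hL b2.1 hy'.2)
      hx.1 hx'.1
    have c2 : e + t = e' + t' := hT.floor_unique (show e + t < n j by omega)
      (show e' + t' < n j by omega) hx.2 hx'.2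
    have hℓ : 0 < ℓ := by omega
    have d1 : q = q' := by
      have := congrArg (· / ℓ) c1
      simpa [Nat.add_div_of_dvd_right, Nat.mul_add_div, mul_comm _ ℓ, hℓ, Nat.div_eq_of_lt hy.2,
        Nat.div_eq_of_lt hy'.2] using this
    subst d1
    have d2 : t = t' := by omega
    subst d2
    have d3 : e = e' := by omega
    rw [d3]
  · simp only [Finset.mem_product, Finset.mem_range] at hy
    exact hsU _ hy.1 _ hy.2

/-- The mass of a product set is essentially carried by the blocks. -/
theorem IsCoupling.le_sum_block (hS : IsTowerSeq μ S F k) (hT : IsTowerSeq μ T E n)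
    {m : Set (X × X) → ℝ} (hm : IsCoupling μ S T m) {j L ℓ : ℕ} (hℓ : 0 < ℓ) (hL : L * ℓ ≤ k j)
    (hn : 2 * ℓ ≤ n j) (hF : 0 < μ.real (F j)) (hE : 0 < μ.real (E j)) {A B : Set X}
    (hAm : MeasurableSet A) (hBm : MeasurableSet B)
    (hA : IsAdapted S (F j) (k j) A) (hB : IsAdapted T (E j) (n j) B) :
    m (A ×ˢ B) ≤ (1 - L * (ℓ * μ.real (F j))) + (1 - (n j - 2 * ℓ) * μ.real (E j))
      + ∑ z ∈ Finset.range L ×ˢ Finset.range (n j - ℓ + 1),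
        ℓ * m (towerFloor S (F j) (z.1 * ℓ) ×ˢ towerFloor T (E j) z.2)
          * blockCharge μ S T (towerFloor S (F j) (z.1 * ℓ)) (towerFloor T (E j) z.2) ℓ
            (A ×ˢ B) := by
  classical
  set C := ⋃ t ∈ Iio (L * ℓ), towerFloor S (F j) t with hC
  -- The lowest and highest `ℓ` floors of the second tower are discarded, so that the block through
  -- any remaining point stays inside the tower.
  set D := ⋃ t ∈ Iio (n j - 2 * ℓ), towerFloor T (towerFloor T (E j) ℓ) t with hD
  have hCm : MeasurableSet C := measurableSet_orbitUnion S (hS.meas j) _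
  have hDm : MeasurableSet D := measurableSet_orbitUnion T (hT.floor_meas j ℓ) _
  have hCμ : μ.real C = L * (ℓ * μ.real (F j)) := by
    rw [measureReal_orbitUnion hS.mp (hS.meas j) ((hS.disj j).subset (Iio_subset_Iio hL))]
    push_cast; ring
  have hDμ : μ.real D = (n j - 2 * ℓ) * μ.real (E j) := by
    rw [measureReal_orbitUnion hT.mp (hT.floor_meas j ℓ) (hT.disj_floor (by omega)),
      hT.floor_measure]
    push_cast [hn]; ring
  set R : (ℕ × ℕ) × ℕ → Set (X × X) := fun y => (A ×ˢ B) ∩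
    (towerFloor S (F j) (y.1.1 * ℓ + y.2) ×ˢ towerFloor T (E j) (y.1.2 + y.2)) with hR
  have hRm : ∀ y, MeasurableSet (R y) := fun y =>
    (hAm.prod hBm).inter ((hS.floor_meas j _).prod (hT.floor_meas j _))
  set s := Finset.range L ×ˢ Finset.range (n j - ℓ + 1) with hs
  have hcov : A ×ˢ B ⊆ (Cᶜ ×ˢ univ ∪ univ ×ˢ Dᶜ) ∪ ⋃ y ∈ s ×ˢ Finset.range ℓ, R y := by
    rintro ⟨x, y⟩ hxy
    by_cases hx : x ∈ C
    · by_cases hy : y ∈ D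
      · right
        simp only [hC, hD, mem_iUnion, mem_Iio, exists_prop, towerFloor_add] at hx hy
        obtain ⟨i, hi, hx⟩ := hx
        obtain ⟨r, hr, hy⟩ := hy
        have hmod : i % ℓ < ℓ := Nat.mod_lt _ hℓ
        -- The floor `i` of `x` is level `i % ℓ` of piece `i / ℓ`; sliding back by `i % ℓ` gives the
        -- starting floor of the block for `y`.
        refine mem_iUnion₂.2 ⟨((i / ℓ, ℓ + r - i % ℓ), i % ℓ), ?_, hxy, ?_, ?_⟩
        · simp only [hs, Finset.mem_product, Finset.mem_range]
          refine ⟨⟨(Nat.div_lt_iff_lt_mul hℓ).2 hi, by omega⟩, hmod⟩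
        · rwa [Nat.div_add_mod']
        · rwa [Nat.sub_add_cancel (by omega)]
      · exact Or.inl (Or.inr ⟨trivial, hy⟩)
    · exact Or.inl (Or.inl ⟨hx, trivial⟩)
  have hCc : m (Cᶜ ×ˢ univ) = 1 - L * (ℓ * μ.real (F j)) := by
    rw [hm.fst _ hCm.compl, measureReal_compl hCm, hCμ]; simp
  have hDc : m (univ ×ˢ Dᶜ) = 1 - (n j - 2 * ℓ) * μ.real (E j) := by
    rw [hm.snd _ hDm.compl, measureReal_compl hDm, hDμ]; simp
  have hUm : MeasurableSet (⋃ y ∈ s ×ˢ Finset.range ℓ, R y) :=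
    Finset.measurableSet_biUnion _ fun y _ => hRm y
  have m1 : MeasurableSet (Cᶜ ×ˢ (univ : Set X)) := hCm.compl.prod .univ
  have m2 : MeasurableSet ((univ : Set X) ×ˢ Dᶜ) := MeasurableSet.univ.prod hDm.compl
  -- By adaptedness `R` is empty unless both floors lie in `A` and `B`, and all rectangles of a
  -- block have equal mass; so the mass of `A × B` in a block is at most its weight times the
  -- proportion of good levels, which is the block charge.
  have hsum : ∑ y ∈ s ×ˢ Finset.range ℓ, m (R y) ≤ ∑ z ∈ s,
      ℓ * m (towerFloor S (F j) (z.1 * ℓ) ×ˢ towerFloor T (E j) z.2)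
          * blockCharge μ S T (towerFloor S (F j) (z.1 * ℓ)) (towerFloor T (E j) z.2) ℓ
            (A ×ˢ B) := by
    rw [Finset.sum_product]
    refine Finset.sum_le_sum fun z hz => ?_
    simp only [hs, Finset.mem_product, Finset.mem_range] at hz
    have hzk : z.1 * ℓ + ℓ ≤ k j := by
      have := Nat.mul_le_mul_right ℓ (Nat.succ_le_of_lt hz.1)
      rw [Nat.succ_mul] at this
      omega
    rw [blockCharge_adapted hS hT hF hE hzk (by omega) hA hB]
    have hℓ' : (ℓ : ℝ) ≠ 0 := by positivity
    rw [mul_comm (ℓ : ℝ), mul_assoc, mul_div_cancel₀ _ hℓ', Finset.mul_sum]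
    refine Finset.sum_le_sum fun t ht => ?_
    rw [← hm.floor_add (hS.meas j) (hT.meas j) _ _ t]
    by_cases h1 : towerFloor S (F j) (z.1 * ℓ + t) ⊆ A
    · by_cases h2 : towerFloor T (E j) (z.2 + t) ⊆ B
      · rw [if_pos h1, if_pos h2]
        simp only [mul_one]
        exact hm.mono (hRm _) ((hS.floor_meas j _).prod (hT.floor_meas j _)) inter_subset_right
      · rw [if_neg h2, show R (z, t) = ∅ from ?_, hm.empty]
        · simp
        · refine eq_empty_of_forall_notMem fun p hp => ?_
          exact disjoint_left.1 ((hB _ (by have := Finset.mem_range.1 ht; omega)).resolve_left h2)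
            hp.2.2 hp.1.2
    · rw [if_neg h1, show R (z, t) = ∅ from ?_, hm.empty]
      · simp
      · refine eq_empty_of_forall_notMem fun p hp => ?_
        exact disjoint_left.1 ((hA _ (by have := Finset.mem_range.1 ht; omega)).resolve_left h1)
            hp.2.1 hp.1.1
  calc m (A ×ˢ B) ≤ _ := hm.mono (hAm.prod hBm) ((m1.union m2).union hUm) hcov
    _ ≤ _ := hm.union_le (m1.union m2) hUm
    _ ≤ (m (Cᶜ ×ˢ univ) + m (univ ×ˢ Dᶜ)) + ∑ y ∈ s ×ˢ Finset.range ℓ, m (R y) :=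
        add_le_add (hm.union_le m1 m2) (hm.biUnion_le _ hRm)
    _ ≤ _ := by rw [hCc, hDc]; linarith

end Covering

/-! ### Asymptotic sizes of the pieces, and the decomposition for arbitrary sets. -/

section Scales

open ProbabilityTheory

theorem tendsto_natDiv_mul {k : ℕ → ℕ} {x : ℕ → ℝ} {v : ℝ} (hx : Tendsto x atTop (𝓝 0))
    (hx0 : ∀ j, 0 ≤ x j) (hkx : Tendsto (fun j => k j * x j) atTop (𝓝 v)) {L : ℕ} (hL : 0 < L) :
    Tendsto (fun j => (k j / L : ℕ) * x j) atTop (𝓝 (v / L)) := by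
  have h1 : Tendsto (fun j => ((k j % L : ℕ) : ℝ) * x j) atTop (𝓝 0) := by
    refine squeeze_zero (fun j => mul_nonneg (Nat.cast_nonneg _) (hx0 j)) (fun j =>
      mul_le_mul_of_nonneg_right (Nat.cast_le.2 (Nat.mod_lt (k j) hL).le) (hx0 j)) ?_
    simpa using hx.const_mul (L : ℝ)
  have h2 := (hkx.sub h1).div_const (L : ℝ)
  rw [sub_zero] at h2
  refine h2.congr fun j => ?_
  have h3 : (k j : ℝ) = L * (k j / L : ℕ) + (k j % L : ℕ) := by
    exact_mod_cast (Nat.div_add_mod (k j) L).symm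
  have hL' : (L : ℝ) ≠ 0 := by positivity
  rw [h3, add_mul, add_sub_cancel_right, mul_assoc, mul_div_cancel_left₀ _ hL']

variable {X : Type*} [MeasurableSpace X] {μ : Measure X} {S T : X ≃ᵐ X}
variable {F E : ℕ → Set X} {k n : ℕ → ℕ} {β : ℝ}

theorem IsTowerSeq.tendsto_height_mul (hT : IsTowerSeq μ T E n)
    (hβ : Tendsto (fun j => (k j : ℝ) / n j) atTop (𝓝 β)) :
    Tendsto (fun j => k j * μ.real (E j)) atTop (𝓝 β) := by
  have := hβ.mul hT.cover
  rw [mul_one] at this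
  refine this.congr' ?_
  filter_upwards [hT.height.eventually_gt_atTop 0] with j hj
  have : (n j : ℝ) ≠ 0 := by positivity
  field_simp

/-- A piece has mass tending to `1 / L` in the first tower and `β / L` in the second; half the
smaller limit serves as a uniform lower bound. The error `2 β / L` is the mass of the two discarded
end strips of the second tower. -/
theorem eventually_scales (hS : IsTowerSeq μ S F k) (hT : IsTowerSeq μ T E n) (hβ0 : 0 < β)
    (hβ : Tendsto (fun j => (k j : ℝ) / n j) atTop (𝓝 β)) {L : ℕ} (hL : 0 < L)
    (hL2 : 2 * β < L) {ε : ℝ} (hε : 0 < ε) :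
    ∀ᶠ j in atTop, 2 * (k j / L) ≤ n j ∧
      min 1 β / (2 * L) ≤ (k j / L : ℕ) * μ.real (F j) ∧
      min 1 β / (2 * L) ≤ (k j / L : ℕ) * μ.real (E j) ∧
      (1 - L * ((k j / L : ℕ) * μ.real (F j))) + (1 - (n j - 2 * (k j / L : ℕ)) * μ.real (E j))
        ≤ 2 * β / L + ε := by
  have hL0 : (0 : ℝ) < L := Nat.cast_pos.2 hL
  have h1 := tendsto_natDiv_mul hS.base_tendsto (fun _ => measureReal_nonneg) hS.cover hL
  have h2 := tendsto_natDiv_mul hT.base_tendsto (fun _ => measureReal_nonneg)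
    (hT.tendsto_height_mul hβ) hL
  have h3 := ((tendsto_const_nhds (x := (1 : ℝ))).sub (h1.const_mul (L : ℝ))).add
    ((tendsto_const_nhds (x := (1 : ℝ))).sub (hT.cover.sub (h2.const_mul 2)))
  have e1 : min 1 β / (2 * L) < 1 / L := by
    rw [div_lt_div_iff₀ (by positivity) hL0]
    nlinarith [min_le_left 1 β]
  have e2 : min 1 β / (2 * L) < β / L := by
    rw [div_lt_div_iff₀ (by positivity) hL0]
    nlinarith [min_le_right 1 β]
  have e3 : 1 - L * (1 / L : ℝ) + (1 - (1 - 2 * (β / L))) < 2 * β / L + ε := by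
    rw [mul_one_div_cancel hL0.ne']
    have : 2 * (β / L) = 2 * β / L := by ring
    linarith
  have e4 : 2 * (β / L) < 1 := by
    rw [← mul_div_assoc, div_lt_one hL0]; exact hL2
  filter_upwards [h1.eventually_const_lt e1, h2.eventually_const_lt e2,
    h3.eventually_lt_const e3, (h2.const_mul 2).eventually_lt hT.cover e4] with j a1 a2 a3 a4
  refine ⟨?_, a1.le, a2.le, ?_⟩
  · by_contra! hlt
    have : (n j : ℝ) ≤ 2 * (k j / L : ℕ) := by exact_mod_cast hlt.le
    have := mul_le_mul_of_nonneg_right this (measureReal_nonneg (μ := μ) (s := E j))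
    linarith
  · refine le_trans (le_of_eq ?_) a3.le
    ring

variable [IsProbabilityMeasure μ]

theorem isCharge_blockCharge {P Q : Set X} (hP : 0 < μ.real P) (hQ : 0 < μ.real Q) {ℓ : ℕ}
    (hℓ : 0 < ℓ) : IsCharge (blockCharge μ S T P Q ℓ) := by
  have := isProbabilityMeasure_cond_of_pos hP
  have := isProbabilityMeasure_cond_of_pos hQ
  exact isCharge_orbitAverage (S.measurable.prodMap T.measurable) _ hℓ

/-- Up to an error governed by the number `L` of pieces of the first tower, every finitely
additive joining is an average of block charges. -/
theorem eventually_le_sum_block (hS : IsTowerSeq μ S F k) (hT : IsTowerSeq μ T E n)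
    (hβ0 : 0 < β) (hβ : Tendsto (fun j => (k j : ℝ) / n j) atTop (𝓝 β)) {L : ℕ} (hL : 0 < L)
    (hL2 : 2 * β < L) {A B : Set X} (hA : MeasurableSet A) (hB : MeasurableSet B) {ε : ℝ}
    (hε : 0 < ε) :
    ∀ᶠ j in atTop, ∀ m : Set (X × X) → ℝ, IsCoupling μ S T m →
      m (A ×ˢ B) ≤ 2 * β / L + ε +
        ∑ z ∈ Finset.range L ×ˢ Finset.range (n j - k j / L + 1),
        (k j / L : ℕ) * m (towerFloor S (F j) (z.1 * (k j / L)) ×ˢ towerFloor T (E j) z.2)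
          * blockCharge μ S T (towerFloor S (F j) (z.1 * (k j / L))) (towerFloor T (E j) z.2)
            (k j / L) (A ×ˢ B) := by
  obtain ⟨A', hA'm, hA'a, hA'⟩ := hS.approx A hA
  obtain ⟨B', hB'm, hB'a, hB'⟩ := hT.approx B hB
  have hL0 : (0 : ℝ) < L := Nat.cast_pos.2 hL
  set c := min 1 β / (2 * L) with hc
  have hc0 : 0 < c := by positivity
  -- Two thresholds are needed: the marginals of `m` are `μ`, while those of a block charge are
  -- bounded only by `μ / c`.
  have hη : 0 < min (ε / 8) (c * (ε / 8)) := by positivity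
  filter_upwards [eventually_scales hS hT hβ0 hβ hL hL2 (half_pos hε),
    hA'.eventually_lt_const hη, hB'.eventually_lt_const hη] with j ⟨h1, h2, h3, h4⟩ hj1 hj2 m hm
  set ℓ := k j / L with hℓdef
  obtain ⟨hF0, hℓ⟩ := pos_of_le_mul hc0 h2
  have hE0 := (pos_of_le_mul hc0 h3).1
  have hLℓ : L * ℓ ≤ k j := Nat.mul_div_le _ _
  have k1 := hm.le_sum_block hS hT hℓ hLℓ h1 hF0 hE0 (hA'm j) (hB'm j) (hA'a j) (hB'a j)
  have k2 := hm.abs_prod_sub_le hA (hA'm j) hB (hB'm j)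
  rw [hm.fst _ (hA.symmDiff (hA'm j)), hm.snd _ (hB.symmDiff (hB'm j))] at k2
  have g1 : μ.real (A ∆ A' j) < ε / 8 := hj1.trans_le (min_le_left _ _)
  have g2 : μ.real (B ∆ B' j) < ε / 8 := hj2.trans_le (min_le_left _ _)
  have g3 : μ.real (A ∆ A' j) / c ≤ ε / 8 := by
    rw [div_le_iff₀ hc0, mul_comm]; exact (hj1.trans_le (min_le_right _ _)).le
  have g4 : μ.real (B ∆ B' j) / c ≤ ε / 8 := by
    rw [div_le_iff₀ hc0, mul_comm]; exact (hj2.trans_le (min_le_right _ _)).le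
  set s := Finset.range L ×ˢ Finset.range (n j - ℓ + 1)
  have hs : ∀ z ∈ s, z.1 < L ∧ z.2 + ℓ ≤ n j := fun z hz => by
    simp only [s, Finset.mem_product, Finset.mem_range] at hz
    exact ⟨hz.1, by omega⟩
  have hw : ∑ z ∈ s, ℓ * m (towerFloor S (F j) (z.1 * ℓ) ×ˢ towerFloor T (E j) z.2) ≤ 1 :=
    (hm.sum_block_le hS hT hLℓ hs MeasurableSet.univ
      fun _ _ _ _ => subset_univ _).trans hm.univ.le
  have hblk : ∀ z ∈ s, blockCharge μ S T (towerFloor S (F j) (z.1 * ℓ)) (towerFloor T (E j) z.2) ℓ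
      (A' j ×ˢ B' j) ≤ blockCharge μ S T (towerFloor S (F j) (z.1 * ℓ)) (towerFloor T (E j) z.2) ℓ
      (A ×ˢ B) + ε / 4 := by
    intro z hz
    obtain ⟨hz1, hz2⟩ := hs z hz
    have hz1' : z.1 * ℓ + ℓ ≤ k j := by
      have := Nat.mul_le_mul_right ℓ (Nat.succ_le_of_lt hz1)
      rw [Nat.succ_mul] at this
      omega
    have pF : 0 < μ.real (towerFloor S (F j) (z.1 * ℓ)) := (hS.floor_measure j _).symm ▸ hF0
    have pE : 0 < μ.real (towerFloor T (E j) z.2) := (hT.floor_measure j _).symm ▸ hE0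
    have := isProbabilityMeasure_cond_of_pos pF
    have := isProbabilityMeasure_cond_of_pos pE
    have q1 := (isCharge_blockCharge (S := S) (T := T) pF pE hℓ).abs_prod_sub_le
      hA (hA'm j) hB (hB'm j)
    simp only [blockCharge] at q1 ⊢
    rw [prod_univ_orbitAverage, univ_prod_orbitAverage] at q1
    have q2 := hS.orbitAverage_le hz1' hc0 h2 (hA.symmDiff (hA'm j))
    have q3 := hT.orbitAverage_le hz2 hc0 h3 (hB.symmDiff (hB'm j))
    rw [abs_le] at q1
    linarith
  have hsum : ∑ z ∈ s, ℓ * m (towerFloor S (F j) (z.1 * ℓ) ×ˢ towerFloor T (E j) z.2)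
        * blockCharge μ S T (towerFloor S (F j) (z.1 * ℓ)) (towerFloor T (E j) z.2) ℓ
          (A' j ×ˢ B' j)
      ≤ (∑ z ∈ s, ℓ * m (towerFloor S (F j) (z.1 * ℓ) ×ˢ towerFloor T (E j) z.2)
        * blockCharge μ S T (towerFloor S (F j) (z.1 * ℓ)) (towerFloor T (E j) z.2) ℓ
          (A ×ˢ B)) + ε / 4 := by
    have hstep : ∀ z ∈ s, ℓ * m (towerFloor S (F j) (z.1 * ℓ) ×ˢ towerFloor T (E j) z.2)
        * blockCharge μ S T (towerFloor S (F j) (z.1 * ℓ)) (towerFloor T (E j) z.2) ℓ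
          (A' j ×ˢ B' j) ≤ ℓ * m (towerFloor S (F j) (z.1 * ℓ) ×ˢ towerFloor T (E j) z.2)
        * blockCharge μ S T (towerFloor S (F j) (z.1 * ℓ)) (towerFloor T (E j) z.2) ℓ
          (A ×ˢ B) + ℓ * m (towerFloor S (F j) (z.1 * ℓ) ×ˢ towerFloor T (E j) z.2) * (ε / 4) := by
      intro z hz
      rw [← mul_add]
      exact mul_le_mul_of_nonneg_left (hblk z hz) (mul_nonneg (Nat.cast_nonneg _)
        (hm.nonneg _ ((hS.floor_meas j _).prod (hT.floor_meas j _))))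
    refine (Finset.sum_le_sum hstep).trans ?_
    rw [Finset.sum_add_distrib, ← Finset.sum_mul]
    nlinarith
  rw [abs_le] at k2
  linarith

end Scales

/-! ### Concentration of near-maximal couplings. -/

/-- Weighted averages of nearly uncorrelated sequences are small. -/
theorem sum_mul_average_le {s : Finset ℕ} {N b₀ ℓ : ℕ} (hs : s ⊆ Finset.range N) (hℓ : 0 < ℓ)
    {q : ℕ → ℝ} {κ : ℝ} (hκ : 0 ≤ κ)
    (hq0 : ∀ e, 0 ≤ q e) (hqκ : ∀ e ∈ s, q e ≤ κ) (hq1 : ∑ e ∈ s, q e ≤ 1)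
    {g : ℕ → ℕ → ℝ} (hg : ∀ e ∈ s, ∀ t, |g e t| ≤ 1) {ε : ℝ} (hε : 0 ≤ ε)
    (hcorr : ∀ e ∈ s, ∀ e' ∈ s, e + b₀ ≤ e' → (∑ t ∈ Finset.range ℓ, g e t * g e' t) / ℓ ≤ ε)
    {x : ℕ → ℝ} (hx0 : ∀ t, 0 ≤ x t) (hx1 : ∀ t, x t ≤ 1) {δ : ℝ} (hδ : 0 < δ) :
    ∑ e ∈ s, q e * ((∑ t ∈ Finset.range ℓ, x t * g e t) / ℓ)
      ≤ δ / 2 + (ε + 2 * b₀ * κ) / (2 * δ) := by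
  have hℓ0 : (0 : ℝ) < ℓ := Nat.cast_pos.2 hℓ
  set G : ℕ → ℝ := fun t => ∑ e ∈ s, q e * g e t with hG
  have h1 : ∑ e ∈ s, q e * ((∑ t ∈ Finset.range ℓ, x t * g e t) / ℓ)
      = (∑ t ∈ Finset.range ℓ, x t * G t) / ℓ := by
    simp only [hG, Finset.mul_sum, Finset.sum_div]
    rw [Finset.sum_comm]
    exact Finset.sum_congr rfl fun t _ => Finset.sum_congr rfl fun e _ => by ring
  have h2 : ∀ t, x t * G t ≤ δ / 2 + G t ^ 2 / (2 * δ) := fun t => by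
    have a1 : x t * G t ≤ |G t| := by
      refine (le_abs_self _).trans ?_
      rw [abs_mul, abs_of_nonneg (hx0 t)]
      exact mul_le_of_le_one_left (abs_nonneg _) (hx1 t)
    have a2 : δ / 2 + G t ^ 2 / (2 * δ) - |G t| = (δ - |G t|) ^ 2 / (2 * δ) := by
      rw [← sq_abs (G t)]
      field_simp
      ring
    have : 0 ≤ (δ - |G t|) ^ 2 / (2 * δ) := by positivity
    linarith
  -- The second moment of the weighted sum expands into correlations: distant pairs contribute at
  -- most `ε`, and for each `e` the fewer than `b₀`-distant `e'` number at most `2 b₀` and have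
  -- weight at most `κ`.
  have h3 : (∑ t ∈ Finset.range ℓ, G t ^ 2) / ℓ
      = ∑ e ∈ s, ∑ e' ∈ s, q e * q e' * ((∑ t ∈ Finset.range ℓ, g e t * g e' t) / ℓ) := by
    simp only [hG, sq, Finset.sum_mul_sum]
    rw [Finset.sum_comm, Finset.sum_div]
    refine Finset.sum_congr rfl fun e _ => ?_
    rw [Finset.sum_comm, Finset.sum_div]
    refine Finset.sum_congr rfl fun e' _ => ?_
    rw [← mul_div_assoc, Finset.mul_sum]
    congr 1
    exact Finset.sum_congr rfl fun t _ => by ring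
  have hK : ∀ e ∈ s, ∀ e' ∈ s, (∑ t ∈ Finset.range ℓ, g e t * g e' t) / ℓ
      ≤ ε + if Nat.dist e e' < b₀ then 1 else 0 := by
    intro e he e' he'
    split_ifs with hd
    · have : (∑ t ∈ Finset.range ℓ, g e t * g e' t) / ℓ ≤ 1 := by
        rw [div_le_one hℓ0]
        refine (Finset.sum_le_card_nsmul _ _ 1 fun t _ => ?_).trans (by simp)
        refine (le_abs_self _).trans ?_
        rw [abs_mul]
        exact mul_le_one₀ (hg e he t) (abs_nonneg _) (hg e' he' t)
      linarith
    · rw [add_zero]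
      rw [Nat.dist] at hd
      rcases le_total e e' with h | h
      · exact hcorr e he e' he' (by omega)
      · have := hcorr e' he' e he (by omega)
        simpa only [mul_comm] using this
  have h4 : (∑ t ∈ Finset.range ℓ, G t ^ 2) / ℓ ≤ ε + 2 * b₀ * κ := by
    rw [h3]
    have hrow : ∀ e ∈ s, ∑ e' ∈ s, q e * q e' * ((∑ t ∈ Finset.range ℓ, g e t * g e' t) / ℓ)
        ≤ q e * (ε + 2 * b₀ * κ) := by
      intro e he
      calc _ ≤ ∑ e' ∈ s, q e * (q e' * ε + if Nat.dist e e' < b₀ then κ else 0) := by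
            refine Finset.sum_le_sum fun e' he' => ?_
            rw [mul_assoc]
            refine mul_le_mul_of_nonneg_left ?_ (hq0 e)
            refine (mul_le_mul_of_nonneg_left (hK e he e' he') (hq0 e')).trans ?_
            rw [mul_add]
            refine add_le_add le_rfl ?_
            split_ifs
            · simpa using hqκ e' he'
            · simp
        _ = q e * ((∑ e' ∈ s, q e') * ε + ∑ e' ∈ s, if Nat.dist e e' < b₀ then κ else 0) := by
            rw [← Finset.mul_sum, Finset.sum_add_distrib, Finset.sum_mul]
        _ ≤ q e * (ε + 2 * b₀ * κ) := by
            refine mul_le_mul_of_nonneg_left (add_le_add ?_ ?_) (hq0 e)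
            · exact mul_le_of_le_one_left hε hq1
            · rw [← Finset.sum_filter, Finset.sum_const, nsmul_eq_mul]
              refine mul_le_mul_of_nonneg_right ?_ hκ
              have a1 := Finset.card_le_card (Finset.filter_subset_filter
                (fun m => Nat.dist e m < b₀) hs)
              exact_mod_cast a1.trans (card_filter_dist_lt_le N e b₀)
    refine (Finset.sum_le_sum hrow).trans ?_
    rw [← Finset.sum_mul]
    exact mul_le_of_le_one_left (by positivity) hq1
  rw [h1]
  calc (∑ t ∈ Finset.range ℓ, x t * G t) / ℓ
      ≤ (∑ t ∈ Finset.range ℓ, (δ / 2 + G t ^ 2 / (2 * δ))) / ℓ :=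
        div_le_div_of_nonneg_right (Finset.sum_le_sum fun t _ => h2 t) hℓ0.le
    _ = δ / 2 + ((∑ t ∈ Finset.range ℓ, G t ^ 2) / ℓ) / (2 * δ) := by
        have : ∑ t ∈ Finset.range ℓ, (δ / 2 + G t ^ 2 / (2 * δ))
            = ℓ * (δ / 2) + (∑ t ∈ Finset.range ℓ, G t ^ 2) / (2 * δ) := by
          rw [Finset.sum_add_distrib, Finset.sum_div]
          simp
        rw [this]
        field_simp
    _ ≤ _ := by
        have := div_le_div_of_nonneg_right h4 (show 0 ≤ 2 * δ by positivity)
        linarith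

section Concentration

open ProbabilityTheory

variable {X : Type*} [MeasurableSpace X] {μ : Measure X} [IsProbabilityMeasure μ] {S T : X ≃ᵐ X}
  {F E : ℕ → Set X} {k n : ℕ → ℕ} {β : ℝ}

/-- A weighted average of block charges with spread weights is at most the product value. -/
theorem sum_mul_blockCharge_le {P : Set X} {Q : ℕ → Set X} [IsProbabilityMeasure (μ[|P])]
    [∀ e, IsProbabilityMeasure (μ[|Q e])] {A B : Set X} {ℓ b₀ R : ℕ} (hℓ : 0 < ℓ)
    {s : Finset ℕ} (hs : s ⊆ Finset.range R) {w : ℕ → ℝ} {κ δ ε : ℝ} (hκ : 0 ≤ κ) (hδ : 0 < δ)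
    (hε : 0 ≤ ε) (hκδ : 2 * b₀ * κ ≤ δ ^ 2 / 2) (hw0 : ∀ e, 0 ≤ w e) (hwκ : ∀ e ∈ s, w e ≤ κ)
    (hw1 : ∑ e ∈ s, w e ≤ 1)
    (hcorr : ∀ e ∈ s, ∀ e' ∈ s, e + b₀ ≤ e' →
      |orbitAverage (Prod.map T T) ((μ[|Q e]).prod (μ[|Q e'])) ℓ (B ×ˢ B)
        - μ.real B * μ.real B| ≤ δ ^ 2 / 6)
    (hoB : ∀ e ∈ s, |orbitAverage T (μ[|Q e]) ℓ B - μ.real B| ≤ δ ^ 2 / 6)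
    (hoA : |orbitAverage S (μ[|P]) ℓ A - μ.real A| ≤ ε) :
    ∑ e ∈ s, w e * blockCharge μ S T P (Q e) ℓ (A ×ˢ B)
      ≤ (∑ e ∈ s, w e) * (μ.real A * μ.real B + ε) + δ := by
  set x : ℕ → ℝ := fun t => (μ[|P]).real (S^[t] ⁻¹' A) with hx
  set g : ℕ → ℕ → ℝ := fun e t =>
    (μ[|Q e]).real (T^[t] ⁻¹' B) - μ.real B with hg
  have hB0 : 0 ≤ μ.real B := measureReal_nonneg
  have hB1 : μ.real B ≤ 1 := measureReal_le_one
  have k1 := sum_mul_average_le (N := R) (b₀ := b₀) (g := g) (x := x) (q := w) (s := s)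
    (ε := δ ^ 2 / 2) hs hℓ hκ hw0
    hwκ hw1
    (fun e _ t => by
      have h1 : (μ[|Q e]).real (T^[t] ⁻¹' B) ≤ 1 := measureReal_le_one
      have h2 : 0 ≤ (μ[|Q e]).real (T^[t] ⁻¹' B) := measureReal_nonneg
      rw [abs_le]
      constructor <;> simp only [hg] <;> linarith)
    (by positivity)
    (fun e he e' he' hee => by
      have h1 := hcorr e he e' he' hee
      have h2 := hoB e he
      have h3 := hoB e' he'
      rw [orbitAverage_prod] at h1
      rw [orbitAverage] at h2 h3
      have h4 : (∑ t ∈ Finset.range ℓ, g e t * g e' t) / ℓ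
          = (∑ t ∈ Finset.range ℓ, (μ[|Q e]).real (T^[t] ⁻¹' B)
              * (μ[|Q e']).real (T^[t] ⁻¹' B)) / ℓ
            - μ.real B * ((∑ t ∈ Finset.range ℓ,
              (μ[|Q e]).real (T^[t] ⁻¹' B)) / ℓ)
            - μ.real B * ((∑ t ∈ Finset.range ℓ,
              (μ[|Q e']).real (T^[t] ⁻¹' B)) / ℓ)
            + μ.real B * μ.real B := by
        have h5 : ∀ t, g e t * g e' t = (μ[|Q e]).real (T^[t] ⁻¹' B)
              * (μ[|Q e']).real (T^[t] ⁻¹' B)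
            - μ.real B * (μ[|Q e]).real (T^[t] ⁻¹' B)
            - μ.real B * (μ[|Q e']).real (T^[t] ⁻¹' B)
            + μ.real B * μ.real B := fun t => by simp only [hg]; ring
        simp only [h5, Finset.sum_add_distrib, Finset.sum_sub_distrib, ← Finset.mul_sum,
          Finset.sum_const, Finset.card_range, nsmul_eq_mul]
        field_simp
      rw [h4]
      rw [abs_le] at h1 h2 h3
      nlinarith)
    (fun t => measureReal_nonneg) (fun t => measureReal_le_one) hδ
  have k2 : δ / 2 + (δ ^ 2 / 2 + 2 * b₀ * κ) / (2 * δ) ≤ δ := by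
    have : (δ ^ 2 / 2 + 2 * b₀ * κ) / (2 * δ) ≤ δ / 2 := by
      rw [div_le_iff₀ (by positivity)]
      linarith
    linarith
  have k3 : (∑ t ∈ Finset.range ℓ, x t) / ℓ ≤ μ.real A + ε := by
    have := hoA
    rw [abs_le, orbitAverage] at this
    linarith
  -- Centring the second factor splits off the product term; what remains is the average handled by
  -- `sum_mul_average_le`.
  have k4 : ∀ e, blockCharge μ S T P (Q e) ℓ (A ×ˢ B) = (∑ t ∈ Finset.range ℓ, x t * g e t) / ℓ
      + μ.real B * ((∑ t ∈ Finset.range ℓ, x t) / ℓ) := by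
    intro e
    simp only [blockCharge]
    rw [orbitAverage_prod, ← mul_div_assoc, ← add_div, Finset.mul_sum, ← Finset.sum_add_distrib]
    congr 1
    refine Finset.sum_congr rfl fun t _ => ?_
    simp only [hx, hg]
    ring
  have k5 : μ.real B * ((∑ t ∈ Finset.range ℓ, x t) / ℓ) ≤ μ.real A * μ.real B + ε := by
    have := mul_le_mul_of_nonneg_left k3 hB0
    nlinarith
  calc ∑ e ∈ s, w e * blockCharge μ S T P (Q e) ℓ (A ×ˢ B)
      = ∑ e ∈ s, w e * ((∑ t ∈ Finset.range ℓ, x t * g e t) / ℓ)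
        + (∑ e ∈ s, w e) * (μ.real B * ((∑ t ∈ Finset.range ℓ, x t) / ℓ)) := by
        simp only [k4, mul_add, Finset.sum_add_distrib, Finset.sum_mul]
    _ ≤ δ + (∑ e ∈ s, w e) * (μ.real A * μ.real B + ε) :=
        add_le_add (k1.trans k2) (mul_le_mul_of_nonneg_left k5
          (Finset.sum_nonneg fun e _ => hw0 e))
    _ = _ := by ring

/-- If the product joining does not maximise the mass of `A × B`, then near-maximising joinings
concentrate on boundedly many offsets. -/
theorem exists_concentration (hS : IsTowerSeq μ S F k) (hT : IsTowerSeq μ T E n)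
    (hmix : IsMixing μ T) (hβ0 : 0 < β) (hβ : Tendsto (fun j => (k j : ℝ) / n j) atTop (𝓝 β))
    {A B : Set X} (hA : MeasurableSet A) (hB : MeasurableSet B)
    (hθ : μ.real A * μ.real B < couplingSup μ S T A B) {c : ℝ} (hc : 0 < c) :
    ∃ η > 0, ∃ M : ℕ, ∀ᶠ j in atTop, ∀ m : Set (X × X) → ℝ, IsCoupling μ S T m →
      couplingSup μ S T A B - η ≤ m (A ×ˢ B) → ∃ N : Finset ℤ, N.card ≤ M ∧
        1 - c ≤ m (diagonalUnion S T (F j) (E j) (k j) (n j) N) := by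
  classical
  set p := μ.real A * μ.real B with hp
  set σ := couplingSup μ S T A B with hσ
  have hp0 : 0 ≤ p := mul_nonneg measureReal_nonneg measureReal_nonneg
  -- The final comparison bounds `(1 - on) (σ - p)` by a sum of five errors of size at most `ε`,
  -- hence by `c (σ - p)`.
  set ε := c * (σ - p) / 8 with hε
  have hε0 : 0 < ε := by have := sub_pos.2 hθ; positivity
  obtain ⟨L, hLgt⟩ := exists_nat_gt (max (2 * β) (2 * β / ε))
  have hL1 : 2 * β < L := (le_max_left _ _).trans_lt hLgt
  have hL0' : (0 : ℝ) < L := (by positivity : (0 : ℝ) < 2 * β).trans hL1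
  have hL0 : 0 < L := Nat.cast_pos.1 hL0'
  have hL2 : 2 * β / L ≤ ε := by
    have := (le_max_right _ _).trans_lt hLgt
    rw [div_lt_iff₀ hε0] at this
    rw [div_le_iff₀ hL0', mul_comm ε]
    exact this.le
  set γ := min 1 β / (2 * L) with hγ
  have hγ0 : 0 < γ := by positivity
  -- The error `δ` is incurred once for each of the `L` pieces.
  set δ := ε / L with hδ
  have hδ0 : 0 < δ := by positivity
  obtain ⟨b₀, hb₀⟩ := hT.eventually_orbitAverage_prod_sub_le hmix hB hB hγ0
    (show 0 < δ ^ 2 / 6 by positivity)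
  set κ := δ ^ 2 / (4 * b₀ + 4) with hκ
  have hκ0 : 0 < κ := by positivity
  have hκ1 : 2 * b₀ * κ ≤ δ ^ 2 / 2 := by
    have : κ * (4 * b₀ + 4) = δ ^ 2 := by rw [hκ]; field_simp
    linarith
  -- The offsets kept are those of blocks of weight at least `κ`; the weights sum to at most `1`, so
  -- there are at most `1 / κ` of them, whatever `j` is.
  refine ⟨ε, hε0, ⌊1 / κ⌋₊, ?_⟩
  filter_upwards [hb₀, eventually_scales hS hT hβ0 hβ hL0 hL1 hε0,
    eventually_le_sum_block hS hT hβ0 hβ hL0 hL1 hA hB hε0,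
    eventually_blockCharge_le hS hT hA hB hγ0 hε0,
    hS.eventually_orbitAverage_sub_le hA hγ0 hε0,
    hT.eventually_orbitAverage_sub_le hB hγ0 (show 0 < δ ^ 2 / 6 by positivity)]
    with j hcorr ⟨hn, hsF, hsE, _⟩ hsum hblk hoA hoB m hm hmη
  set ℓ := k j / L with hℓdef
  obtain ⟨hF0, hℓ⟩ := pos_of_le_mul hγ0 hsF
  have hE0 := (pos_of_le_mul hγ0 hsE).1
  have hLℓ : L * ℓ ≤ k j := Nat.mul_div_le _ _
  have hℓ0 : (0 : ℝ) < ℓ := Nat.cast_pos.2 hℓ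
  set R := n j - ℓ + 1 with hR
  set w : ℕ → ℕ → ℝ := fun q e =>
    ℓ * m (towerFloor S (F j) (q * ℓ) ×ˢ towerFloor T (E j) e) with hw
  set bl : ℕ → ℕ → ℝ := fun q e => blockCharge μ S T (towerFloor S (F j) (q * ℓ))
    (towerFloor T (E j) e) ℓ (A ×ˢ B) with hbl
  have hw0 : ∀ q e, 0 ≤ w q e := fun q e => mul_nonneg (Nat.cast_nonneg _)
    (hm.nonneg _ ((hS.floor_meas j _).prod (hT.floor_meas j _)))
  have hqk : ∀ q < L, q * ℓ + ℓ ≤ k j := fun q hq => by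
    have := Nat.mul_le_mul_right ℓ (Nat.succ_le_of_lt hq)
    rw [Nat.succ_mul] at this
    omega
  have hpE := fun e => isProbabilityMeasure_cond_of_pos ((hT.floor_measure j e).symm ▸ hE0)
  have hpF := fun e => isProbabilityMeasure_cond_of_pos ((hS.floor_measure j e).symm ▸ hF0)
  have hwsum : ∑ z ∈ Finset.range L ×ˢ Finset.range R, w z.1 z.2 ≤ 1 :=
    (hm.sum_block_le hS hT hLℓ (fun z hz => by
      simp only [Finset.mem_product, Finset.mem_range] at hz
      exact ⟨hz.1, by omega⟩) MeasurableSet.univ fun _ _ _ _ => subset_univ _).trans hm.univ.le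
  rw [Finset.sum_product] at hwsum
  have hwrow : ∀ q ∈ Finset.range L, ∑ e ∈ Finset.range R, w q e ≤ 1 := fun q hq =>
    (Finset.single_le_sum (f := fun q => ∑ e ∈ Finset.range R, w q e)
      (fun q _ => Finset.sum_nonneg fun e _ => hw0 q e) hq).trans hwsum
  have hoff : ∀ q ∈ Finset.range L,
      ∑ e ∈ Finset.range R with ¬ κ ≤ w q e, w q e * bl q e
        ≤ (∑ e ∈ Finset.range R with ¬ κ ≤ w q e, w q e) * (p + ε) + δ := by
    intro q hq
    have hqk' := hqk q (Finset.mem_range.1 hq)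
    set s := (Finset.range R).filter fun e => ¬ κ ≤ w q e with hs
    have hsR : s ⊆ Finset.range R := Finset.filter_subset _ _
    exact sum_mul_blockCharge_le (P := towerFloor S (F j) (q * ℓ)) (Q := towerFloor T (E j))
      (T := T) hℓ hsR hκ0.le hδ0 hε0.le hκ1 (hw0 q)
      (fun e he => (not_le.1 (Finset.mem_filter.1 he).2).le)
      ((Finset.sum_le_sum_of_subset_of_nonneg hsR fun e _ _ => hw0 q e).trans (hwrow q hq))
      (fun e he e' he' hee => by
        have heR' := Finset.mem_range.1 (hsR he')
        exact hcorr e e' ℓ hee (by omega) hsE)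
      (fun e he => by
        have heR := Finset.mem_range.1 (hsR he)
        exact hoB e ℓ (by omega) hsE)
      (hoA (q * ℓ) ℓ hqk' hsF)
  have hon : ∀ q ∈ Finset.range L,
      ∑ e ∈ Finset.range R with κ ≤ w q e, w q e * bl q e
        ≤ (∑ e ∈ Finset.range R with κ ≤ w q e, w q e) * (σ + ε) := by
    intro q hq
    rw [Finset.sum_mul]
    refine Finset.sum_le_sum fun e he => mul_le_mul_of_nonneg_left ?_ (hw0 q e)
    have heR := Finset.mem_range.1 (Finset.mem_filter.1 he).1
    exact hblk _ _ _ (hqk q (Finset.mem_range.1 hq)) (by omega) hsF hsE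
  set on := ∑ q ∈ Finset.range L, ∑ e ∈ Finset.range R with κ ≤ w q e, w q e with hondef
  set off := ∑ q ∈ Finset.range L, ∑ e ∈ Finset.range R with ¬ κ ≤ w q e, w q e with hoffdef
  have honoff : on + off ≤ 1 := by
    refine le_trans (le_of_eq ?_) hwsum
    rw [hondef, hoffdef, ← Finset.sum_add_distrib]
    exact Finset.sum_congr rfl fun q _ => Finset.sum_filter_add_sum_filter_not _ _ _
  have hon0 : 0 ≤ on := Finset.sum_nonneg fun q _ => Finset.sum_nonneg fun e _ => hw0 q e
  have hoff0 : 0 ≤ off := Finset.sum_nonneg fun q _ => Finset.sum_nonneg fun e _ => hw0 q e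
  have htotal : ∑ z ∈ Finset.range L ×ˢ Finset.range R, w z.1 z.2 * bl z.1 z.2
      ≤ on * (σ + ε) + off * (p + ε) + ε := by
    rw [Finset.sum_product]
    calc _ = ∑ q ∈ Finset.range L, (∑ e ∈ Finset.range R with κ ≤ w q e, w q e * bl q e
          + ∑ e ∈ Finset.range R with ¬ κ ≤ w q e, w q e * bl q e) :=
          Finset.sum_congr rfl fun q _ => (Finset.sum_filter_add_sum_filter_not _ _ _).symm
      _ ≤ ∑ q ∈ Finset.range L, ((∑ e ∈ Finset.range R with κ ≤ w q e, w q e) * (σ + ε)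
          + ((∑ e ∈ Finset.range R with ¬ κ ≤ w q e, w q e) * (p + ε) + δ)) :=
          Finset.sum_le_sum fun q hq => add_le_add (hon q hq) (hoff q hq)
      _ = _ := by
          rw [Finset.sum_add_distrib, Finset.sum_add_distrib, ← Finset.sum_mul, ← Finset.sum_mul,
            ← hondef, ← hoffdef, Finset.sum_const, Finset.card_range, nsmul_eq_mul, hδ,
            mul_div_cancel₀ _ hL0'.ne', add_assoc]
  have hmain := hsum m hm
  -- Heavy blocks yield at most about `σ` per unit mass and light ones only about `p < σ`, so a
  -- near-maximal total leaves little mass to the light blocks.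
  have honbig : 1 - c ≤ on := by
    have h1 : σ - ε ≤ 2 * β / L + ε + (on * (σ + ε) + off * (p + ε) + ε) :=
      hmη.trans (hmain.trans (by linarith [htotal]))
    have h2 : off * p ≤ (1 - on) * p := mul_le_mul_of_nonneg_right (by linarith) hp0
    have h3 : (on + off) * ε ≤ ε := mul_le_of_le_one_left hε0.le honoff
    have h4 : (1 - on) * (σ - p) ≤ c * (σ - p) := by
      have : ε * 8 = c * (σ - p) := by rw [hε]; ring
      nlinarith
    have := le_of_mul_le_mul_right h4 (sub_pos.2 hθ)
    linarith
  set Z := (Finset.range L ×ˢ Finset.range R).filter fun z => κ ≤ w z.1 z.2 with hZ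
  have hZsum : ∑ z ∈ Z, w z.1 z.2 = on := by
    rw [hZ, Finset.sum_filter, Finset.sum_product, hondef]
    exact Finset.sum_congr rfl fun q _ => (Finset.sum_filter _ _).symm
  refine ⟨Z.image fun z => (z.2 : ℤ) - (z.1 * ℓ : ℕ), ?_, ?_⟩
  · refine Finset.card_image_le.trans (Nat.le_floor ?_)
    rw [le_div_iff₀ hκ0]
    calc (Z.card : ℝ) * κ = Z.card • κ := by rw [nsmul_eq_mul]
      _ ≤ ∑ z ∈ Z, w z.1 z.2 := Finset.card_nsmul_le_sum _ _ _ fun z hz =>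
          (Finset.mem_filter.1 hz).2
      _ ≤ 1 := by linarith
  · refine honbig.trans (hZsum.symm.le.trans (hm.sum_block_le hS hT hLℓ (fun z hz => ?_)
      (measurableSet_diagonalUnion (hS.meas j) (hT.meas j) _ _ _) fun z hz t ht => ?_))
    · have := (Finset.mem_filter.1 hz).1
      simp only [Finset.mem_product, Finset.mem_range] at this
      exact ⟨this.1, by omega⟩
    · have hz' := (Finset.mem_filter.1 hz).1
      simp only [Finset.mem_product, Finset.mem_range] at hz'
      rintro ⟨x, y⟩ ⟨hx, hy⟩
      refine ⟨z.1 * ℓ + t, mul_add_lt_of_lt hLℓ hz'.1 ht, z.2 + t, by omega, ?_, hx, hy⟩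
      refine Finset.mem_image.2 ⟨z, hz, ?_⟩
      push_cast
      ring

end Concentration

/-! ### The case of a shorter first tower. -/

section ShorterFirst

open ProbabilityTheory

variable {X : Type*} [MeasurableSpace X] {μ : Measure X} {S T : X ≃ᵐ X}
  {F E : ℕ → Set X} {k n : ℕ → ℕ} {β : ℝ}

theorem exists_coupling_gt {A B : Set X} (h : μ.real A * μ.real B < couplingSup μ S T A B)
    {η : ℝ} (hη : 0 < η) :
    ∃ m, IsCoupling μ S T m ∧ couplingSup μ S T A B - η ≤ m (A ×ˢ B) := by
  -- An empty set would have supremum `0` by convention, which cannot exceed a product of measures.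
  have hne : {x | ∃ m, IsCoupling μ S T m ∧ m (A ×ˢ B) = x}.Nonempty := by
    by_contra hem
    rw [not_nonempty_iff_eq_empty] at hem
    rw [couplingSup, hem, Real.sSup_empty] at h
    exact absurd h (not_lt.2 (mul_nonneg measureReal_nonneg measureReal_nonneg))
  obtain ⟨x, ⟨m, hm, rfl⟩, hx⟩ := exists_lt_of_lt_csSup hne
    (show couplingSup μ S T A B - η < _ from sub_lt_self _ hη)
  exact ⟨m, hm, hx.le⟩

variable [IsProbabilityMeasure μ]

/-- If the first towers are shorter, near-maximising joinings have, over a common piece of the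
first tower, two distant offsets whose block charges are nearly maximising. -/
theorem exists_far_blocks (hS : IsTowerSeq μ S F k) (hT : IsTowerSeq μ T E n) (hβ0 : 0 < β)
    (hβ1 : β < 1) (hβ : Tendsto (fun j => (k j : ℝ) / n j) atTop (𝓝 β)) {A B : Set X}
    (hA : MeasurableSet A) (hB : MeasurableSet B)
    (hθ : μ.real A * μ.real B < couplingSup μ S T A B) {η : ℝ} (hη : 0 < η) :
    ∃ L : ℕ, 0 < L ∧ 2 * β < L ∧ ∀ b : ℕ, ∀ᶠ j in atTop, ∃ q < L, ∃ e e' : ℕ, e + b ≤ e' ∧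
      e' + k j / L ≤ n j ∧
      couplingSup μ S T A B - η ≤ blockCharge μ S T (towerFloor S (F j) (q * (k j / L)))
        (towerFloor T (E j) e) (k j / L) (A ×ˢ B) ∧
      couplingSup μ S T A B - η ≤ blockCharge μ S T (towerFloor S (F j) (q * (k j / L)))
        (towerFloor T (E j) e') (k j / L) (A ×ˢ B) := by
  classical
  set σ := couplingSup μ S T A B with hσ
  -- Blocks with near-maximal value will carry mass at least `1 - 3 r`, while bounded windows of
  -- offsets can cover mass at most `β + r`; the choice of `r` makes these incompatible.
  set r := (1 - β) / 8 with hr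
  have hr0 : 0 < r := by rw [hr]; linarith
  set ε := min r (r * η / 4) with hε
  have hε0 : 0 < ε := by positivity
  have hε1 : ε ≤ r := min_le_left _ _
  have hε2 : ε ≤ r * η / 4 := min_le_right _ _
  obtain ⟨m, hm, hmσ⟩ := exists_coupling_gt hθ hε0
  obtain ⟨L, hLgt⟩ := exists_nat_gt (max (2 * β) (2 * β / ε))
  have hL1 : 2 * β < L := (le_max_left _ _).trans_lt hLgt
  have hL0' : (0 : ℝ) < L := (by positivity : (0 : ℝ) < 2 * β).trans hL1
  have hL0 : 0 < L := Nat.cast_pos.1 hL0'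
  have hL2 : 2 * β / L ≤ ε := by
    have := (le_max_right _ _).trans_lt hLgt
    rw [div_lt_iff₀ hε0] at this
    rw [div_le_iff₀ hL0', mul_comm ε]
    exact this.le
  refine ⟨L, hL0, hL1, fun b => ?_⟩
  set γ := min 1 β / (2 * L) with hγ
  have hγ0 : 0 < γ := by positivity
  have hV : Tendsto (fun j => L * ((b + (k j / L : ℕ)) * μ.real (E j))) atTop (𝓝 β) := by
    have h1 := tendsto_natDiv_mul hT.base_tendsto (fun _ => measureReal_nonneg)
      (hT.tendsto_height_mul hβ) hL0
    have h2 := ((hT.base_tendsto.const_mul (b : ℝ)).add h1).const_mul (L : ℝ)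
    rw [mul_zero, zero_add, mul_div_cancel₀ _ hL0'.ne'] at h2
    refine h2.congr fun j => ?_
    ring
  filter_upwards [eventually_scales hS hT hβ0 hβ hL0 hL1 hε0,
    eventually_le_sum_block hS hT hβ0 hβ hL0 hL1 hA hB hε0,
    eventually_le_sum_block hS hT hβ0 hβ hL0 hL1 MeasurableSet.univ MeasurableSet.univ hε0,
    eventually_blockCharge_le hS hT hA hB hγ0 hε0,
    hV.eventually_lt_const (show β < β + r by linarith)]
    with j ⟨hn, hsF, hsE, _⟩ hsum hsum1 hblk hVj
  replace hsum := hsum m hm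
  replace hsum1 := hsum1 m hm
  set ℓ := k j / L with hℓdef
  obtain ⟨hF0, hℓ⟩ := pos_of_le_mul hγ0 hsF
  have hE0 := (pos_of_le_mul hγ0 hsE).1
  have hLℓ : L * ℓ ≤ k j := Nat.mul_div_le _ _
  set s := Finset.range L ×ˢ Finset.range (n j - ℓ + 1) with hs
  set w : ℕ × ℕ → ℝ := fun z =>
    ℓ * m (towerFloor S (F j) (z.1 * ℓ) ×ˢ towerFloor T (E j) z.2) with hw
  set bl : ℕ × ℕ → ℝ := fun z => blockCharge μ S T (towerFloor S (F j) (z.1 * ℓ))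
    (towerFloor T (E j) z.2) ℓ (A ×ˢ B) with hbl
  have hw0 : ∀ z, 0 ≤ w z := fun z => mul_nonneg (Nat.cast_nonneg _)
    (hm.nonneg _ ((hS.floor_meas j _).prod (hT.floor_meas j _)))
  have hsmem : ∀ z ∈ s, z.1 < L ∧ z.2 + ℓ ≤ n j := fun z hz => by
    simp only [s, Finset.mem_product, Finset.mem_range] at hz
    exact ⟨hz.1, by omega⟩
  have hwle : ∑ z ∈ s, w z ≤ 1 := (hm.sum_block_le hS hT hLℓ hsmem MeasurableSet.univ
    fun _ _ _ _ => subset_univ _).trans hm.univ.le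
  -- The decomposition applied to the whole space bounds the total weight from below.
  have hwge : 1 - 2 * ε ≤ ∑ z ∈ s, w z := by
    rw [univ_prod_univ, hm.univ] at hsum1
    have : ∀ z : ℕ × ℕ, blockCharge μ S T (towerFloor S (F j) (z.1 * ℓ))
        (towerFloor T (E j) z.2) ℓ univ = 1 := fun z => (isCharge_blockCharge
          ((hS.floor_measure j _).symm ▸ hF0) ((hT.floor_measure j _).symm ▸ hE0) hℓ).univ
    simp only [this, mul_one] at hsum1
    linarith
  have hσ0 : 0 ≤ σ := (mul_nonneg measureReal_nonneg measureReal_nonneg).trans hθ.le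
  set good := ∑ z ∈ s with σ - η ≤ bl z, w z with hgood
  set bad := ∑ z ∈ s with ¬ σ - η ≤ bl z, w z with hbad
  have hgb : good + bad = ∑ z ∈ s, w z := Finset.sum_filter_add_sum_filter_not _ _ _
  have hgood0 : 0 ≤ good := Finset.sum_nonneg fun z _ => hw0 z
  have hbad0 : 0 ≤ bad := Finset.sum_nonneg fun z _ => hw0 z
  have hupper : ∑ z ∈ s, w z * bl z ≤ good * (σ + ε) + bad * (σ - η) := by
    rw [← Finset.sum_filter_add_sum_filter_not s (fun z => σ - η ≤ bl z), hgood, hbad,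
      Finset.sum_mul, Finset.sum_mul]
    refine add_le_add (Finset.sum_le_sum fun z hz => ?_) (Finset.sum_le_sum fun z hz => ?_)
    · refine mul_le_mul_of_nonneg_left ?_ (hw0 z)
      obtain ⟨h1, h2⟩ := hsmem z (Finset.mem_filter.1 hz).1
      refine hblk _ _ _ ?_ h2 hsF hsE
      have := Nat.mul_le_mul_right ℓ (Nat.succ_le_of_lt h1)
      rw [Nat.succ_mul] at this
      omega
    · exact mul_le_mul_of_nonneg_left (not_le.1 (Finset.mem_filter.1 hz).2).le (hw0 z)
  have hbadr : bad ≤ r := by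
    have h1 : σ - ε ≤ 2 * β / L + ε + ∑ z ∈ s, w z * bl z := hmσ.trans hsum
    have h2 : (good + bad) * σ ≤ σ := mul_le_of_le_one_left hσ0 (hgb ▸ hwle)
    have h3 : good * ε ≤ ε := mul_le_of_le_one_left hε0.le (by linarith)
    have h4 : bad * η ≤ r * η := by nlinarith
    exact le_of_mul_le_mul_right h4 hη
  have hgoodlarge : 1 - 3 * r ≤ good := by linarith
  by_contra! hcon
  set G : ℕ → Finset ℕ := fun q => (Finset.range (n j - ℓ + 1)).filter fun e => σ - η ≤ bl (q, e)
    with hG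
  -- If no two good offsets over the same piece are `b` apart, all of them lie in a window of length
  -- `b` starting at the smallest one.
  have hmin : ∀ q < L, ∃ e₀, ∀ e ∈ G q, e₀ ≤ e ∧ e < e₀ + b := by
    intro q hq
    rcases (G q).eq_empty_or_nonempty with h | h
    · exact ⟨0, by simp [h]⟩
    · refine ⟨(G q).min' h, fun e he => ⟨Finset.min'_le _ _ he, ?_⟩⟩
      by_contra! hlt
      have h1 := (Finset.mem_filter.1 ((G q).min'_mem h))
      have h2 := Finset.mem_filter.1 he
      have h3 := Finset.mem_range.1 h2.1
      exact absurd (hcon q hq _ e hlt (by omega) h1.2) (not_lt.2 h2.2)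
  choose! e₀ he₀ using hmin
  -- `V` contains the second coordinates of all good blocks: `b + ℓ` floors for each of the `L`
  -- pieces, of total mass tending to `β < 1`.
  set V : Set X := ⋃ y ∈ Finset.range L ×ˢ Finset.range (b + ℓ),
    towerFloor T (E j) (e₀ y.1 + y.2) with hVdef
  have hVm : MeasurableSet V := Finset.measurableSet_biUnion _ fun y _ => hT.floor_meas j _
  have hVμ : μ.real V ≤ L * ((b + ℓ) * μ.real (E j)) := by
    refine (measureReal_biUnion_finset_le _ _).trans (le_of_eq ?_)
    simp only [hT.floor_measure, Finset.sum_const, Finset.card_product, Finset.card_range,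
      nsmul_eq_mul]
    push_cast
    ring
  have hgoodV : good ≤ μ.real V := by
    rw [← hm.snd V hVm, hgood]
    refine hm.sum_block_le hS hT hLℓ (fun z hz => hsmem z (Finset.mem_filter.1 hz).1)
      (MeasurableSet.univ.prod hVm) fun z hz t ht => ?_
    rintro ⟨x, y⟩ ⟨-, hy⟩
    refine ⟨trivial, ?_⟩
    obtain ⟨hz1, hz2⟩ := Finset.mem_filter.1 hz
    obtain ⟨h1, h2⟩ := hsmem z hz1
    obtain ⟨h3, h4⟩ := he₀ z.1 h1 z.2 (Finset.mem_filter.2 ⟨Finset.mem_range.2 (by omega), hz2⟩)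
    refine mem_iUnion₂.2 ⟨(z.1, z.2 - e₀ z.1 + t), ?_, ?_⟩
    · simp only [Finset.mem_product, Finset.mem_range]
      exact ⟨h1, by omega⟩
    · simp only
      rwa [show e₀ z.1 + (z.2 - e₀ z.1 + t) = z.2 + t by omega]
  linarith

/-- A finitely additive coupling of `S`, `T`, `T` with nearly maximising `(1,2)` and `(1,3)`
marginals and independent second and third coordinates. -/
theorem exists_independent_triple (hS : IsTowerSeq μ S F k) (hT : IsTowerSeq μ T E n)
    (hmix : IsMixing μ T) (hβ0 : 0 < β)
    (hβ1 : β < 1) (hβ : Tendsto (fun j => (k j : ℝ) / n j) atTop (𝓝 β)) {A B : Set X}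
    (hA : MeasurableSet A) (hB : MeasurableSet B)
    (hθ : μ.real A * μ.real B < couplingSup μ S T A B) {η : ℝ} (hη : 0 < η) :
    ∃ l : Set (X × X × X) → ℝ, IsCharge l ∧
      IsCoupling μ S T (fun R => l (Prod.map id Prod.fst ⁻¹' R)) ∧
      IsCoupling μ S T (fun R => l (Prod.map id Prod.snd ⁻¹' R)) ∧
      couplingSup μ S T A B - η ≤ l (Prod.map id Prod.fst ⁻¹' (A ×ˢ B)) ∧
      couplingSup μ S T A B - η ≤ l (Prod.map id Prod.snd ⁻¹' (A ×ˢ B)) ∧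
      ∀ B₁ B₂, MeasurableSet B₁ → MeasurableSet B₂ →
        l (Prod.snd ⁻¹' (B₁ ×ˢ B₂)) = μ.real B₁ * μ.real B₂ := by
  obtain ⟨L, hL0, hL1, hfar⟩ := exists_far_blocks hS hT hβ0 hβ1 hβ hA hB hθ hη
  set γ := min 1 β / (2 * L) with hγ
  have hL0' : (0 : ℝ) < L := Nat.cast_pos.2 hL0
  have hγ0 : 0 < γ := by positivity
  -- A diagonal choice of stages makes the gap between the two offsets tend to infinity, so that
  -- mixing gives exact independence in the limit.
  obtain ⟨φ, hφ, hφP⟩ := extraction_forall_of_eventually fun b => (hfar b).and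
    (eventually_scales hS hT hβ0 hβ hL0 hL1 one_pos)
  choose hφ1 hφ2 using hφP
  choose q hq e e' hee he' hσ1 hσ2 using hφ1
  have hS' := hS.comp hφ.tendsto_atTop
  have hT' := hT.comp hφ.tendsto_atTop
  obtain ⟨l, hl, hl12, hl13, h12, h13, h23⟩ := exists_triple_limit hS' hT' hγ0
    (a := fun i => q i * (k (φ i) / L)) (e := e) (e' := e') (ℓ := fun i => k (φ i) / L)
    (fun i => (hφ2 i).2.1) (fun i => (hφ2 i).2.2.1)
    (fun i => by
      have h1 := Nat.mul_le_mul_right (k (φ i) / L) (Nat.succ_le_of_lt (hq i))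
      rw [Nat.succ_mul] at h1
      exact h1.trans (Nat.mul_div_le _ _))
    (fun i => le_trans (by have := hee i; omega) (he' i)) he'
  refine ⟨l, hl, hl12, hl13, ge_of_tendsto' (h12 _ (hA.prod hB)) hσ1,
    ge_of_tendsto' (h13 _ (hA.prod hB)) hσ2, fun B₁ B₂ h₁ h₂ => ?_⟩
  refine tendsto_nhds_unique (h23 _ (h₁.prod h₂)) ?_
  refine Tendsto.mono_left (Metric.tendsto_atTop'.2 fun ε hε => ?_) Nat.hyperfilter_le_atTop
  obtain ⟨b, hb⟩ := hT'.eventually_orbitAverage_prod_sub_le hmix h₁ h₂ hγ0 (half_pos hε)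
  obtain ⟨i₀, hi₀⟩ := eventually_atTop.1 hb
  refine ⟨max i₀ b, fun i hi => ?_⟩
  rw [Real.dist_eq]
  have := hi₀ i ((le_max_left _ _).trans hi.le) (e i) (e' i) (k (φ i) / L)
    (by have := hee i; have := (le_max_right i₀ b).trans hi.le; omega) (he' i) (hφ2 i).2.2.1
  rw [blockCharge]
  linarith

/-- Independent coordinates rarely have their offset in a small set. -/
theorem diagonalUnion_le_of_independent (hT : IsTowerSeq μ T E n) {m : Set (X × X) → ℝ}
    (hm : IsCharge m) (hind : ∀ B₁ B₂, MeasurableSet B₁ → MeasurableSet B₂ →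
      m (B₁ ×ˢ B₂) = μ.real B₁ * μ.real B₂) (j : ℕ) (N : Finset ℤ) :
    m (diagonalUnion T T (E j) (E j) (n j) (n j) N) ≤ N.card * μ.real (E j) := by
  -- For each offset there are `n j` rectangles of mass `μ(E j)²`. Only a cover is needed, so
  -- truncating negative indices to `0` does no harm.
  set R : ℤ × ℕ → Set (X × X) := fun z =>
    towerFloor T (E j) z.2 ×ˢ towerFloor T (E j) (z.2 + z.1).toNat with hR
  have hRm : ∀ z, MeasurableSet (R z) := fun z => (hT.floor_meas j _).prod (hT.floor_meas j _)
  have hsub : diagonalUnion T T (E j) (E j) (n j) (n j) N ⊆ ⋃ z ∈ N ×ˢ Finset.range (n j), R z := by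
    rintro ⟨y, y'⟩ ⟨i, hi, i', hi', hN, hy, hy'⟩
    refine mem_iUnion₂.2 ⟨((i' : ℤ) - i, i), ?_, hy, ?_⟩
    · simp only [Finset.mem_product, Finset.mem_range]
      exact ⟨hN, hi⟩
    · simp only
      rwa [show ((i : ℤ) + ((i' : ℤ) - i)).toNat = i' by omega]
  refine (hm.mono (measurableSet_diagonalUnion (hT.meas j) (hT.meas j) _ _ _)
    (Finset.measurableSet_biUnion _ fun z _ => hRm z) hsub).trans ((hm.biUnion_le _ hRm).trans ?_)
  have h1 : ∀ z, m (R z) = μ.real (E j) * μ.real (E j) := fun z => by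
    simp only [hR]
    rw [hind _ _ (hT.floor_meas j _) (hT.floor_meas j _), hT.floor_measure, hT.floor_measure]
  simp only [h1, Finset.sum_const, Finset.card_product, Finset.card_range, nsmul_eq_mul]
  push_cast
  have h2 := mul_le_mul_of_nonneg_left (hT.mul_le_one j)
    (mul_nonneg (Nat.cast_nonneg N.card) (measureReal_nonneg (μ := μ) (s := E j)))
  calc (N.card : ℝ) * n j * (μ.real (E j) * μ.real (E j))
      = N.card * μ.real (E j) * (n j * μ.real (E j)) := by ring
    _ ≤ _ := by linarith

/-- The two pair laws of the independent triple must concentrate on a common set of offsets, which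
ties together two independent coordinates. -/
theorem couplingSup_le_of_lt_one (hS : IsTowerSeq μ S F k) (hT : IsTowerSeq μ T E n)
    (hmix : IsMixing μ T) (hβ0 : 0 < β) (hβ1 : β < 1)
    (hβ : Tendsto (fun j => (k j : ℝ) / n j) atTop (𝓝 β)) {A B : Set X}
    (hA : MeasurableSet A) (hB : MeasurableSet B) :
    couplingSup μ S T A B ≤ μ.real A * μ.real B := by
  by_contra! hθ
  obtain ⟨η, hη, M, hM⟩ := exists_concentration hS hT hmix hβ0 hβ hA hB hθ
    (show (0 : ℝ) < 1 / 8 by norm_num)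
  obtain ⟨l, hl, h12, h13, hσ1, hσ2, hind⟩ :=
    exists_independent_triple hS hT hmix hβ0 hβ1 hβ hA hB hθ hη
  have hsmall : Tendsto (fun j => ((M * M : ℕ) : ℝ) * μ.real (E j)) atTop (𝓝 0) := by
    simpa using hT.base_tendsto.const_mul ((M * M : ℕ) : ℝ)
  obtain ⟨j, hj, hjs⟩ := (hM.and (hsmall.eventually_lt_const
    (show (0 : ℝ) < 1 / 2 by norm_num))).exists
  -- Concentration is applied to the mean of the two marginals, so that the same `N` serves both;
  -- their masses then sum to at least `7 / 4`, and the two events meet in mass at least `3 / 4`.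
  obtain ⟨N, hN, hmass⟩ := hj _ (h12.half h13) (by linarith)
  set U := diagonalUnion S T (F j) (E j) (k j) (n j) N with hU
  have hUm : MeasurableSet U := measurableSet_diagonalUnion (hS.meas j) (hT.meas j) _ _ _
  have m12 : MeasurableSet (Prod.map id Prod.fst ⁻¹' U : Set (X × X × X)) :=
    (measurable_id.prodMap measurable_fst) hUm
  have m13 : MeasurableSet (Prod.map id Prod.snd ⁻¹' U : Set (X × X × X)) :=
    (measurable_id.prodMap measurable_snd) hUm
  have h1 := hl.le_one m12
  have h2 := hl.le_one m13
  have h3 := hl.inter_ge m12 m13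
  set N' := Finset.image₂ (fun a b : ℤ => a - b) N N with hN'
  have hsub : (Prod.map id Prod.fst ⁻¹' U ∩ Prod.map id Prod.snd ⁻¹' U : Set (X × X × X)) ⊆
      Prod.snd ⁻¹' diagonalUnion T T (E j) (E j) (n j) (n j) N' := by
    rintro ⟨x, y, y'⟩ ⟨⟨i, hi, e, he, hd, hx, hy⟩, ⟨i', hi', e', he', hd', hx', hy'⟩⟩
    simp only [Prod.map_apply, id] at hx hy hx' hy'
    obtain rfl := hS.floor_unique hi hi' hx hx'
    exact ⟨e, he, e', he', Finset.mem_image₂.2 ⟨_, hd', _, hd, by ring⟩, hy, hy'⟩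
  have h4 := hl.mono (m12.inter m13) (measurable_snd (measurableSet_diagonalUnion (T := T)
    (hT.meas j) (hT.meas j) _ _ _)) hsub
  have h5 := diagonalUnion_le_of_independent hT (hl.map measurable_snd) hind j N'
  have h6 : (N'.card : ℝ) ≤ ((M * M : ℕ) : ℝ) :=
    Nat.cast_le.2 ((Finset.card_image₂_le _ _ _).trans (Nat.mul_le_mul hN hN))
  have h7 := mul_le_mul_of_nonneg_right h6 (measureReal_nonneg (μ := μ) (s := E j))
  linarith

end ShorterFirst

/-! ### The case of a longer first tower. -/

section LongerFirst

variable {X : Type*} [MeasurableSpace X] {μ : Measure X} [IsProbabilityMeasure μ] {S T : X ≃ᵐ X}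
  {F E : ℕ → Set X} {k n : ℕ → ℕ} {β : ℝ}

/-- Under mixing, the points returning to their own floor after a given time not less than the
height of the tower form a small set. -/
theorem IsTowerSeq.eventually_return_le (hT : IsTowerSeq μ T E n) (hmix : IsMixing μ T) {ε : ℝ}
    (hε : 0 < ε) :
    ∀ᶠ j in atTop, ∀ r ≥ n j,
      μ.real (⋃ i ∈ Iio (n j), towerFloor T (E j ∩ T^[r] ⁻¹' E j) i) ≤ ε := by
  obtain ⟨j₀, hj₀, hj₀'⟩ := ((hT.base_tendsto.eventually_lt_const (half_pos hε)).and
    (hT.cover.eventually_const_lt (show (0 : ℝ) < 1 by norm_num))).exists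
  set A := E j₀ with hAdef
  have hA : MeasurableSet A := hT.meas j₀
  have hA0 : 0 < μ.real A := pos_of_mul_pos_right hj₀' (Nat.cast_nonneg _)
  -- `A` is a fixed set with `0 < μ(A) < ε / 2`. The estimate will read `μ(D) μ(A) ≤ μ(A)² + 4 τ`:
  -- one `τ` from near-invariance of `D`, one from mixing, two from approximating `A`.
  set τ := ε * μ.real A / 12 with hτ
  have hτ0 : 0 < τ := by positivity
  obtain ⟨γ, hγ0, hγ⟩ := hT.exists_nearInvariant_inter_le hA hτ0
  obtain ⟨A', hA'm, hA'a, hA'⟩ := hT.approx A hA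
  have hmixA := (hmix.tendsto_measureReal hT.mp hA hA).eventually_lt_const
    (show μ.real A * μ.real A < μ.real A * μ.real A + τ by linarith)
  obtain ⟨r₀, hr₀⟩ := eventually_atTop.1 hmixA
  filter_upwards [hT.base_tendsto.eventually_lt_const hγ0, hA'.eventually_lt_const hτ0,
    hT.height.eventually_ge_atTop r₀] with j hj hjA hjr r hr
  have hpre : ∀ B : Set X, MeasurableSet B → MeasurableSet (T^[r] ⁻¹' B) :=
    fun B hB => T.measurable.iterate r hB
  have hG : MeasurableSet (E j ∩ T^[r] ⁻¹' E j) := (hT.meas j).inter (hpre _ (hT.meas j))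
  set D := ⋃ i ∈ Iio (n j), towerFloor T (E j ∩ T^[r] ⁻¹' E j) i with hD
  have hDm : MeasurableSet D := measurableSet_orbitUnion T hG _
  have h1 := hγ D hDm ((measureReal_orbitUnion_diff_preimage_le hT.mp hG _).trans
    ((measureReal_mono inter_subset_left).trans hj.le))
  -- A point of `D` is back in its own floor at time `r`, and an adapted set contains the whole
  -- floor once it meets it.
  have h2 : D ∩ A' j ⊆ A' j ∩ T^[r] ⁻¹' A' j := by
    rintro y ⟨hyD, hyA⟩
    simp only [hD, mem_iUnion, mem_Iio, exists_prop] at hyD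
    obtain ⟨i, hi, z, ⟨hzE, hzr⟩, rfl⟩ := hyD
    refine ⟨hyA, ?_⟩
    have hfl : T^[i] z ∈ towerFloor T (E j) i := mem_image_of_mem _ hzE
    have hsub := (hA'a j i hi).resolve_right fun hd => disjoint_left.1 hd hfl hyA
    rw [mem_preimage, ← Function.iterate_add_apply, add_comm, Function.iterate_add_apply]
    exact hsub (mem_image_of_mem _ hzr)
  have h3 : μ.real (D ∩ A) ≤ μ.real (A ∩ T^[r] ⁻¹' A) + (μ.real (A ∆ A' j)
      + μ.real (T^[r] ⁻¹' (A ∆ A' j))) := by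
    refine (measureReal_mono (s₂ := (A ∩ T^[r] ⁻¹' A) ∪ ((A ∆ A' j) ∪ T^[r] ⁻¹' (A ∆ A' j)))
      ?_).trans ((measureReal_union_le _ _).trans (add_le_add le_rfl (measureReal_union_le _ _)))
    rintro y ⟨hyD, hyA⟩
    have := @h2 y
    simp only [mem_inter_iff, mem_preimage, mem_union, mem_symmDiff] at this ⊢
    tauto
  rw [(hT.mp.iterate r).measureReal_preimage (hA.symmDiff (hA'm j)).nullMeasurableSet] at h3
  have h4 := hr₀ r (hjr.trans hr)
  rw [abs_le] at h1
  have h5 : μ.real D * μ.real A ≤ ε * μ.real A := by nlinarith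
  exact le_of_mul_le_mul_right h5 hA0

/-- Comparing offsets at times `0` and `n j` while `x` stays in its longer tower turns concentration
into long returns of `y` to its own floor. -/
theorem couplingSup_le_of_one_lt (hS : IsTowerSeq μ S F k) (hT : IsTowerSeq μ T E n)
    (hmix : IsMixing μ T) (hβ1 : 1 < β)
    (hβ : Tendsto (fun j => (k j : ℝ) / n j) atTop (𝓝 β)) {A B : Set X}
    (hA : MeasurableSet A) (hB : MeasurableSet B) :
    couplingSup μ S T A B ≤ μ.real A * μ.real B := by
  classical
  by_contra! hθ
  have hβ0 : 0 < β := one_pos.trans hβ1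
  set γ := 1 - β⁻¹ with hγ
  have hγ0 : 0 < γ := by rw [hγ]; linarith [inv_lt_one_of_one_lt₀ hβ1]
  have hstrip : Tendsto (fun j => k j * μ.real (F j) - n j * μ.real (F j)) atTop (𝓝 γ) :=
    hS.cover.sub (hS.tendsto_height_mul (by simpa using hβ.inv₀ hβ0.ne'))
  obtain ⟨η, hη, M, hM⟩ := exists_concentration hS hT hmix hβ0 hβ hA hB hθ
    (show 0 < γ / 8 by positivity)
  obtain ⟨m, hm, hmσ⟩ := exists_coupling_gt hθ hη
  obtain ⟨j, hj, hjs, hjr⟩ := (hM.and ((hstrip.eventually_const_lt (half_lt_self hγ0)).and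
    (hT.eventually_return_le hmix (show 0 < γ / (8 * (M * M + 1)) by positivity)))).exists
  obtain ⟨N, hN, hmass⟩ := hj m hm hmσ
  have hnk : n j < k j := by
    by_contra! hle
    have := mul_le_mul_of_nonneg_right (Nat.cast_le (α := ℝ).2 hle)
      (measureReal_nonneg (μ := μ) (s := F j))
    linarith
  set U := diagonalUnion S T (F j) (E j) (k j) (n j) N with hU
  have hUm : MeasurableSet U := measurableSet_diagonalUnion (hS.meas j) (hT.meas j) _ _ _
  -- From these floors `x` can climb `n j` more steps within its tower; their mass tends to `γ = 1 -
  -- 1 / β`.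
  set C := ⋃ i ∈ Iio (k j - n j), towerFloor S (F j) i with hC
  have hCm : MeasurableSet C := measurableSet_orbitUnion S (hS.meas j) _
  have hCμ : μ.real C = k j * μ.real (F j) - n j * μ.real (F j) := by
    rw [measureReal_orbitUnion hS.mp (hS.meas j) ((hS.disj j).subset
      (Iio_subset_Iio (Nat.sub_le _ _))), Nat.cast_sub hnk.le, sub_mul]
  set U' := (Prod.map S T)^[n j] ⁻¹' U with hU'
  have hUm' : MeasurableSet U' := (S.measurable.prodMap T.measurable).iterate _ hUm
  have hmU' : m U' = m U := hm.iterate _ hUm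
  have mC : MeasurableSet (C ×ˢ (univ : Set X)) := hCm.prod .univ
  have k1 := hm.inter_ge hUm hUm'
  have k2 := hm.inter_ge mC (hUm.inter hUm')
  rw [hm.fst C hCm, hCμ] at k2
  set N' := (Finset.image₂ (fun a b : ℤ => a - b) N N).filter fun o => (n j : ℤ) ≤ o with hN'
  set D : ℤ → Set X := fun o =>
    ⋃ i ∈ Iio (n j), towerFloor T (E j ∩ T^[o.toNat] ⁻¹' E j) i with hD
  have hDm : ∀ o, MeasurableSet (D o) := fun o => measurableSet_orbitUnion T
    ((hT.meas j).inter (T.measurable.iterate _ (hT.meas j))) _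
  have hsub : C ×ˢ univ ∩ (U ∩ U') ⊆ univ ×ˢ ⋃ o ∈ N', D o := by
    rintro ⟨x, y⟩ ⟨⟨hxC, -⟩, ⟨i, hi, e, he, hd, hx, hy⟩, ⟨i', hi', e', he', hd', hx', hy'⟩⟩
    rw [Prod.map_iterate] at hx' hy'
    simp only [Prod.map_apply] at hx hy hx' hy'
    simp only [hC, mem_iUnion, mem_Iio, exists_prop] at hxC
    obtain ⟨i₁, hi₁, hx₁⟩ := hxC
    obtain rfl := hS.floor_unique (by omega) hi hx₁ hx
    obtain rfl := hS.floor_unique (by omega) hi' (iterate_mem_towerFloor (n j) hx) hx'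
    obtain ⟨z, hz, rfl⟩ := hy
    have hr : e + n j = e' + (e + n j - e') := by omega
    have hzr : T^[e + n j - e'] z ∈ E j := by
      rw [← Function.iterate_add_apply, add_comm (n j), hr, Function.iterate_add_apply] at hy'
      have := (iterate_mem_towerFloor_iff (T := T) (i := 0) (k := e')).1 (by rwa [zero_add])
      rwa [towerFloor_zero] at this
    -- The return time is positive since `e' < n j`, and a return to the base at a positive time
    -- below `n j` would contradict disjointness of the floors.
    have hbig : n j ≤ e + n j - e' := by
      by_contra! hlt
      have h1 : T^[e + n j - e'] z ∈ towerFloor T (E j) (e + n j - e') := mem_image_of_mem _ hz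
      have h2 : T^[e + n j - e'] z ∈ towerFloor T (E j) 0 := by rwa [towerFloor_zero]
      have := hT.floor_unique hlt (by omega) h1 h2
      omega
    refine ⟨trivial, mem_iUnion₂.2 ⟨((e + n j - e' : ℕ) : ℤ), ?_, ?_⟩⟩
    · refine Finset.mem_filter.2 ⟨Finset.mem_image₂.2 ⟨_, hd, _, hd', ?_⟩, ?_⟩
      · omega
      · exact_mod_cast hbig
    · simp only [hD, Int.toNat_natCast, mem_iUnion, mem_Iio, exists_prop]
      exact ⟨e, he, mem_image_of_mem _ ⟨hz, hzr⟩⟩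
  have hDU : MeasurableSet (⋃ o ∈ N', D o) := Finset.measurableSet_biUnion _ fun o _ => hDm o
  have k3 := hm.mono (mC.inter (hUm.inter hUm')) (MeasurableSet.univ.prod hDU) hsub
  rw [hm.snd _ hDU] at k3
  have k4 : μ.real (⋃ o ∈ N', D o) ≤ γ / 8 := by
    refine (measureReal_biUnion_finset_le _ _).trans ?_
    refine (Finset.sum_le_card_nsmul _ _ (γ / (8 * (M * M + 1))) fun o ho => ?_).trans ?_
    · have := (Finset.mem_filter.1 ho).2
      exact hjr _ (by omega)
    · have h1 : N'.card ≤ M * M := (Finset.card_filter_le _ _).trans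
        ((Finset.card_image₂_le _ _ _).trans (Nat.mul_le_mul hN hN))
      have h2 : (N'.card : ℝ) ≤ M * M := by exact_mod_cast h1
      rw [nsmul_eq_mul, mul_div_assoc', div_le_div_iff₀ (by positivity) (by norm_num)]
      nlinarith
  linarith

end LongerFirst

/-! ### From couplings to joinings, and the atomic case. -/

section Joining

variable {X : Type*} [MeasurableSpace X] {μ : Measure X} [IsProbabilityMeasure μ] {S T : X ≃ᵐ X}
  {ν : Measure (X × X)}

theorem IsJoining.isProbabilityMeasure (hν : IsJoining μ S T ν) : IsProbabilityMeasure ν :=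
  ⟨by rw [← univ_prod_univ, hν.fst_marginal _ .univ, measure_univ]⟩

theorem IsJoining.isCoupling (hν : IsJoining μ S T ν) : IsCoupling μ S T fun R => ν.real R where
  toIsCharge := by
    have := hν.isProbabilityMeasure
    exact IsCharge.measure ν
  inv _ hR := hν.invariant.measureReal_preimage hR.nullMeasurableSet
  fst A hA := by simp only [measureReal_def, hν.fst_marginal A hA]
  snd A hA := by simp only [measureReal_def, hν.snd_marginal A hA]

theorem IsJoining.map_swap (hν : IsJoining μ S T ν) : IsJoining μ T S (ν.map Prod.swap) where
  invariant := by
    refine ⟨T.measurable.prodMap S.measurable, ?_⟩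
    rw [Measure.map_map (T.measurable.prodMap S.measurable) measurable_swap]
    have : Prod.map T S ∘ Prod.swap = Prod.swap ∘ Prod.map S T := rfl
    rw [this, ← Measure.map_map measurable_swap hν.invariant.measurable, hν.invariant.map_eq]
  fst_marginal A hA := by
    rw [Measure.map_apply measurable_swap (hA.prod .univ), preimage_swap_prod,
      hν.snd_marginal A hA]
  snd_marginal A hA := by
    rw [Measure.map_apply measurable_swap (MeasurableSet.univ.prod hA), preimage_swap_prod,
      hν.fst_marginal A hA]

theorem isJoining_prod (hS : MeasurePreserving S μ μ) (hT : MeasurePreserving T μ μ) :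
    IsJoining μ S T (μ.prod μ) where
  invariant := hS.prod hT
  fst_marginal A _ := by simp
  snd_marginal A _ := by simp

/-- A joining which is dominated by the product measure on rectangles is the product measure. -/
theorem IsJoining.eq_prod_of_le (hν : IsJoining μ S T ν)
    (hle : ∀ A B, MeasurableSet A → MeasurableSet B → ν.real (A ×ˢ B) ≤ μ.real A * μ.real B) :
    ν = μ.prod μ := by
  have := hν.isProbabilityMeasure
  refine (Measure.prod_eq fun A B hA hB => ?_).symm
  have key : ν.real (A ×ˢ B) = μ.real A * μ.real B := by
    have hunion : ν.real (A ×ˢ B) + ν.real (A ×ˢ Bᶜ) = μ.real A := by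
      rw [← measureReal_union (Disjoint.set_prod_right disjoint_compl_right A A)
        (hA.prod hB.compl), ← prod_union, union_compl_self]
      exact hν.isCoupling.fst A hA
    have h1 := hle A B hA hB
    have h2 := hle A Bᶜ hA hB.compl
    rw [probReal_compl_eq_one_sub hB] at h2
    -- The two upper bounds add up to `μ(A)`, which is also the sum of the two masses, so neither
    -- can be strict.
    nlinarith
  rw [← ofReal_measureReal, key, ENNReal.ofReal_mul measureReal_nonneg, ofReal_measureReal,
    ofReal_measureReal]

/-- The only joining of two transformations of a point mass is the product measure. -/
theorem IsJoining.eq_prod_of_singleton [MeasurableSingletonClass X] (hν : IsJoining μ S T ν)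
    {x : X} (hx : μ {x} = 1) : ν = μ.prod μ := by
  have := hν.isProbabilityMeasure
  have hnull : ∀ A, MeasurableSet A → x ∉ A → μ.real A = 0 := fun A hA hxA => by
    have : A ⊆ {x}ᶜ := fun y hy hyx => hxA (mem_singleton_iff.1 hyx ▸ hy)
    have h0 : μ {x}ᶜ = 0 := by
      rw [prob_compl_eq_zero_iff (measurableSet_singleton x), hx]
    simp [measureReal_def, measure_mono_null this h0]
  refine hν.eq_prod_of_le fun A B hA hB => ?_
  by_cases hxA : x ∈ A
  · have hA1 : μ.real A = 1 := by
      have := hnull Aᶜ hA.compl (by simpa using hxA)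
      rw [probReal_compl_eq_one_sub hA] at this
      linarith
    rw [hA1, one_mul, ← hν.isCoupling.snd B hB]
    exact measureReal_mono (prod_mono_left (subset_univ A))
  · have hA0 := hnull A hA hxA
    rw [hA0, zero_mul, ← hA0, ← hν.isCoupling.fst A hA]
    exact measureReal_mono (prod_mono_right (subset_univ B))

/-- The atoms of a mixing system have full measure. -/
theorem IsMixing.measure_singleton_eq_one [MeasurableSingletonClass X] (hT : IsMixing μ T) {x : X}
    (hx : μ {x} ≠ 0) : μ {x} = 1 := by
  have hlim := hT {x} {x} (measurableSet_singleton x) (measurableSet_singleton x)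
  have hev : ∀ᶠ m in atTop, μ ({x} ∩ T^[m] '' {x}) = μ {x} := by
    filter_upwards [hlim.eventually_ne (mul_ne_zero hx hx)] with m hm
    rw [image_singleton] at hm ⊢
    -- The intersection is either empty or the whole atom; a positive limit eventually excludes the
    -- former, so `μ{x}² = μ{x}`.
    by_cases h : T^[m] x = x
    · rw [h, inter_self]
    · rw [singleton_inter_eq_empty.2 (by simpa using Ne.symm h), measure_empty] at hm
      exact absurd rfl hm
  have hsq : μ {x} * μ {x} = μ {x} * 1 := by
    rw [mul_one]
    exact tendsto_nhds_unique hlim (tendsto_const_nhds.congr' (hev.mono fun _ h => h.symm))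
  exact (ENNReal.mul_right_inj hx (measure_ne_top μ _)).1 hsq

theorem tendsto_add_one_div_add_one {a b : ℕ → ℕ} {α : ℝ}
    (h : Tendsto (fun j => (a j : ℝ) / b j) atTop (𝓝 α)) (hb : Tendsto b atTop atTop) :
    Tendsto (fun j => ((a j + 1 : ℕ) : ℝ) / (b j + 1 : ℕ)) atTop (𝓝 α) := by
  have hinv : Tendsto (fun j => ((b j : ℝ))⁻¹) atTop (𝓝 0) :=
    tendsto_inv_atTop_zero.comp (tendsto_natCast_atTop_atTop.comp hb)
  have hlim : Tendsto (fun j => ((a j : ℝ) / b j + (b j : ℝ)⁻¹) / (1 + (b j : ℝ)⁻¹)) atTop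
      (𝓝 ((α + 0) / (1 + 0))) :=
    (h.add hinv).div (tendsto_const_nhds.add hinv) (by norm_num)
  rw [add_zero, add_zero, div_one] at hlim
  refine hlim.congr' ?_
  filter_upwards [hb.eventually_gt_atTop 0] with j hj
  have : (0 : ℝ) < b j := Nat.cast_pos.2 hj
  push_cast
  field_simp

theorem IsJoining.eq_prod_of_isMixing_right [StandardBorelSpace X] [NullSingletonClass μ]
    {a b : ℕ → ℕ} {α : ℝ} (hν : IsJoining μ S T ν) (hS : IsRankOne μ S a) (hT : IsRankOne μ T b)
    (hα0 : 0 < α) (hα1 : α ≠ 1) (ratio : Tendsto (fun j => (a j : ℝ) / b j) atTop (𝓝 α))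
    (hmix : IsMixing μ T) : ν = μ.prod μ := by
  obtain ⟨F, hF⟩ := hS.exists_isTowerSeq
  obtain ⟨E, hE⟩ := hT.exists_isTowerSeq
  have hb : Tendsto b atTop atTop :=
    tendsto_atTop.2 fun c => (hE.height.eventually_ge_atTop (c + 1)).mono fun _ h =>
      Nat.succ_le_succ_iff.1 h
  have hratio := tendsto_add_one_div_add_one ratio hb
  refine hν.eq_prod_of_le fun A B hA hB => (hν.isCoupling.le_couplingSup hA hB).trans ?_
  rcases hα1.lt_or_gt with h | h
  · exact couplingSup_le_of_lt_one hF hE hmix hα0 h hratio hA hB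
  · exact couplingSup_le_of_one_lt hF hE hmix h hratio hA hB

/-- An atom of a mixing system carries all the mass, which settles that case; otherwise the
coordinates are swapped if the mixing transformation is the first one. -/
theorem IsJoining.eq_prod_of_isRankOne [StandardBorelSpace X] {a b : ℕ → ℕ} {α : ℝ}
    (hν : IsJoining μ S T ν) (hS : IsRankOne μ S a) (hT : IsRankOne μ T b) (hα0 : 0 < α)
    (hα1 : α ≠ 1) (ratio : Tendsto (fun j => (a j : ℝ) / b j) atTop (𝓝 α))
    (hmix : IsMixing μ T ∨ IsMixing μ S) : ν = μ.prod μ := by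
  by_cases hatom : ∃ x, μ {x} ≠ 0
  · obtain ⟨x, hx⟩ := hatom
    exact hν.eq_prod_of_singleton
      (hmix.elim (·.measure_singleton_eq_one hx) (·.measure_singleton_eq_one hx))
  push Not at hatom
  have : NullSingletonClass μ := ⟨hatom⟩
  rcases hmix with hmix | hmix
  · exact hν.eq_prod_of_isMixing_right hS hT hα0 hα1 ratio hmix
  · have hswap := hν.map_swap.eq_prod_of_isMixing_right hT hS (inv_pos.2 hα0)
      (by simpa using hα1) ((ratio.inv₀ hα0.ne').congr fun j => inv_div _ _) hmix
    have hmap : (ν.map Prod.swap).map Prod.swap = ν := by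
      rw [Measure.map_map measurable_swap measurable_swap, Prod.swap_swap_eq, Measure.map_id]
    rw [← hmap, hswap, Measure.prod_swap]

end Joining

theorem theorem1 {X : Type*} [MeasurableSpace X] [StandardBorelSpace X]
    (μ : Measure X) [IsProbabilityMeasure μ]
    (S T : X ≃ᵐ X) (hS hT : ℕ → ℕ) (α : ℝ)
    (rankOne_S : IsRankOne μ S hS) (rankOne_T : IsRankOne μ T hT)
    (hα : α ∈ Set.Ioo (0 : ℝ) 1)
    (ratio : Tendsto (fun j => (hS j : ℝ) / (hT j : ℝ)) atTop (𝓝 α))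
    (mixing : IsMixing μ T ∨ IsMixing μ S) :
    (∀ ν : Measure (X × X), IsJoining μ S T ν → Ergodic (Prod.map S T) ν → ν = μ.prod μ) ∧
      AreDisjoint μ S T := by
  have key : ∀ ν : Measure (X × X), IsJoining μ S T ν → ν = μ.prod μ := fun ν hν =>
    hν.eq_prod_of_isRankOne rankOne_S rankOne_T hα.1 hα.2.ne ratio mixing
  refine ⟨fun ν hν _ => key ν hν, fun ν => ⟨key ν, ?_⟩⟩
  rintro rfl
  exact isJoining_prod rankOne_S.measurePreserving rankOne_T.measurePreserving
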